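/- **Setting.** A *stoquastic verification circuit* acts on a witness register, on ancillary qubits initialized to $|0\rangle$ and on ancillary qubits initialized to $|+\rangle$; it consists of Toffoli, CNOT and X gates and finally measures one designated qubit in the Hadamard basis, accepting if and only if the outcome is $+$. A *non-negative state* is a unit vector with non-negative amplitudes in the computational basis. Let $\ell,k$ be functions from $\mathbb N$ to $\mathbb N$ and $c,s$ real-valued functions on $\mathbb N$. A promise problem $\mathcal I=(\mathcal I_{\rm yes},\mathcal I_{\rm no})$ over $\{0,1\}^*$ is in $\mathsf{StoqMA}_\ell(k,c,s)$ if * $\ell$ is computable in polynomial time from $1^n$ with unary output (so it is polynomially bounded), $c$ and $s$ are efficiently computable (dyadic approximations to within $2^{-m}$ are computable in time polynomial in $n+m$), $1/2\le s(n)<c(n)\le 1$ for all $n$, and $c(n)-s(n)\ge 1/\mathrm{poly}(n)$; and * there is a polynomial-time Turing machine that maps each $x$ to the description of a stoquastic verification circuit $V_x$ such that, with $n=|x|$, for every $x\in\mathcal I_{\rm yes}\cup\mathcal I_{\rm no}$ the witness register of $V_x$ has $k(n)\ell(n)$ qubits; if $x\in\mathcal I_{\rm yes}$, then there are $\ell(n)$-qubit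 non-negative states $|\psi_1\rangle,\dots,|\psi_{k(n)}\rangle$ such that $V_x$ accepts $|\psi_1\rangle\otimes\cdots\otimes|\psi_{k(n)}\rangle$ with probability at least $c(n)$; and if $x\in\mathcal I_{\rm no}$, then for all $\ell(n)$-qubit non-negative states $|\psi_1\rangle,\dots,|\psi_{k(n)}\rangle$ it accepts $|\psi_1\rangle\otimes\cdots\otimes|\psi_{k(n)}\rangle$ with probability at most $s(n)$. Write $\mathsf{StoqMA}_\ell[k,c,\Delta]:=\mathsf{StoqMA}_\ell(k,c,c-\Delta)$, and let $\mathsf{StoqMA}(k)_{1-\mathrm{negl}}$ be the union of $\mathsf{StoqMA}_\ell[k,1-\epsilon,\Delta]$ over all $\ell$, all $\Delta$ and all negligible $\epsilon$. **Theorem.** Let $k(n)>2$ be a polynomially bounded integer-valued function that is efficiently computable (that is, $1^n\mapsto 1^{k(n)}$ is computable in polynomial time). 1. Let $c_{\mathrm{prod}}$ be any rational constant with $0<c_{\mathrm{prod}}\le 1/3$ (for instance $c_{\mathrm{prod}}=1/3$). For every $\ell$ and all functions $\epsilon,\Delta$ with $0\le\epsilon(n)<1/2$ and $\Delta(n)>0$,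 $$\mathsf{StoqMA}_\ell[k,\,1-\epsilon,\,\Delta]\ \subseteq\ \mathsf{StoqMA}_{k\ell}\Big[2,\ 1-\lambda\epsilon,\ \frac{\gamma\Delta^2}{2}\Big],\qquad \gamma:=\frac{c_{\mathrm{prod}}}{4},\quad \lambda:=\gamma\Delta .$$ In particular, a constant gap $\Delta$ remains constant. 2. $\mathsf{StoqMA}(k)_{1-\mathrm{negl}}=\mathsf{StoqMA}(2)_{1-\mathrm{negl}}$. -/

import Mathlib

/-- The elementary reversible gates on wires indexed by `ι`. -/
inductive StoqGate (ι : Type) : Type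
  | x (target : ι)
  | cnot (control target : ι)
  | toffoli (control₁ control₂ target : ι)

/-- The wires of a gate are pairwise distinct. -/
def StoqGate.IsValid {ι : Type} : StoqGate ι → Prop
  | .x _ => True
  | .cnot a t => a ≠ t
  | .toffoli a b t => a ≠ b ∧ a ≠ t ∧ b ≠ t

/-- The action of a gate on computational-basis strings. Every valid gate is an involution. -/
def StoqGate.act {ι : Type} [DecidableEq ι] : StoqGate ι → (ι → Bool) → (ι → Bool)
  | .x t, z => Function.update z t (!z t)
  | .cnot a t, z => Function.update z t (xor (z t) (z a))
  | .toffoli a b t, z => Function.update z t (xor (z t) (z a && z b))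

/-- A stoquastic verification circuit. The qubits are numbered so that the witness register comes
first, then the ancillas initialized to `|0⟩`, then the ancillas initialized to `|+⟩`. -/
structure StoqCircuit where
  numWitness : ℕ
  numZero : ℕ
  numPlus : ℕ
  gates : List (StoqGate (Fin (numWitness + numZero + numPlus)))
  valid : ∀ g ∈ gates, g.IsValid
  /-- the qubit that is measured in the Hadamard basis -/
  output : Fin (numWitness + numZero + numPlus)

namespace StoqCircuit

/-- The index set of the computational basis of the whole register. -/
abbrev Basis (C : StoqCircuit) : Type :=
  Fin (C.numWitness + C.numZero + C.numPlus) → Bool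

/-- Amplitudes of the initial state `|ψ⟩ ⊗ |0…0⟩ ⊗ |+…+⟩`. -/
noncomputable def initialState (C : StoqCircuit) (ψ : (Fin C.numWitness → Bool) → ℝ) :
    C.Basis → ℝ := fun z =>
  if ∀ j : Fin C.numZero, z (Fin.castAdd C.numPlus (Fin.natAdd C.numWitness j)) = false then
    ψ (fun i => z (Fin.castAdd C.numPlus (Fin.castAdd C.numZero i))) * (√2)⁻¹ ^ C.numPlus
  else 0

/-- Amplitudes after running the gates, the head of the list first. A gate `g` maps `|z⟩` to
`|g z⟩` and is its own inverse, so it turns the amplitudes `φ` into `z ↦ φ (g z)`. -/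
noncomputable def finalState (C : StoqCircuit) (ψ : (Fin C.numWitness → Bool) → ℝ) :
    C.Basis → ℝ :=
  C.gates.foldl (fun φ g z => φ (g.act z)) (C.initialState ψ)

/-- The probability that measuring the output qubit in the Hadamard basis gives `+`: the squared
norm of the projection of the final state by `|+⟩⟨+|` on the output qubit. -/
noncomputable def acceptProb (C : StoqCircuit) (ψ : (Fin C.numWitness → Bool) → ℝ) : ℝ :=
  ∑ z : C.Basis,
    ((C.finalState ψ z + C.finalState ψ (Function.update z C.output (!z C.output))) / 2) ^ 2

end StoqCircuit

/-- A unit vector with non-negative amplitudes on `ℓ` qubits. -/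
def IsNonnegState {ℓ : ℕ} (ψ : (Fin ℓ → Bool) → ℝ) : Prop :=
  (∀ z, 0 ≤ ψ z) ∧ ∑ z, ψ z ^ 2 = 1

/-- The product state `ψ₁ ⊗ ⋯ ⊗ ψₖ` of `ℓ`-qubit states on a register of `w = k * ℓ` qubits, which
consists of `k` consecutive blocks of `ℓ` qubits. -/
noncomputable def productWitness {k ℓ w : ℕ} (h : w = k * ℓ)
    (ψ : Fin k → (Fin ℓ → Bool) → ℝ) : (Fin w → Bool) → ℝ := fun u =>
  ∏ i : Fin k, ψ i fun t => u (Fin.cast h.symm (finProdFinEquiv (i, t)))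

/-- The alphabet in which circuits are written down. -/
inductive CircuitSymbol : Type
  | tick
  | sep
  | x
  | cnot
  | toffoli

/-- A number in unary, followed by an end marker. -/
def CircuitSymbol.unary (n : ℕ) : List CircuitSymbol :=
  List.replicate n .tick ++ [.sep]

/-- The description of a gate: its kind, followed by its wires. -/
def StoqGate.encode {n : ℕ} : StoqGate (Fin n) → List CircuitSymbol
  | .x t => .x :: CircuitSymbol.unary t
  | .cnot a t => .cnot :: (CircuitSymbol.unary a ++ CircuitSymbol.unary t)
  | .toffoli a b t =>
      .toffoli :: (CircuitSymbol.unary a ++ CircuitSymbol.unary b ++ CircuitSymbol.unary t)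

/-- The description of a circuit: the sizes of its three registers, the position of the output
qubit, and the list of its gates. -/
def StoqCircuit.encode (C : StoqCircuit) : List CircuitSymbol :=
  CircuitSymbol.unary C.numWitness ++ CircuitSymbol.unary C.numZero ++
    CircuitSymbol.unary C.numPlus ++ CircuitSymbol.unary C.output ++
    C.gates.flatMap StoqGate.encode

/-- A family of circuits indexed by input strings is uniform: a Turing machine writes down the
description of `V x` on input `x` in time polynomial in `|x|`. -/
def PolyTimeVerifier (V : List Bool → StoqCircuit) : Prop :=
  Nonempty (Turing.TM2ComputableInPolyTime (id : List Bool → List Bool) StoqCircuit.encode V)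

/-- `f` is polynomially bounded and efficiently computable: a Turing machine maps `1ⁿ` to `1^(f n)`
in time polynomial in `n`. -/
def PolyTimeNat (f : ℕ → ℕ) : Prop :=
  Nonempty (Turing.TM2ComputableInPolyTime Computability.unaryEncodeNat
    Computability.unaryEncodeNat f)

/-- A function with non-negative real values is efficiently computable: a Turing machine maps
`(1ⁿ, 1ᵐ)` to the binary expansion of a natural number `a n m` such that `a n m / 2ᵐ` approximates
`r n` to within `2⁻ᵐ`, in time polynomial in `n + m`. -/
def PolyTimeReal (r : ℕ → ℝ) : Prop :=
  ∃ a : ℕ × ℕ → ℕ,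
    Nonempty (Turing.TM2ComputableInPolyTime
      (Computability.encodingProd Computability.unaryEncodingNat
        Computability.unaryEncodingNat).encode
      Computability.encodeNat a) ∧
    ∀ n m : ℕ, |r n - (a (n, m) : ℝ) / 2 ^ m| ≤ 1 / 2 ^ m

/-- A promise problem over the binary alphabet. -/
structure PromiseProblem where
  yes : Set (List Bool)
  no : Set (List Bool)
  disjoint : Disjoint yes no

/-- The class `StoqMA_ℓ(k, c, s)`: `k` unentangled non-negative proofs of `ℓ` qubits each,
completeness `c` and soundness `s`, all parameters being functions of the input length. -/
def StoqMA (ℓ k : ℕ → ℕ) (c s : ℕ → ℝ) : Set PromiseProblem :=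
  {I | PolyTimeNat ℓ ∧ PolyTimeReal c ∧ PolyTimeReal s ∧
    (∀ n, 1 / 2 ≤ s n ∧ s n < c n ∧ c n ≤ 1) ∧
    (∃ p : Polynomial ℕ, ∀ n, 0 < p.eval n ∧ 1 / ((p.eval n : ℕ) : ℝ) ≤ c n - s n) ∧
    ∃ V : List Bool → StoqCircuit, PolyTimeVerifier V ∧
      (∀ x ∈ I.yes, ∃ h : (V x).numWitness = k x.length * ℓ x.length,
        ∃ ψ : Fin (k x.length) → (Fin (ℓ x.length) → Bool) → ℝ,
          (∀ i, IsNonnegState (ψ i)) ∧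
            c x.length ≤ (V x).acceptProb (productWitness h ψ)) ∧
      (∀ x ∈ I.no, ∃ h : (V x).numWitness = k x.length * ℓ x.length,
        ∀ ψ : Fin (k x.length) → (Fin (ℓ x.length) → Bool) → ℝ,
          (∀ i, IsNonnegState (ψ i)) →
            (V x).acceptProb (productWitness h ψ) ≤ s x.length)}

/-- The class `StoqMA_ℓ[k, c, Δ]`, parametrized by the promise gap `Δ = c - s`. -/
def StoqMAGap (ℓ k : ℕ → ℕ) (c Δ : ℕ → ℝ) : Set PromiseProblem :=
  StoqMA ℓ k c (fun n => c n - Δ n)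

/-- `StoqMA(k)` with negligible completeness error: the union of `StoqMA_ℓ[k, 1 - ε, Δ]` over all
proof lengths `ℓ`, all negligible `ε` and all promise gaps `Δ`. The definition of the class forces
`ℓ` to be polynomially bounded, `0 ≤ ε < 1 / 2`, and `Δ` to be at least an inverse polynomial. -/
def StoqMANegl (k : ℕ → ℕ) : Set PromiseProblem :=
  {I | ∃ (ℓ : ℕ → ℕ) (ε Δ : ℕ → ℝ),
    Asymptotics.SuperpolynomialDecay Filter.atTop (fun n : ℕ => (n : ℝ)) ε ∧
      I ∈ StoqMAGap ℓ k (fun n => 1 - ε n) Δ}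

/-! A second proof makes it possible to test whether the first one is a product of `k` states. On
proofs `ψ₀`, `ψ₁` the new verifier runs the given circuit `V` on `ψ₀` with probability `p`; with
probability `1 - p` it draws a uniformly random set `S` of blocks and performs one swap test on the
blocks in `S`.

The projection onto `|+⟩` is `(1 + X) / 2`, so every circuit accepts `ψ` with probability `1/2 + 1/2
⟨ψ, E ψ⟩`, where the permutation `E` runs the gates, flips the output and undoes the gates
(`StoqCircuit.echo`). Both tests fit into one such expectation value if the output is a fresh
control qubit in `|+⟩`: depending on random bits, flipping it inserts either the echo of `V` or the
exchange of the blocks in `S`. Hence the acceptance probability is `p Pr[V accepts ψ₀] + (1 - p)(1/2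
+ F/2)`, where `F` is the average over `S` of the overlap `tr ρ_S σ_S` of the reduced states
(`SwapTest.acceptProb_verifier`). Two copies of an honest product proof have `F = 1`, which gives
completeness `1 - p ε`.

Soundness rests on `SwapTest.totalOverlap_le`: if the squared overlap of a unit vector with every
product vector is at most `B`, then the average of `tr ρ_S²` is at most `(1 + B) / 2`. This is an
induction on the number of blocks through the Schmidt decomposition across the first block. If `V`
accepts `ψ₀` with probability `s + y`, then `B = 1 - y²` is admissible, because acceptance
probabilities of two states with overlap `o` differ by at most `√(1 - o²)`
(`StoqCircuit.sq_acceptProb_sub_le`). Signs in the product vector are harmless: as `ψ₀` is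
non-negative, absolute values only increase the overlap. With an arbitrary second proof this yields
`F ≤ 1 - y² / 4`. So cheating gains at most `p y` in one test and loses `(1 - p) y² / 8` in the
other, which for `p ≤ λ ≤ Δ / 12` costs only a fraction of `λ Δ` (`SwapTest.mixture_le`). The bias
`p` is a dyadic number slightly below `λ`, realized by comparing qubits in `|+⟩` with its digits.

Uniformity requires that this circuit be written down by a Turing machine in polynomial time. The
predicate `PT` is shown to be closed under composition, pairing and folds with intermediate results
of polynomial size; unary and binary arithmetic and the description of circuits follow from that.

For the second claim, `λ ε ≤ ε` stays negligible, and conversely a verifier for two proofs can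
ignore `k - 2` further ones (`StoqCircuit.pad`). -/

section

/-! ### Structured stack programs -/

open Turing

/-- A program for a stack machine with stacks `Γ` and memory `σ`. Halting means leaving it. -/
structure StackProg (K : Type) [DecidableEq K] (Γ : K → Type) (σ : Type) where
  Label : Type
  [fintypeLabel : Fintype Label]
  main : Label
  code : Label → TM2.Stmt Γ Label σ

namespace StackProg

variable {K : Type} [DecidableEq K] {Γ : K → Type} {σ : Type}

/-- Rename the labels of a statement and replace `halt` by `e`. -/
def relabel {L L' : Type} (f : L → L') (e : TM2.Stmt Γ L' σ) :
    TM2.Stmt Γ L σ → TM2.Stmt Γ L' σ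
  | .push k g q => .push k g (relabel f e q)
  | .peek k g q => .peek k g (relabel f e q)
  | .pop k g q => .pop k g (relabel f e q)
  | .load g q => .load g (relabel f e q)
  | .branch g q q' => .branch g (relabel f e q) (relabel f e q')
  | .goto g => .goto (fun s => f (g s))
  | .halt => e

/-- The machine with code `m` goes from one configuration to the other in `n` steps. -/
inductive Steps {L : Type} (m : L → TM2.Stmt Γ L σ) :
    ℕ → TM2.Cfg Γ L σ → TM2.Cfg Γ L σ → Prop
  | refl (c) : Steps m 0 c c
  | step {l s S n c} (h : Steps m n (TM2.stepAux (m l) s S) c) : Steps m (n + 1) ⟨some l, s, S⟩ c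

theorem Steps.trans {L : Type} {m : L → TM2.Stmt Γ L σ} {n n' : ℕ} {c c' c'' : TM2.Cfg Γ L σ}
    (h : Steps m n c c') (h' : Steps m n' c' c'') : Steps m (n + n') c c'' := by
  induction h with
  | refl c => simpa using h'
  | step h ih =>
    rw [Nat.add_right_comm]
    exact .step (ih h')

/-- Running `P` from the memory and stacks `c` leads to `c'` within `t` steps. -/
def Run (P : StackProg K Γ σ) (t : ℕ) (c c' : σ × (∀ k, List (Γ k))) : Prop :=
  ∃ n ≤ t, Steps P.code n ⟨some P.main, c.1, c.2⟩ ⟨none, c'.1, c'.2⟩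

theorem Run.mono {P : StackProg K Γ σ} {t t' : ℕ} {c c' : σ × (∀ k, List (Γ k))}
    (h : P.Run t c c') (ht : t ≤ t') : P.Run t' c c' := by
  obtain ⟨n, hn, h⟩ := h
  exact ⟨n, hn.trans ht, h⟩

theorem stepAux_relabel {L L' : Type} (f : L → L') (e : TM2.Stmt Γ L' σ) (q : TM2.Stmt Γ L σ)
    (s : σ) (S : ∀ k, List (Γ k)) :
    TM2.stepAux (relabel f e q) s S =
      match TM2.stepAux q s S with
      | ⟨some l, s', S'⟩ => ⟨some (f l), s', S'⟩
      | ⟨none, s', S'⟩ => TM2.stepAux e s' S' := by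
  induction q generalizing s S with
  | push k g q ih => simp [relabel, TM2.stepAux, ih]
  | peek k g q ih => simp [relabel, TM2.stepAux, ih]
  | pop k g q ih => simp [relabel, TM2.stepAux, ih]
  | load g q ih => simp [relabel, TM2.stepAux, ih]
  | branch g q q' ih ih' => cases h : g s <;> simp [relabel, TM2.stepAux, ih, ih', h]
  | goto g => simp [relabel, TM2.stepAux]
  | halt => simp [relabel, TM2.stepAux]

/-- A program embedded in a larger one runs as it does alone until it halts. -/
theorem Steps.embed {L L' : Type} {m : L → TM2.Stmt Γ L σ} {m' : L' → TM2.Stmt Γ L' σ}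
    (f : L → L') (e : TM2.Stmt Γ L' σ) (hm : ∀ l, m' (f l) = relabel f e (m l))
    {n : ℕ} {l : L} {s s' : σ} {S S' : ∀ k, List (Γ k)}
    (h : Steps m n ⟨some l, s, S⟩ ⟨none, s', S'⟩) :
    Steps m' n ⟨some (f l), s, S⟩ (TM2.stepAux e s' S') := by
  induction n generalizing l s S with
  | zero => cases h
  | succ n ih =>
    cases h with
    | step h =>
      refine .step ?_
      rw [hm, stepAux_relabel]
      rcases hc : TM2.stepAux (m l) s S with ⟨_ | l₁, s₁, S₁⟩
      · rw [hc] at h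
        cases h
        exact .refl _
      · rw [hc] at h
        exact ih h

/-- A single statement. -/
def prim (q : TM2.Stmt Γ Unit σ) : StackProg K Γ σ := ⟨Unit, (), fun _ => q⟩

theorem run_prim {q : TM2.Stmt Γ Unit σ} {c c' : σ × (∀ k, List (Γ k))}
    (h : TM2.stepAux q c.1 c.2 = ⟨none, c'.1, c'.2⟩) : (prim q).Run 1 c c' :=
  ⟨1, le_rfl, .step (h ▸ .refl _)⟩

/-- Run `P`, then `Q`. -/
def seq (P Q : StackProg K Γ σ) : StackProg K Γ σ where
  Label := P.Label ⊕ Q.Label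
  fintypeLabel := @instFintypeSum _ _ P.fintypeLabel Q.fintypeLabel
  main := .inl P.main
  code := Sum.elim (fun l => relabel .inl (.goto fun _ => .inr Q.main) (P.code l))
    (fun l => relabel .inr .halt (Q.code l))

theorem Run.seq {P Q : StackProg K Γ σ} {t t' : ℕ} {c c' c'' : σ × (∀ k, List (Γ k))}
    (h : P.Run t c c') (h' : Q.Run t' c' c'') : (P.seq Q).Run (t + t') c c'' := by
  obtain ⟨n, hn, h⟩ := h
  obtain ⟨n', hn', h'⟩ := h'
  refine ⟨n + n', by omega, ?_⟩
  exact (h.embed (m' := (P.seq Q).code) .inl (.goto fun _ => .inr Q.main) fun _ => rfl).trans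
    (h'.embed (m' := (P.seq Q).code) .inr .halt fun _ => rfl)

/-- Pop the stack `src`, store the symbol with `put`, and run the program selected by `dec`;
afterwards start again or halt, according to `more`. -/
def loop (src : K) (put : σ → Option (Γ src) → σ) {ι : Type} [Fintype ι] (dec : σ → ι)
    (P : ι → StackProg K Γ σ) (more : ι → Bool) : StackProg K Γ σ where
  Label := Unit ⊕ Σ i, (P i).Label
  fintypeLabel :=
    @instFintypeSum _ _ _ (@Sigma.instFintype _ _ (fun i => (P i).fintypeLabel) _)
  main := .inl ()
  code := Sum.elim (fun _ => .pop src put (.goto fun s => .inr ⟨dec s, (P (dec s)).main⟩))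
    (fun l => relabel (fun l' => .inr ⟨l.1, l'⟩) (bif more l.1 then .goto fun _ => .inl () else .halt)
      ((P l.1).code l.2))

section Loop

variable {src : K} {put : σ → Option (Γ src) → σ} {ι : Type} [Fintype ι] {dec : σ → ι}
  {P : ι → StackProg K Γ σ} {more : ι → Bool}

/-- The pop is one step, and the body then runs embedded, with its `halt` replaced by the exit. The
exit is left unevaluated so that repeating and stopping are both instances. -/
theorem steps_loop {t : ℕ} {s : σ} {S : ∀ k, List (Γ k)} {c : σ × (∀ k, List (Γ k))}
    (h : (P (dec (put s (S src).head?))).Run t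
      (put s (S src).head?, Function.update S src (S src).tail) c) :
    ∃ n ≤ t, Steps (loop src put dec P more).code (1 + n) ⟨some (.inl ()), s, S⟩
      (TM2.stepAux (bif more (dec (put s (S src).head?)) then .goto fun _ => .inl () else .halt)
        c.1 c.2) := by
  obtain ⟨n, hn, h⟩ := h
  refine ⟨n, hn, ?_⟩
  rw [add_comm]
  exact .step (h.embed (m' := (loop src put dec P more).code)
    (fun l' => Sum.inr ⟨dec (put s (S src).head?), l'⟩) _ fun _ => rfl)

theorem run_loop_more {t t' : ℕ} {s : σ} {S : ∀ k, List (Γ k)} {c c' : σ × (∀ k, List (Γ k))}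
    (hm : more (dec (put s (S src).head?)) = true)
    (h : (P (dec (put s (S src).head?))).Run t
      (put s (S src).head?, Function.update S src (S src).tail) c)
    (h' : (loop src put dec P more).Run t' c c') :
    (loop src put dec P more).Run (1 + t + t') (s, S) c' := by
  obtain ⟨n, hn, h⟩ := steps_loop (more := more) h
  obtain ⟨n', hn', h'⟩ := h'
  rw [hm] at h
  exact ⟨1 + n + n', by omega, h.trans h'⟩

theorem run_loop_stop {t : ℕ} {s : σ} {S : ∀ k, List (Γ k)} {c : σ × (∀ k, List (Γ k))}
    (hm : more (dec (put s (S src).head?)) = false)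
    (h : (P (dec (put s (S src).head?))).Run t
      (put s (S src).head?, Function.update S src (S src).tail) c) :
    (loop src put dec P more).Run (1 + t) (s, S) c := by
  obtain ⟨n, hn, h⟩ := steps_loop (more := more) h
  rw [hm] at h
  exact ⟨1 + n, by omega, h⟩

end Loop

section Lift

variable {K' : Type} [DecidableEq K'] {σ' : Type}

/-- Let a statement act on some of the stacks and on a part of the memory. -/
def liftStmt (e : K' → K) (get : σ → σ') (set : σ → σ' → σ) {L : Type} :
    TM2.Stmt (fun k => Γ (e k)) L σ' → TM2.Stmt Γ L σ
  | .push k g q => .push (e k) (fun s => g (get s)) (liftStmt e get set q)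
  | .peek k g q => .peek (e k) (fun s x => set s (g (get s) x)) (liftStmt e get set q)
  | .pop k g q => .pop (e k) (fun s x => set s (g (get s) x)) (liftStmt e get set q)
  | .load g q => .load (fun s => set s (g (get s))) (liftStmt e get set q)
  | .branch g q q' =>
      .branch (fun s => g (get s)) (liftStmt e get set q) (liftStmt e get set q')
  | .goto g => .goto (fun s => g (get s))
  | .halt => .halt

/-- Let a program act on some of the stacks and on a part of the memory. -/
def lift (e : K' → K) (get : σ → σ') (set : σ → σ' → σ)
    (P : StackProg K' (fun k => Γ (e k)) σ') : StackProg K Γ σ where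
  Label := P.Label
  fintypeLabel := P.fintypeLabel
  main := P.main
  code l := liftStmt e get set (P.code l)

variable {e : K' → K} {get : σ → σ'} {set : σ → σ' → σ}

/-- The three equations say that `get` and `set` form a lens, so the part of the memory outside the
view is preserved; injectivity of `e` keeps updates of different stacks apart. -/
theorem stepAux_liftStmt (he : Function.Injective e) (hgs : ∀ s a, get (set s a) = a)
    (hss : ∀ s a b, set (set s a) b = set s b) (hsg : ∀ s, set s (get s) = s) {L : Type}
    (q : TM2.Stmt (fun k => Γ (e k)) L σ') (s : σ) (S : ∀ k, List (Γ k)) :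
    ∃ S' : ∀ k, List (Γ k), (∀ k, k ∉ Set.range e → S' k = S k) ∧
      (fun k => S' (e k)) = (TM2.stepAux q (get s) fun k => S (e k)).stk ∧
      TM2.stepAux (liftStmt e get set q) s S =
        ⟨(TM2.stepAux q (get s) fun k => S (e k)).l,
          set s (TM2.stepAux q (get s) fun k => S (e k)).var, S'⟩ := by
  have hupd : ∀ (S : ∀ k, List (Γ k)) k v,
      (fun k' => Function.update S (e k) v (e k')) = Function.update (fun k => S (e k)) k v :=
    fun S k v => Function.update_comp_eq_of_injective' S he k v
  have hne : ∀ (S : ∀ k, List (Γ k)) k v k', k' ∉ Set.range e →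
      Function.update S (e k) v k' = S k' := fun S k v k' hk' =>
    Function.update_of_ne (fun h => hk' ⟨k, h.symm⟩) _ _
  induction q generalizing s S with
  | push k g q ih =>
    obtain ⟨S', h1, h2, h3⟩ := ih s (Function.update S (e k) (g (get s) :: S (e k)))
    rw [hupd] at h2 h3
    exact ⟨S', fun k' hk' => (h1 k' hk').trans (hne _ _ _ _ hk'), h2, h3⟩
  | peek k g q ih =>
    obtain ⟨S', h1, h2, h3⟩ := ih (set s (g (get s) (S (e k)).head?)) S
    rw [hgs] at h2 h3
    rw [hss] at h3
    exact ⟨S', h1, h2, h3⟩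
  | pop k g q ih =>
    obtain ⟨S', h1, h2, h3⟩ := ih (set s (g (get s) (S (e k)).head?))
      (Function.update S (e k) (S (e k)).tail)
    rw [hgs, hupd] at h2 h3
    rw [hss] at h3
    exact ⟨S', fun k' hk' => (h1 k' hk').trans (hne _ _ _ _ hk'), h2, h3⟩
  | load g q ih =>
    obtain ⟨S', h1, h2, h3⟩ := ih (set s (g (get s))) S
    rw [hgs] at h2 h3
    rw [hss] at h3
    exact ⟨S', h1, h2, h3⟩
  | branch g q q' ih ih' =>
    cases h : g (get s)
    · simpa [liftStmt, TM2.stepAux, h] using ih' s S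
    · simpa [liftStmt, TM2.stepAux, h] using ih s S
  | goto g => exact ⟨S, fun _ _ => rfl, rfl, by simp [liftStmt, TM2.stepAux, hsg]⟩
  | halt => exact ⟨S, fun _ _ => rfl, rfl, by simp [liftStmt, TM2.stepAux, hsg]⟩

theorem Run.lift {P : StackProg K' (fun k => Γ (e k)) σ'} (he : Function.Injective e)
    (hgs : ∀ s a, get (set s a) = a) (hss : ∀ s a b, set (set s a) b = set s b)
    (hsg : ∀ s, set s (get s) = s) {t : ℕ} {s : σ} {S S' : ∀ k, List (Γ k)} {s' : σ'}
    (h : P.Run t (get s, fun k => S (e k)) (s', fun k => S' (e k)))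
    (hS : ∀ k, k ∉ Set.range e → S' k = S k) :
    (P.lift e get set).Run t (s, S) (set s s', S') := by
  obtain ⟨n, hn, h⟩ := h
  refine ⟨n, hn, ?_⟩
  change Steps P.code n ⟨some P.main, get s, fun k => S (e k)⟩ ⟨none, s', fun k => S' (e k)⟩ at h
  change Steps (P.lift e get set).code n ⟨some P.main, s, S⟩ ⟨none, set s s', S'⟩
  generalize P.main = l at h
  clear hn
  induction n generalizing l s S with
  | zero => cases h
  | succ n ih =>
    cases h with
    | step h =>
      obtain ⟨S₁, h1, h2, h3⟩ := stepAux_liftStmt he hgs hss hsg (P.code l) s S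
      refine .step ?_
      change Steps _ n (TM2.stepAux (liftStmt e get set (P.code l)) s S) _
      rw [h3]
      rcases hc : TM2.stepAux (P.code l) (get s) (fun k => S (e k)) with ⟨_ | l₁, s₁, T₁⟩
      · rw [hc] at h h2
        cases h
        have : S' = S₁ := by
          funext k
          by_cases hk : k ∈ Set.range e
          · obtain ⟨k, rfl⟩ := hk
            exact (congrFun h2 k).symm
          · rw [hS k hk, h1 k hk]
        rw [this]
        exact .refl _
      · rw [hc] at h h2
        have := ih (s := set s s₁) (S := S₁) (l := l₁) (fun k hk => (hS k hk).trans (h1 k hk).symm)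
        rw [hgs, hss, h2] at this
        exact this h

end Lift

/-- The number of symbols that a statement can push. -/
def pushCount {L : Type} : TM2.Stmt Γ L σ → ℕ
  | .push _ _ q => pushCount q + 1
  | .peek _ _ q => pushCount q
  | .pop _ _ q => pushCount q
  | .load _ q => pushCount q
  | .branch _ q q' => pushCount q + pushCount q'
  | .goto _ => 0
  | .halt => 0

theorem length_stepAux_le {L : Type} (q : TM2.Stmt Γ L σ) (s : σ) (S : ∀ k, List (Γ k)) (k : K) :
    ((TM2.stepAux q s S).stk k).length ≤ (S k).length + pushCount q := by
  induction q generalizing s S with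
  | push j g q ih =>
    refine (ih _ _).trans ?_
    rcases eq_or_ne k j with rfl | h
    · simp [pushCount]; omega
    · simp [pushCount, h]
  | peek j g q ih => exact ih _ _
  | pop j g q ih =>
    refine (ih _ _).trans ?_
    rcases eq_or_ne k j with rfl | h
    · simp [pushCount]
    · simp [pushCount, h]
  | load g q ih => exact ih _ _
  | branch g q q' ih ih' =>
    have h1 := ih s S
    have h2 := ih' s S
    cases h : g s <;> simp only [TM2.stepAux, h, cond_true, cond_false, pushCount] <;> omega
  | goto g => simp [TM2.stepAux]
  | halt => simp [TM2.stepAux]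

/-- A bound for the number of symbols pushed in one step. -/
def pushBound (P : StackProg K Γ σ) : ℕ :=
  let _ := P.fintypeLabel
  Finset.univ.sup fun l => pushCount (P.code l)

/-- Each step pushes at most a constant number of symbols, so a bound on time is also a bound on
space. This is what makes intermediate results polynomially long. -/
theorem Run.length_le {P : StackProg K Γ σ} {t : ℕ} {c c' : σ × (∀ k, List (Γ k))}
    (h : P.Run t c c') (k : K) : (c'.2 k).length ≤ (c.2 k).length + t * P.pushBound := by
  obtain ⟨n, hn, h⟩ := h
  have key : ∀ (n : ℕ) (c c' : TM2.Cfg Γ P.Label σ), Steps P.code n c c' →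
      (c'.stk k).length ≤ (c.stk k).length + n * P.pushBound := by
    intro n c c' h
    induction h with
    | refl c => simp
    | @step l s S n c h ih =>
      have h1 := length_stepAux_le (P.code l) s S k
      have h2 : pushCount (P.code l) ≤ P.pushBound := by
        let _ := P.fintypeLabel
        exact Finset.le_sup (f := fun l => pushCount (P.code l)) (Finset.mem_univ l)
      simp only [Nat.succ_mul]
      omega
  exact (key n _ _ h).trans (Nat.add_le_add_left (Nat.mul_le_mul_right _ hn) _)

/-! ### Programs and Turing machines -/

/-- All stacks but one are empty. -/
def single (k : K) (l : List (Γ k)) : ∀ k, List (Γ k) := Function.update (fun _ => []) k l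

theorem iterate_bind_of_steps {L : Type} {m : L → TM2.Stmt Γ L σ} {n : ℕ}
    {c c' : TM2.Cfg Γ L σ} (h : Steps m n c c') :
    (flip bind (TM2.step m))^[n] (some c) = some c' := by
  induction h with
  | refl c => rfl
  | step h ih => exact ih

theorem steps_of_iterate_bind {L : Type} {m : L → TM2.Stmt Γ L σ} {n : ℕ}
    {c c' : TM2.Cfg Γ L σ} (h : (flip bind (TM2.step m))^[n] (some c) = some c') :
    Steps m n c c' := by
  have hnone : ∀ n, (flip bind (TM2.step m))^[n] none = none := by
    intro n
    induction n with
    | zero => rfl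
    | succ n ih => exact ih
  induction n generalizing c with
  | zero =>
    cases h
    exact .refl _
  | succ n ih =>
    rcases c with ⟨_ | l, s, S⟩
    -- A halted configuration has no successor, and `none` is absorbing.
    · exact absurd ((hnone n).symm.trans h) (by simp)
    · exact .step (ih h)

/-- A program that computes `f` in polynomial time yields a Turing machine. -/
theorem computableInPolyTime [Fintype K] [Fintype σ] {α β A B : Type} {ea : α → List A}
    {eb : β → List B} {f : α → β} (P : StackProg K Γ σ) (s₀ : σ) {k₀ k₁ : K} [Fintype A]
    (i : A ≃ Γ k₀) (j : B ≃ Γ k₁) (time : Polynomial ℕ)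
    (h : ∀ a, P.Run (time.eval (ea a).length) (s₀, single k₀ ((ea a).map i))
      (s₀, single k₁ ((eb (f a)).map j))) :
    Nonempty (TM2ComputableInPolyTime ea eb f) := by
  let _ := P.fintypeLabel
  let _ : Fintype (Γ k₀) := Fintype.ofEquiv A i
  -- Initial and final configurations of a machine are defined by a cast along an equality of
  -- stacks; in this form `single` agrees with them.
  have hs : ∀ (k₀ : K) (l : List (Γ k₀)), single k₀ l = fun k =>
      @dite (List (Γ k)) (k = k₀) _ (fun h => by rw [h]; exact l) fun _ => [] := by
    intro k₀ l
    funext k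
    by_cases hk : k = k₀
    · subst hk
      simp [single]
    · simp [single, hk]
  choose n hn hsteps using h
  refine ⟨{ tm := ⟨k₀, k₁, Γ, P.Label, P.main, σ, s₀, P.code⟩, inputAlphabet := i.symm,
            outputAlphabet := j.symm, time := time, outputsFun := fun a => ?_ }⟩
  refine ⟨⟨n a, ?_⟩, hn a⟩
  have := iterate_bind_of_steps (hsteps a)
  simp only [hs] at this
  exact this

/-- A Turing machine that computes `f` in polynomial time yields a program. -/
theorem exists_of_computableInPolyTime {α β A B : Type} {ea : α → List A}
    {eb : β → List B} {f : α → β} (h : TM2ComputableInPolyTime ea eb f) :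
    ∃ (K : Type) (_ : DecidableEq K) (_ : Fintype K) (Γ : K → Type) (σ : Type) (_ : Fintype σ)
      (P : StackProg K Γ σ) (s₀ : σ) (k₀ k₁ : K) (i : A ≃ Γ k₀) (j : B ≃ Γ k₁)
      (time : Polynomial ℕ),
      ∀ a, P.Run (time.eval (ea a).length) (s₀, single k₀ ((ea a).map i))
        (s₀, single k₁ ((eb (f a)).map j)) := by
  obtain ⟨⟨tm, i, j⟩, time, h⟩ := h
  have hs : ∀ (k₀ : tm.K) (l : List (tm.Γ k₀)), single k₀ l = fun k =>
      @dite (List (tm.Γ k)) (k = k₀) _ (fun h => by rw [h]; exact l) fun _ => [] := by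
    intro k₀ l
    funext k
    by_cases hk : k = k₀
    · subst hk
      simp [single]
    · simp [single, hk]
  refine ⟨tm.K, tm.kDecidableEq, tm.kFin, tm.Γ, tm.σ, tm.σFin,
    @StackProg.mk _ _ _ _ tm.Λ tm.ΛFin tm.main tm.m, tm.initialState, tm.k₀, tm.k₁, i.symm, j.symm,
    time, fun a => ?_⟩
  obtain ⟨⟨n, hsteps⟩, hn⟩ := h a
  refine ⟨n, hn, steps_of_iterate_bind ?_⟩
  simp only [hs]
  exact hsteps

end StackProg

end

/-! ### Moving stacks and composing machines -/

section

open Turing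

namespace StackProg

variable {K : Type} [DecidableEq K] {Γ : K → Type} {σ : Type}

theorem single_self (k : K) (l : List (Γ k)) : single k l k = l := by simp [single]

theorem single_of_ne {k k' : K} (h : k' ≠ k) (l : List (Γ k)) : single k l k' = [] := by
  simp [single, h]

/-- The statement that pushes the word `w`, its last symbol first. -/
def pushWord (k : K) {L : Type} (q : TM2.Stmt Γ L σ) (w : List (Γ k)) : TM2.Stmt Γ L σ :=
  w.foldl (fun q x => .push k (fun _ => x) q) q

theorem stepAux_pushWord (k : K) {L : Type} (q : TM2.Stmt Γ L σ) (w : List (Γ k)) (s : σ)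
    (S : ∀ k, List (Γ k)) :
    TM2.stepAux (pushWord k q w) s S = TM2.stepAux q s (Function.update S k (w ++ S k)) := by
  induction w generalizing q S with
  | nil => simp [pushWord]
  | cons x w ih =>
    change TM2.stepAux (pushWord k (.push k (fun _ => x) q) w) s S = _
    rw [ih]
    simp [TM2.stepAux]

theorem Run.congr_right {P : StackProg K Γ σ} {t : ℕ} {c c' c'' : σ × (∀ k, List (Γ k))}
    (h : P.Run t c c') (hc : c' = c'') : P.Run t c c'' := hc ▸ h

section Move

variable {τ R : Type} [Fintype R]

/-- Move the stack `src` to the stack `dst`, which reverses it. -/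
def move (src dst : K) (i : Γ src → R) (j : R → Γ dst) : StackProg K Γ (τ × Option R) :=
  loop src (fun s x => (s.1, x.map i)) (ι := Option R) (fun s => s.2)
    (fun o => prim (pushWord dst .halt (o.map j).toList)) Option.isSome

theorem run_move_update {src dst : K} (hne : src ≠ dst) (i : Γ src → R) (j : R → Γ dst) (s : τ)
    (r : Option R) (S : ∀ k, List (Γ k)) :
    (move src dst i j).Run (2 * (S src).length + 2) ((s, r), S)
      ((s, none), Function.update (Function.update S src []) dst
        (((S src).map fun x => j (i x)).reverse ++ S dst)) := by
  have hbody : ∀ (o : Option R) (S : ∀ k, List (Γ k)),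
      (prim (pushWord dst .halt (o.map j).toList)).Run 1 ((s, o), S)
        ((s, o), Function.update S dst ((o.map j).toList ++ S dst)) := fun o S =>
    run_prim (by rw [stepAux_pushWord]; rfl)
  generalize hl : S src = l
  unfold move
  induction l generalizing S r with
  | nil =>
    have := run_loop_stop (src := src) (put := fun (s : τ × Option R) x => (s.1, x.map i))
      (dec := fun s => s.2) (P := fun o => prim (pushWord dst .halt (o.map j).toList))
      (more := Option.isSome) (s := (s, r)) (S := S) (t := 1) (by simp [hl]) (hbody _ _)
    have hs : Function.update S src [] = S := by rw [← hl, Function.update_eq_self]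
    simpa [hl, hs] using this
  | cons x l ih =>
    have h1 := ih (some (i x))
      (Function.update (Function.update S src l) dst (j (i x) :: S dst)) (by simp [hne])
    have := run_loop_more (src := src) (put := fun (s : τ × Option R) x => (s.1, x.map i))
      (dec := fun s => s.2) (P := fun o => prim (pushWord dst .halt (o.map j).toList))
      (more := Option.isSome) (s := (s, r)) (S := S) (t := 1) (by simp [hl])
      (hbody _ _) (t' := 2 * l.length + 2) (c' := _) (by simpa [hl, hne.symm] using h1)
    refine (this.mono (by simp; omega)).congr_right ?_
    refine Prod.ext rfl ?_
    funext k
    by_cases hk : k = dst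
    · subst hk
      simp
    · by_cases hk' : k = src
      · subst hk'
        simp [hk]
      · simp [hk, hk']

/-- The final stacks are described by their values instead of nested updates, so that a caller can
check them one stack at a time. -/
theorem run_move {src dst : K} (hne : src ≠ dst) {i : Γ src → R} {j : R → Γ dst} (s : τ)
    (r : Option R) {S S' : ∀ k, List (Γ k)} {t : ℕ} (ht : 2 * (S src).length + 2 ≤ t)
    (h1 : S' src = []) (h2 : S' dst = ((S src).map fun x => j (i x)).reverse ++ S dst)
    (h3 : ∀ k, k ≠ src → k ≠ dst → S' k = S k) :
    (move src dst i j).Run t ((s, r), S) ((s, none), S') := by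
  have : S' = Function.update (Function.update S src []) dst
        (((S src).map fun x => j (i x)).reverse ++ S dst) := by
    funext k
    by_cases hk : k = dst
    · subst hk
      simpa using h2
    · by_cases hk' : k = src
      · subst hk'
        simpa [hk] using h1
      · simp [hk, hk', h3]
  rw [this]
  exact (run_move_update hne i j s r S).mono ht

end Move

theorem Run.length_output_le {P : StackProg K Γ σ} {t : ℕ} {s s' : σ} {k₀ k₁ : K}
    {l : List (Γ k₀)} {l' : List (Γ k₁)} (h : P.Run t (s, single k₀ l) (s', single k₁ l')) :
    l'.length ≤ l.length + t * P.pushBound := by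
  have := h.length_le k₁
  simp only [single_self] at this
  refine this.trans (Nat.add_le_add_right ?_ _)
  by_cases hk : k₁ = k₀
  · subst hk
    simp [single]
  · simp [single, hk]

theorem eq_single {k : K} {S : ∀ k, List (Γ k)} {l : List (Γ k)} (h : S k = l)
    (h' : ∀ k', k' ≠ k → S k' = []) : S = single k l := by
  funext k'
  by_cases hk : k' = k
  · subst hk
    rw [h, single_self]
  · rw [h' k' hk, single_of_ne hk]

/-- Stacks indexed by a sum. -/
def joinStacks {J : Type} {Δ : K ⊕ J → Type} (a : ∀ k, List (Δ (.inl k)))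
    (b : ∀ j, List (Δ (.inr j))) : ∀ k, List (Δ k)
  | .inl k => a k
  | .inr j => b j

/-- A program that computes `f` in polynomial time yields a Turing machine. -/
theorem computableInPolyTime_of_stacks [Fintype K] [Fintype σ] {α β A B : Type} {ea : α → List A}
    {eb : β → List B} {f : α → β} (P : StackProg K Γ σ) (s₀ : σ) {k₀ k₁ : K} [Fintype A]
    (i : A ≃ Γ k₀) (j : B ≃ Γ k₁) (time : Polynomial ℕ) (S S' : α → ∀ k, List (Γ k))
    (h₀ : ∀ a, S a k₀ = (ea a).map i) (h₀' : ∀ a k, k ≠ k₀ → S a k = [])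
    (h₁ : ∀ a, S' a k₁ = (eb (f a)).map j) (h₁' : ∀ a k, k ≠ k₁ → S' a k = [])
    (h : ∀ a, P.Run (time.eval (ea a).length) (s₀, S a) (s₀, S' a)) :
    Nonempty (Turing.TM2ComputableInPolyTime ea eb f) :=
  computableInPolyTime P s₀ i j time fun a => by
    rw [← eq_single (h₀ a) (h₀' a), ← eq_single (h₁ a) (h₁' a)]
    exact h a

end StackProg

theorem Polynomial.monotone_eval_nat (p : Polynomial ℕ) : Monotone fun n => p.eval n := by
  intro a b h
  simp only [Polynomial.eval_eq_sum_range]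
  exact Finset.sum_le_sum fun i _ => Nat.mul_le_mul_left _ (Nat.pow_le_pow_left h i)

namespace Turing.TM2ComputableInPolyTime

open StackProg

variable {α β γ A B C : Type} {ea : α → List A} {eb : β → List B} {ec : γ → List C}

/-- The summand `X` covers a machine whose output stack is its input stack. -/
theorem exists_length_le {f : α → β} (h : TM2ComputableInPolyTime ea eb f) :
    ∃ q : Polynomial ℕ, ∀ a, (eb (f a)).length ≤ q.eval (ea a).length := by
  obtain ⟨K, _, _, Γ, σ, _, P, s₀, k₀, k₁, i, j, time, h⟩ := exists_of_computableInPolyTime h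
  refine ⟨.X + time * .C P.pushBound, fun a => ?_⟩
  simpa using (h a).length_output_le

/-- Each machine keeps its own stacks and memory. The intermediate word travels over an auxiliary
stack, because a single move would reverse it. Machines halt with all other stacks empty and the
memory reset, so nothing has to be cleaned up, and `q` bounds the length on which the second machine
runs. -/
theorem comp [Fintype A] [Fintype B] {g : β → γ} {f : α → β}
    (hg : TM2ComputableInPolyTime eb ec g) (hf : TM2ComputableInPolyTime ea eb f) :
    Nonempty (TM2ComputableInPolyTime ea ec fun a => g (f a)) := by
  obtain ⟨q, hq⟩ := hf.exists_length_le
  obtain ⟨K, _, _, Γ, σ, _, P, s₀, k₀, k₁, i, j, time, hP⟩ := exists_of_computableInPolyTime hf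
  obtain ⟨K', _, _, Γ', σ', _, P', s₀', k₀', k₁', i', j', time', hP'⟩ :=
    exists_of_computableInPolyTime hg
  let Δ : K ⊕ K' ⊕ Unit → Type := Sum.elim Γ (Sum.elim Γ' fun _ => B)
  let τ : Type := (σ × σ') × Option B
  let st (a : ∀ k, List (Γ k)) (b : ∀ k, List (Γ' k)) (c : List B) : ∀ k, List (Δ k) :=
    joinStacks a (joinStacks (Δ := fun j => Δ (.inr j)) b fun _ => c)
  let Q₁ : StackProg (K ⊕ K' ⊕ Unit) Δ τ :=
    lift (Γ := Δ) Sum.inl (fun s => s.1.1) (fun s a => ((a, s.1.2), s.2)) P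
  let Q₂ : StackProg (K ⊕ K' ⊕ Unit) Δ τ :=
    lift (Γ := Δ) (fun k => Sum.inr (Sum.inl k)) (fun s => s.1.2) (fun s a => ((s.1.1, a), s.2)) P'
  let M₁ : StackProg (K ⊕ K' ⊕ Unit) Δ τ :=
    move (Γ := Δ) (R := B) (.inl k₁) (.inr (.inr ())) j.symm (fun x => x)
  let M₂ : StackProg (K ⊕ K' ⊕ Unit) Δ τ :=
    move (Γ := Δ) (R := B) (.inr (.inr ())) (.inr (.inl k₀')) (fun x => x) i'
  let c₀ : τ := ((s₀, s₀'), none)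
  refine computableInPolyTime_of_stacks (((Q₁.seq M₁).seq M₂).seq Q₂) c₀ (k₀ := .inl k₀)
    (k₁ := .inr (.inl k₁')) i j' (time + (2 * q + 2) + (2 * q + 2) + time'.comp q)
    (fun a => st (single k₀ ((ea a).map i)) (fun _ => []) [])
    (fun a => st (fun _ => []) (single k₁' ((ec (g (f a))).map j')) [])
    (fun a => single_self (Γ := Γ) k₀ _) ?_ (fun a => single_self (Γ := Γ') k₁' _) ?_ fun a => ?_
  · rintro a (k | k | k) hk
    exacts [single_of_ne (by simpa using hk) _, rfl, rfl]
  · rintro a (k | k | k) hk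
    exacts [rfl, single_of_ne (by simpa using hk) _, rfl]
  have h1 : Q₁.Run (time.eval (ea a).length) (c₀, st (single k₀ ((ea a).map i)) (fun _ => []) [])
      (c₀, st (single k₁ ((eb (f a)).map j)) (fun _ => []) []) := by
    refine Run.lift (Γ := Δ) (P := P) (get := fun s : τ => s.1.1)
      (set := fun s a => ((a, s.1.2), s.2)) (s := c₀) (s' := s₀)
      (S := st (single k₀ ((ea a).map i)) (fun _ => []) [])
      (S' := st (single k₁ ((eb (f a)).map j)) (fun _ => []) [])
      Sum.inl_injective (fun _ _ => rfl) (fun _ _ _ => rfl) (fun _ => rfl) (hP a) fun k hk => ?_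
    rcases k with k | k | k
    exacts [absurd ⟨k, rfl⟩ hk, rfl, rfl]
  have h2 : M₁.Run (2 * (eb (f a)).length + 2)
      (c₀, st (single k₁ ((eb (f a)).map j)) (fun _ => []) [])
      (c₀, st (fun _ => []) (fun _ => []) (eb (f a)).reverse) := by
    have e1 : 2 * (single k₁ ((eb (f a)).map j) k₁).length + 2 ≤ 2 * (eb (f a)).length + 2 := by
      simp [single_self]
    have e2 : (eb (f a)).reverse
        = ((single k₁ ((eb (f a)).map j) k₁).map fun x => j.symm x).reverse ++ [] := by
      simp [single_self, Function.comp_def]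
    refine run_move (Γ := Δ) (by simp) _ _ e1 rfl e2 ?_
    rintro (k | k | k) hk hk'
    exacts [(single_of_ne (by simpa using hk) _).symm, rfl, absurd rfl hk']
  have h3 : M₂.Run (2 * (eb (f a)).length + 2)
      (c₀, st (fun _ => []) (fun _ => []) (eb (f a)).reverse)
      (c₀, st (fun _ => []) (single k₀' ((eb (f a)).map i')) []) := by
    have e1 : 2 * (eb (f a)).reverse.length + 2 ≤ 2 * (eb (f a)).length + 2 := by simp
    have e2 : single k₀' ((eb (f a)).map i') k₀'
        = ((eb (f a)).reverse.map fun x => i' x).reverse ++ [] := by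
      simp [single_self]
    refine run_move (Γ := Δ) (by simp) _ _ e1 rfl e2 ?_
    rintro (k | k | k) hk hk'
    exacts [rfl, single_of_ne (by simpa using hk') _, absurd rfl hk]
  have h4 : Q₂.Run (time'.eval (eb (f a)).length)
      (c₀, st (fun _ => []) (single k₀' ((eb (f a)).map i')) [])
      (c₀, st (fun _ => []) (single k₁' ((ec (g (f a))).map j')) []) := by
    refine Run.lift (Γ := Δ) (P := P') (get := fun s : τ => s.1.2)
      (set := fun s a => ((s.1.1, a), s.2)) (s := c₀) (s' := s₀')
      (S := st (fun _ => []) (single k₀' ((eb (f a)).map i')) [])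
      (S' := st (fun _ => []) (single k₁' ((ec (g (f a))).map j')) [])
      (Sum.inr_injective.comp Sum.inl_injective)
      (fun _ _ => rfl) (fun _ _ _ => rfl) (fun _ => rfl) (hP' (f a)) fun k hk => ?_
    rcases k with k | k | k
    exacts [rfl, absurd ⟨k, rfl⟩ hk, rfl]
  refine (((h1.seq h2).seq h3).seq h4).mono ?_
  have := hq a
  have := time'.monotone_eval_nat this
  simp only [Polynomial.eval_add, Polynomial.eval_mul, Polynomial.eval_ofNat, Polynomial.eval_comp]
    at this ⊢
  omega

end Turing.TM2ComputableInPolyTime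

end

/-! ### Transducers, pairing and folds on Turing machines -/

section

open Turing

namespace StackProg

variable {K : Type} [DecidableEq K] {Γ : K → Type} {σ : Type}

section Scatter

variable {τ R : Type} [Fintype R]

/-- Pop the stack `src` until it is empty and push words that depend on the symbols to the stacks
`dst` and `dst'`. -/
def scatter (src dst dst' : K) (i : Γ src → R) (φ : R → List (Γ dst)) (φ' : R → List (Γ dst')) :
    StackProg K Γ (τ × Option R) :=
  loop src (fun s x => (s.1, x.map i)) (ι := Option R) (fun s => s.2)
    (fun o => prim (pushWord dst (pushWord dst' .halt (o.toList.flatMap φ'))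
      (o.toList.flatMap φ))) Option.isSome

/-- With two destinations one pass can duplicate a word or split it by the kind of its symbols; a
constant empty word switches a destination off. -/
theorem run_scatter {src dst dst' : K} (h : src ≠ dst) (h' : src ≠ dst') (hd : dst ≠ dst')
    {i : Γ src → R} {φ : R → List (Γ dst)} {φ' : R → List (Γ dst')} (s : τ)
    (r : Option R) {S S' : ∀ k, List (Γ k)} {t : ℕ} (ht : 2 * (S src).length + 2 ≤ t)
    (h1 : S' src = [])
    (h2 : S' dst = ((S src).reverse.flatMap fun x => φ (i x)) ++ S dst)
    (h2' : S' dst' = ((S src).reverse.flatMap fun x => φ' (i x)) ++ S dst')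
    (h3 : ∀ k, k ≠ src → k ≠ dst → k ≠ dst' → S' k = S k) :
    (scatter src dst dst' i φ φ').Run t ((s, r), S) ((s, none), S') := by
  refine Run.mono ?_ ht
  clear ht
  have hbody : ∀ (o : Option R) (S : ∀ k, List (Γ k)),
      (prim (pushWord dst (pushWord dst' .halt (o.toList.flatMap φ'))
      (o.toList.flatMap φ))).Run 1 ((s, o), S)
        ((s, o), Function.update (Function.update S dst (o.toList.flatMap φ ++ S dst)) dst'
          (o.toList.flatMap φ' ++ S dst')) := fun o S =>
    run_prim (by rw [stepAux_pushWord, stepAux_pushWord]; simp [TM2.stepAux, hd.symm])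
  generalize hl : S src = l at h2 h2'
  unfold scatter
  induction l generalizing S r with
  | nil =>
    have := run_loop_stop (src := src) (put := fun (s : τ × Option R) x => (s.1, x.map i))
      (dec := fun s => s.2) (P := fun o => prim (pushWord dst (pushWord dst' .halt
        (o.toList.flatMap φ')) (o.toList.flatMap φ)))
      (more := Option.isSome) (s := (s, r)) (S := S) (t := 1) (by simp [hl]) (hbody _ _)
    have hs : Function.update S src [] = S := by rw [← hl, Function.update_eq_self]
    have hs' : S' = S := by
      funext k
      by_cases hk : k = dst
      · subst hk
        simpa using h2
      by_cases hk' : k = dst'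
      · subst hk'
        simpa using h2'
      by_cases hk'' : k = src
      · subst hk''
        rw [h1, hl]
      exact h3 k hk'' hk hk'
    simpa [hl, hs, hs'] using this
  | cons x l ih =>
    have h4 := ih (some (i x))
      (S := Function.update (Function.update (Function.update S src l) dst (φ (i x) ++ S dst)) dst'
        (φ' (i x) ++ S dst')) (by
          intro k hk hk' hk''
          simp [hk, hk', hk'', h3]) (by simp [h, h']) (by simp [h2, hd]) (by simp [h2'])
    have := run_loop_more (src := src) (put := fun (s : τ × Option R) x => (s.1, x.map i))
      (dec := fun s => s.2) (P := fun o => prim (pushWord dst (pushWord dst' .halt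
        (o.toList.flatMap φ')) (o.toList.flatMap φ)))
      (more := Option.isSome) (s := (s, r)) (S := S) (t := 1) (by simp [hl])
      (hbody _ _) (t' := 2 * l.length + 2) (c' := ((s, none), S'))
      (by simpa [hl, h.symm, h'.symm] using h4)
    exact this.mono (by simp; omega)

end Scatter

end StackProg

/-- The output of a finite transducer that reads its input from the left. -/
def transduce {Q A B : Type} (δ : Q → A → Q × List B) (fin : Q → List B) : Q → List A → List B
  | q, [] => fin q
  | q, a :: l => (δ q a).2 ++ transduce δ fin (δ q a).1 l

namespace Turing.TM2ComputableInPolyTime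

open StackProg

variable {α β γ A B C : Type} {ea : α → List A} {eb : β → List B} {ec : γ → List C}

/-- The stacks of a transducer. -/
inductive TransducerStack : Type
  | inp | tmp | out
  deriving DecidableEq

instance : Fintype TransducerStack := ⟨{.inp, .tmp, .out}, fun x => by cases x <;> simp⟩

/-- The emitted words pile up in reverse on a temporary stack, and a second pass restores their
order. -/
theorem of_transduce [Fintype A] [Fintype B] {Q : Type} [Fintype Q] (δ : Q → A → Q × List B)
    (fin : Q → List B) (q₀ : Q) {f : α → β} (h : ∀ a, eb (f a) = transduce δ fin q₀ (ea a)) :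
    Nonempty (TM2ComputableInPolyTime ea eb f) := by
  let Δ : TransducerStack → Type
    | .inp => A | .tmp => B | .out => B
  let st (a : List A) (b c : List B) : ∀ k, List (Δ k)
    | .inp => a | .tmp => b | .out => c
  let τ : Type := Q × Option (A ⊕ B)
  let emit (q : Q) (w : List B) : StackProg TransducerStack Δ τ :=
    prim (.load (fun _ => (q, none)) (pushWord (Γ := Δ) .tmp .halt w.reverse))
  have hemit : ∀ q w s l b, (emit q w).Run 1 (s, st l b []) ((q, none), st l (w.reverse ++ b) []) := by
    intro q w s l b
    refine run_prim ?_
    change TM2.stepAux (pushWord (Γ := Δ) .tmp .halt w.reverse) (q, none) _ = _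
    rw [stepAux_pushWord]
    refine congrArg (TM2.Cfg.mk none (q, none)) (funext fun k => ?_)
    cases k <;> simp [st]
  let body : Q × Option (A ⊕ B) → StackProg TransducerStack Δ τ
    | (q, some (.inl a)) => emit (δ q a).1 (δ q a).2
    | (q, _) => emit q₀ (fin q)
  let P : StackProg TransducerStack Δ τ :=
    loop (Γ := Δ) .inp (fun s x => (s.1, x.map Sum.inl)) (ι := Q × Option (A ⊕ B))
      (fun s => s) body (fun s => s.2.isSome)
  have hP : ∀ (l : List A) (b : List B) (s : τ), P.Run (2 * l.length + 2) (s, st l b [])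
      ((q₀, none), st [] ((transduce δ fin s.1 l).reverse ++ b) []) := by
    intro l
    induction l with
    | nil =>
      intro b s
      refine run_loop_stop (t := 1) (S := st [] b []) rfl ?_
      have e : Function.update (st [] b []) .inp [] = st [] b [] := by
        funext k
        cases k <;> simp [st]
      change (emit q₀ (fin s.1)).Run 1 ((s.1, none), Function.update (st [] b []) .inp []) _
      rw [e]
      exact hemit _ _ _ _ _
    | cons a l ih =>
      intro b s
      refine (run_loop_more (t := 1) (t' := 2 * l.length + 2) (S := st (a :: l) b [])
        (c := (((δ s.1 a).1, none), st l ((δ s.1 a).2.reverse ++ b) [])) rfl ?_ ?_).mono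
        (by simp; omega)
      · have e : Function.update (st (a :: l) b []) .inp l = st l b [] := by
          funext k
          cases k <;> simp [st]
        change (emit (δ s.1 a).1 (δ s.1 a).2).Run 1
          ((s.1, some (.inl a)), Function.update (st (a :: l) b []) .inp l) _
        rw [e]
        exact hemit _ _ _ _ _
      · have := ih ((δ s.1 a).2.reverse ++ b) ((δ s.1 a).1, none)
        simp only [transduce, List.reverse_append, List.append_assoc]
        exact this
  let M : StackProg TransducerStack Δ τ :=
    scatter (Γ := Δ) (R := A ⊕ B) .tmp .out .inp Sum.inr (Sum.elim (fun _ => []) fun b => [b])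
      (fun _ => [])
  have hM : ∀ (w : List B), M.Run (2 * w.length + 2) ((q₀, none), st [] w.reverse [])
      ((q₀, none), st [] [] w) := by
    intro w
    have e1 : 2 * w.reverse.length + 2 ≤ 2 * w.length + 2 := by simp
    have e2 : w = (w.reverse.reverse.flatMap fun b => [b]) ++ [] := by simp
    have e3 : [] = (w.reverse.reverse.flatMap fun b => ([] : List A)) ++ [] := by simp
    refine run_scatter (Γ := Δ) (by simp) (by simp) (by simp) q₀ none (S := st [] w.reverse [])
      (S' := st [] [] w) e1 rfl e2 e3 ?_
    rintro (_ | _ | _) h1 h2 h3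
    exacts [rfl, absurd rfl h1, absurd rfl h2]
  -- The second pass is linear in the length of the output, which is at most `C` times the duration
  -- of the first pass.
  let C := P.pushBound
  refine computableInPolyTime_of_stacks (Γ := Δ) (P.seq M) (q₀, none) (k₀ := .inp) (k₁ := .out)
    (Equiv.refl A) (Equiv.refl B) (2 * .X + 2 + (2 * ((2 * .X + 2) * .C C) + 2))
    (fun a => st (ea a) [] []) (fun a => st [] [] (eb (f a))) (fun a => (List.map_id _).symm) ?_
    (fun a => (List.map_id _).symm) ?_ fun a => ?_
  · rintro a (_ | _ | _) hk
    exacts [absurd rfl hk, rfl, rfl]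
  · rintro a (_ | _ | _) hk
    exacts [rfl, rfl, absurd rfl hk]
  have h1 := hP (ea a) [] (q₀, none)
  rw [← h a, List.append_nil] at h1
  have h2 : (eb (f a)).reverse.length ≤ 0 + (2 * (ea a).length + 2) * C := h1.length_le .tmp
  refine (h1.seq (hM _)).mono ?_
  simp only [List.length_reverse, Polynomial.eval_add, Polynomial.eval_mul, Polynomial.eval_ofNat,
    Polynomial.eval_X, Polynomial.eval_C] at h2 ⊢
  omega

/-- The stacks used besides those of two machines run on the same input. -/
inductive PairStack : Type
  | inp | copy | fst | snd | out
  deriving DecidableEq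

instance : Fintype PairStack :=
  ⟨{.inp, .copy, .fst, .snd, .out}, fun x => by cases x <;> simp⟩

/-- Both machines destroy their input, so it is duplicated beforehand. The second output is
delivered before the first one, since later pushes end up in front; each output is moved twice to
regain its orientation. -/
theorem pair [Fintype A] [Fintype B] [Fintype C] {f : α → β} {g : α → γ}
    (hf : TM2ComputableInPolyTime ea eb f) (hg : TM2ComputableInPolyTime ea ec g) :
    Nonempty (TM2ComputableInPolyTime ea
      (fun x : β × γ => (eb x.1).map Sum.inl ++ (ec x.2).map Sum.inr) fun a => (f a, g a)) := by
  obtain ⟨q, hq⟩ := hf.exists_length_le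
  obtain ⟨q', hq'⟩ := hg.exists_length_le
  obtain ⟨K, _, _, Γ, σ, _, P, s₀, k₀, k₁, i, j, time, hP⟩ := exists_of_computableInPolyTime hf
  obtain ⟨K', _, _, Γ', σ', _, P', s₀', k₀', k₁', i', j', time', hP'⟩ :=
    exists_of_computableInPolyTime hg
  let Δ : K ⊕ K' ⊕ PairStack → Type := Sum.elim Γ (Sum.elim Γ' fun
    | .inp => A | .copy => A | .fst => B | .snd => C | .out => B ⊕ C)
  let τ : Type := (σ × σ') × Option (A ⊕ B ⊕ C)
  let c₀ : τ := ((s₀, s₀'), none)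
  let st (x : ∀ k, List (Γ k)) (y : ∀ k, List (Γ' k)) (a a' : List A) (b : List B) (c : List C)
      (d : List (B ⊕ C)) : ∀ k, List (Δ k) :=
    joinStacks x (joinStacks (Δ := fun j => Δ (.inr j)) y fun
      | .inp => a | .copy => a' | .fst => b | .snd => c | .out => d)
  let Q₁ : StackProg (K ⊕ K' ⊕ PairStack) Δ τ :=
    lift (Γ := Δ) Sum.inl (fun s => s.1.1) (fun s a => ((a, s.1.2), s.2)) P
  let Q₂ : StackProg (K ⊕ K' ⊕ PairStack) Δ τ :=
    lift (Γ := Δ) (fun k => Sum.inr (Sum.inl k)) (fun s => s.1.2) (fun s a => ((s.1.1, a), s.2)) P'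
  have hQ₁ : ∀ a y a₁ a₂ b c d, Q₁.Run (time.eval (ea a).length)
      (c₀, st (single k₀ ((ea a).map i)) y a₁ a₂ b c d)
      (c₀, st (single k₁ ((eb (f a)).map j)) y a₁ a₂ b c d) := by
    intro a y a₁ a₂ b c d
    refine Run.lift (Γ := Δ) (P := P) (get := fun s : τ => s.1.1)
      (set := fun s a => ((a, s.1.2), s.2)) (s := c₀) (s' := s₀)
      (S := st (single k₀ ((ea a).map i)) y a₁ a₂ b c d)
      (S' := st (single k₁ ((eb (f a)).map j)) y a₁ a₂ b c d)
      Sum.inl_injective (fun _ _ => rfl) (fun _ _ _ => rfl) (fun _ => rfl) (hP a) fun k hk => ?_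
    rcases k with k | k | k
    exacts [absurd ⟨k, rfl⟩ hk, rfl, rfl]
  have hQ₂ : ∀ a x a₁ a₂ b c d, Q₂.Run (time'.eval (ea a).length)
      (c₀, st x (single k₀' ((ea a).map i')) a₁ a₂ b c d)
      (c₀, st x (single k₁' ((ec (g a)).map j')) a₁ a₂ b c d) := by
    intro a x a₁ a₂ b c d
    refine Run.lift (Γ := Δ) (P := P') (get := fun s : τ => s.1.2)
      (set := fun s a => ((s.1.1, a), s.2)) (s := c₀) (s' := s₀')
      (S := st x (single k₀' ((ea a).map i')) a₁ a₂ b c d)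
      (S' := st x (single k₁' ((ec (g a)).map j')) a₁ a₂ b c d)
      (Sum.inr_injective.comp Sum.inl_injective)
      (fun _ _ => rfl) (fun _ _ _ => rfl) (fun _ => rfl) (hP' a) fun k hk => ?_
    rcases k with k | k | k
    exacts [rfl, absurd ⟨k, rfl⟩ hk, rfl]
  let M₁ : StackProg (K ⊕ K' ⊕ PairStack) Δ τ :=
    scatter (Γ := Δ) (R := A ⊕ B ⊕ C) (.inr (.inr .inp)) (.inr (.inr .copy)) (.inr (.inr .fst))
      Sum.inl (Sum.elim (fun a => [a]) fun _ => []) (fun _ => [])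
  have hM₁ : ∀ l : List A, M₁.Run (2 * l.length + 2) (c₀, st (fun _ => []) (fun _ => []) l [] [] [] [])
      (c₀, st (fun _ => []) (fun _ => []) [] l.reverse [] [] []) := by
    intro l
    have e1 : l.reverse = (l.reverse.flatMap fun a => [a]) ++ [] := by simp
    have e2 : [] = (l.reverse.flatMap fun _ => ([] : List B)) ++ [] := by simp
    refine run_scatter (Γ := Δ) (by simp) (by simp) (by simp) (s₀, s₀') none
      (S := st (fun _ => []) (fun _ => []) l [] [] [] [])
      (S' := st (fun _ => []) (fun _ => []) [] l.reverse [] [] []) le_rfl rfl e1 e2 ?_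
    rintro (k | k | _ | _ | _ | _ | _) h1 h2 h3
    exacts [rfl, rfl, absurd rfl h1, absurd rfl h2, rfl, rfl, rfl]
  let M₂ : StackProg (K ⊕ K' ⊕ PairStack) Δ τ :=
    scatter (Γ := Δ) (R := A ⊕ B ⊕ C) (.inr (.inr .copy)) (.inl k₀) (.inr (.inl k₀'))
      Sum.inl (Sum.elim (fun a => [i a]) fun _ => []) (Sum.elim (fun a => [i' a]) fun _ => [])
  have hM₂ : ∀ l : List A, M₂.Run (2 * l.length + 2)
      (c₀, st (fun _ => []) (fun _ => []) [] l.reverse [] [] [])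
      (c₀, st (single k₀ (l.map i)) (single k₀' (l.map i')) [] [] [] [] []) := by
    intro l
    have e0 : 2 * l.reverse.length + 2 ≤ 2 * l.length + 2 := by simp
    have e1 : single k₀ (l.map i) k₀ = (l.reverse.reverse.flatMap fun a => [i a]) ++ [] := by
      simp [single_self, ← List.map_eq_flatMap]
    have e2 : single k₀' (l.map i') k₀' = (l.reverse.reverse.flatMap fun a => [i' a]) ++ [] := by
      simp [single_self, ← List.map_eq_flatMap]
    refine run_scatter (Γ := Δ) (by simp) (by simp) (by simp) (s₀, s₀') none
      (S := st (fun _ => []) (fun _ => []) [] l.reverse [] [] [])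
      (S' := st (single k₀ (l.map i)) (single k₀' (l.map i')) [] [] [] [] []) e0 rfl e1 e2 ?_
    rintro (k | k | _ | _ | _ | _ | _) h1 h2 h3
    exacts [single_of_ne (by simpa using h2) _, single_of_ne (by simpa using h3) _, rfl,
      absurd rfl h1, rfl, rfl, rfl]
  let M₃ : StackProg (K ⊕ K' ⊕ PairStack) Δ τ :=
    scatter (Γ := Δ) (R := A ⊕ B ⊕ C) (.inr (.inl k₁')) (.inr (.inr .snd)) (.inr (.inr .fst))
      (fun x => .inr (.inr (j'.symm x)))
      (Sum.elim (fun _ => []) (Sum.elim (fun _ => []) fun c => [c])) (fun _ => [])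
  have hM₃ : ∀ (x) (w : List C), M₃.Run (2 * w.length + 2)
      (c₀, st x (single k₁' (w.map j')) [] [] [] [] [])
      (c₀, st x (fun _ => []) [] [] [] w.reverse []) := by
    intro x w
    have e0 : 2 * (single k₁' (w.map j') k₁').length + 2 ≤ 2 * w.length + 2 := by
      simp [single_self]
    have e1 : w.reverse
        = ((single k₁' (w.map j') k₁').reverse.flatMap fun a => [j'.symm a]) ++ [] := by
      simp [single_self, ← List.map_eq_flatMap, Function.comp_def]
    have e2 : [] = ((single k₁' (w.map j') k₁').reverse.flatMap fun _ => ([] : List B)) ++ [] := by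
      simp
    refine run_scatter (Γ := Δ) (by simp) (by simp) (by simp) (s₀, s₀') none
      (S := st x (single k₁' (w.map j')) [] [] [] [] [])
      (S' := st x (fun _ => []) [] [] [] w.reverse []) e0 rfl e1 e2 ?_
    rintro (k | k | _ | _ | _ | _ | _) h1 h2 h3
    exacts [rfl, (single_of_ne (by simpa using h1) _).symm, rfl, rfl, rfl, absurd rfl h2, rfl]
  let M₄ : StackProg (K ⊕ K' ⊕ PairStack) Δ τ :=
    scatter (Γ := Δ) (R := A ⊕ B ⊕ C) (.inr (.inr .snd)) (.inr (.inr .out)) (.inr (.inr .fst))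
      (fun x => .inr (.inr x))
      (Sum.elim (fun _ => []) (Sum.elim (fun _ => []) fun c => [.inr c])) (fun _ => [])
  have hM₄ : ∀ (x) (w : List C), M₄.Run (2 * w.length + 2)
      (c₀, st x (fun _ => []) [] [] [] w.reverse [])
      (c₀, st x (fun _ => []) [] [] [] [] (w.map .inr)) := by
    intro x w
    have e0 : 2 * w.reverse.length + 2 ≤ 2 * w.length + 2 := by simp
    have e1 : w.map (Sum.inr (α := B))
        = (w.reverse.reverse.flatMap fun a => [Sum.inr a]) ++ [] := by
      simp [← List.map_eq_flatMap]
    have e2 : [] = (w.reverse.reverse.flatMap fun _ => ([] : List B)) ++ [] := by simp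
    refine run_scatter (Γ := Δ) (by simp) (by simp) (by simp) (s₀, s₀') none
      (S := st x (fun _ => []) [] [] [] w.reverse [])
      (S' := st x (fun _ => []) [] [] [] [] (w.map Sum.inr)) e0 rfl e1 e2 ?_
    rintro (k | k | _ | _ | _ | _ | _) h1 h2 h3
    exacts [rfl, rfl, rfl, rfl, rfl, absurd rfl h1, absurd rfl h2]
  let M₅ : StackProg (K ⊕ K' ⊕ PairStack) Δ τ :=
    scatter (Γ := Δ) (R := A ⊕ B ⊕ C) (.inl k₁) (.inr (.inr .fst)) (.inr (.inr .snd))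
      (fun x => .inr (.inl (j.symm x)))
      (Sum.elim (fun _ => []) (Sum.elim (fun b => [b]) fun _ => [])) (fun _ => [])
  have hM₅ : ∀ (w : List B) (d), M₅.Run (2 * w.length + 2)
      (c₀, st (single k₁ (w.map j)) (fun _ => []) [] [] [] [] d)
      (c₀, st (fun _ => []) (fun _ => []) [] [] w.reverse [] d) := by
    intro w d
    have e0 : 2 * (single k₁ (w.map j) k₁).length + 2 ≤ 2 * w.length + 2 := by
      simp [single_self]
    have e1 : w.reverse
        = ((single k₁ (w.map j) k₁).reverse.flatMap fun a => [j.symm a]) ++ [] := by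
      simp [single_self, ← List.map_eq_flatMap, Function.comp_def]
    have e2 : [] = ((single k₁ (w.map j) k₁).reverse.flatMap fun _ => ([] : List C)) ++ [] := by
      simp
    refine run_scatter (Γ := Δ) (by simp) (by simp) (by simp) (s₀, s₀') none
      (S := st (single k₁ (w.map j)) (fun _ => []) [] [] [] [] d)
      (S' := st (fun _ => []) (fun _ => []) [] [] w.reverse [] d) e0 rfl e1 e2 ?_
    rintro (k | k | _ | _ | _ | _ | _) h1 h2 h3
    exacts [(single_of_ne (by simpa using h1) _).symm, rfl, rfl, rfl, absurd rfl h2, rfl, rfl]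
  let M₆ : StackProg (K ⊕ K' ⊕ PairStack) Δ τ :=
    scatter (Γ := Δ) (R := A ⊕ B ⊕ C) (.inr (.inr .fst)) (.inr (.inr .out)) (.inr (.inr .snd))
      (fun x => .inr (.inl x))
      (Sum.elim (fun _ => []) (Sum.elim (fun b => [.inl b]) fun _ => [])) (fun _ => [])
  have hM₆ : ∀ (w : List B) (d), M₆.Run (2 * w.length + 2)
      (c₀, st (fun _ => []) (fun _ => []) [] [] w.reverse [] d)
      (c₀, st (fun _ => []) (fun _ => []) [] [] [] [] (w.map .inl ++ d)) := by
    intro w d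
    have e0 : 2 * w.reverse.length + 2 ≤ 2 * w.length + 2 := by simp
    have e1 : w.map (Sum.inl (β := C)) ++ d
        = (w.reverse.reverse.flatMap fun a => [Sum.inl a]) ++ d := by
      simp [← List.map_eq_flatMap]
    have e2 : [] = (w.reverse.reverse.flatMap fun _ => ([] : List C)) ++ [] := by simp
    refine run_scatter (Γ := Δ) (by simp) (by simp) (by simp) (s₀, s₀') none
      (S := st (fun _ => []) (fun _ => []) [] [] w.reverse [] d)
      (S' := st (fun _ => []) (fun _ => []) [] [] [] [] (w.map Sum.inl ++ d)) e0 rfl e1 e2 ?_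
    rintro (k | k | _ | _ | _ | _ | _) h1 h2 h3
    exacts [rfl, rfl, rfl, rfl, absurd rfl h1, rfl, absurd rfl h2]
  refine computableInPolyTime_of_stacks (Γ := Δ)
    (M₁.seq (M₂.seq (Q₁.seq (Q₂.seq (M₃.seq (M₄.seq (M₅.seq M₆))))))) c₀
    (k₀ := .inr (.inr .inp)) (k₁ := .inr (.inr .out)) (Equiv.refl A) (Equiv.refl (B ⊕ C))
    (2 * (2 * .X + 2) + time + time' + 2 * (2 * q' + 2) + 2 * (2 * q + 2))
    (fun a => st (fun _ => []) (fun _ => []) (ea a) [] [] [] [])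
    (fun a => st (fun _ => []) (fun _ => []) [] [] [] []
      ((eb (f a)).map .inl ++ (ec (g a)).map .inr)) (fun a => (List.map_id _).symm) ?_
    (fun a => (List.map_id _).symm) ?_ fun a => ?_
  · rintro a (k | k | _ | _ | _ | _ | _) hk
    exacts [rfl, rfl, absurd rfl hk, rfl, rfl, rfl, rfl]
  · rintro a (k | k | _ | _ | _ | _ | _) hk
    exacts [rfl, rfl, rfl, rfl, rfl, rfl, absurd rfl hk]
  have := (hM₁ (ea a)).seq ((hM₂ (ea a)).seq ((hQ₁ a _ _ _ _ _ _).seq ((hQ₂ a _ _ _ _ _ _).seq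
    ((hM₃ _ _).seq ((hM₄ _ _).seq ((hM₅ _ _).seq (hM₆ _ _)))))))
  refine this.mono ?_
  have h1 := hq a
  have h2 := hq' a
  simp only [Polynomial.eval_add, Polynomial.eval_mul, Polynomial.eval_ofNat, Polynomial.eval_X]
  omega

/-- The stacks used to fold a function over a list besides those of the machine that computes it. -/
inductive FoldStack : Type
  | inp | state | rest | list | out
  deriving DecidableEq

instance : Fintype FoldStack :=
  ⟨{.inp, .state, .rest, .list, .out}, fun x => by cases x <;> simp⟩

/-- The size hypothesis is essential: polynomial time for each step alone would allow the state to
grow exponentially over the rounds. -/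
theorem foldl [Fintype A] [Fintype B] {step : β → A → β}
    (h : TM2ComputableInPolyTime (fun x : β × A => (eb x.1).map Sum.inl ++ [Sum.inr x.2]) eb
      fun x => step x.1 x.2) (init : α → β) (list : α → List A)
    (q : Polynomial ℕ) (hq : ∀ a l, l <+: list a → (eb (l.foldl step (init a))).length
      ≤ q.eval ((eb (init a)).length + (list a).length)) :
    Nonempty (TM2ComputableInPolyTime
      (fun a => (eb (init a)).map Sum.inl ++ (list a).map Sum.inr) eb
      fun a => (list a).foldl step (init a)) := by
  obtain ⟨K, _, _, Γ, σ, _, P, s₀, k₀, k₁, i, j, time, hP⟩ := exists_of_computableInPolyTime h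
  let Δ : K ⊕ FoldStack → Type := Sum.elim Γ fun
    | .inp => B ⊕ A | .state => B | .rest => A | .list => A | .out => B
  let τ : Type := σ × Option (B ⊕ A)
  let c₀ : τ := (s₀, none)
  let enc (s : List B) (a : A) : List (Γ k₀) := (s.map Sum.inl ++ [Sum.inr a]).map i
  let st (x : ∀ k, List (Γ k)) (u : List (B ⊕ A)) (s : List B) (l l' : List A) (v : List B) :
      ∀ k, List (Δ k) :=
    joinStacks x fun | .inp => u | .state => s | .rest => l | .list => l' | .out => v
  let Q : StackProg (K ⊕ FoldStack) Δ τ :=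
    lift (Γ := Δ) Sum.inl (fun s => s.1) (fun s a => (a, s.2)) P
  have hQ : ∀ b a u s l l' v, Q.Run (time.eval ((eb b).length + 1))
      (c₀, st (single k₀ (enc (eb b) a)) u s l l' v)
      (c₀, st (single k₁ ((eb (step b a)).map j)) u s l l' v) := by
    intro b a u s l l' v
    have := hP (b, a)
    simp only [List.length_append, List.length_map, List.length_singleton] at this
    refine Run.lift (Γ := Δ) (P := P) (get := fun s : τ => s.1)
      (set := fun s a => (a, s.2)) (s := c₀) (s' := s₀)
      (S := st (single k₀ (enc (eb b) a)) u s l l' v)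
      (S' := st (single k₁ ((eb (step b a)).map j)) u s l l' v)
      Sum.inl_injective (fun _ _ => rfl) (fun _ _ _ => rfl) (fun _ => rfl) this fun k hk => ?_
    rcases k with k | k
    exacts [absurd ⟨k, rfl⟩ hk, rfl]
  let N₁ : StackProg (K ⊕ FoldStack) Δ τ :=
    scatter (Γ := Δ) (R := B ⊕ A) (.inr .inp) (.inr .state) (.inr .rest) (fun x => x)
      (Sum.elim (fun b => [b]) fun _ => []) (Sum.elim (fun _ => []) fun a => [a])
  have hN₁ : ∀ (s : List B) (l : List A), N₁.Run (2 * (s.length + l.length) + 2)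
      (c₀, st (fun _ => []) (s.map Sum.inl ++ l.map Sum.inr) [] [] [] [])
      (c₀, st (fun _ => []) [] s.reverse l.reverse [] []) := by
    intro s l
    have e0 : 2 * (s.map Sum.inl ++ l.map Sum.inr).length + 2
        ≤ 2 * (s.length + l.length) + 2 := by simp
    have e1 : s.reverse = ((s.map Sum.inl ++ l.map Sum.inr).reverse.flatMap
        (Sum.elim (fun b => [b]) fun _ => [])) ++ [] := by
      simp [List.flatMap_map, ← List.map_reverse]
    have e2 : l.reverse = ((s.map Sum.inl ++ l.map Sum.inr).reverse.flatMap
        (Sum.elim (fun _ => []) fun a => [a])) ++ [] := by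
      simp [List.flatMap_map, ← List.map_reverse]
    refine run_scatter (Γ := Δ) (by simp) (by simp) (by simp) s₀ none
      (S := st (fun _ => []) (s.map Sum.inl ++ l.map Sum.inr) [] [] [] [])
      (S' := st (fun _ => []) [] s.reverse l.reverse [] []) e0 rfl e1 e2 ?_
    rintro (k | _ | _ | _ | _ | _) h1 h2 h3
    exacts [rfl, absurd rfl h1, absurd rfl h2, absurd rfl h3, rfl, rfl]
  let N₂ : StackProg (K ⊕ FoldStack) Δ τ :=
    scatter (Γ := Δ) (R := B ⊕ A) (.inr .rest) (.inr .list) (.inr .inp) Sum.inr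
      (Sum.elim (fun _ => []) fun a => [a]) (fun _ => [])
  have hN₂ : ∀ (s : List B) (l : List A), N₂.Run (2 * l.length + 2)
      (c₀, st (fun _ => []) [] s l.reverse [] []) (c₀, st (fun _ => []) [] s [] l []) := by
    intro s l
    have e0 : 2 * l.reverse.length + 2 ≤ 2 * l.length + 2 := by simp
    have e1 : l = (l.reverse.reverse.flatMap fun a => [a]) ++ [] := by simp
    have e2 : [] = (l.reverse.reverse.flatMap fun _ => ([] : List (B ⊕ A))) ++ ([] : List (B ⊕ A)) := by simp
    refine run_scatter (Γ := Δ) (by simp) (by simp) (by simp) s₀ none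
      (S := st (fun _ => []) [] s l.reverse [] [])
      (S' := st (fun _ => []) [] s [] l []) e0 rfl e1 e2 ?_
    rintro (k | _ | _ | _ | _ | _) h1 h2 h3
    exacts [rfl, rfl, rfl, absurd rfl h1, absurd rfl h2, rfl]
  let N₃ : StackProg (K ⊕ FoldStack) Δ τ :=
    scatter (Γ := Δ) (R := B ⊕ A) (.inr .state) (.inl k₀) (.inr .inp) Sum.inl
      (Sum.elim (fun b => [i (.inl b)]) fun _ => []) (fun _ => [])
  have hN₃ : ∀ (s : List B) (a : A) (l : List A) (r), N₃.Run (2 * s.length + 2)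
      ((s₀, r), st (single k₀ [i (.inr a)]) [] s.reverse [] l [])
      (c₀, st (single k₀ (enc s a)) [] [] [] l []) := by
    intro s a l r
    have e0 : 2 * s.reverse.length + 2 ≤ 2 * s.length + 2 := by simp
    have e1 : single k₀ (enc s a) k₀
        = (s.reverse.reverse.flatMap fun b => [i (.inl b)]) ++ single k₀ [i (.inr a)] k₀ := by
      simp [single_self, ← List.map_eq_flatMap, enc]
    have e2 : [] = (s.reverse.reverse.flatMap fun _ => ([] : List (B ⊕ A))) ++ ([] : List (B ⊕ A)) := by simp
    refine run_scatter (Γ := Δ) (src := .inr .state) (dst := .inl k₀) (dst' := .inr .inp)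
      (R := B ⊕ A) (i := Sum.inl) (φ := Sum.elim (fun b => [i (.inl b)]) fun _ => [])
      (φ' := fun _ => [])
      (by simp) (by simp) (by simp) s₀ r
      (S := st (single k₀ [i (Sum.inr a)]) [] s.reverse [] l [])
      (S' := st (single k₀ (enc s a)) [] [] [] l []) e0 rfl e1 e2 ?_
    rintro (k | _ | _ | _ | _ | _) h1 h2 h3
    exacts [(single_of_ne (by simpa using h2) _).trans (single_of_ne (by simpa using h2) _).symm,
      rfl, absurd rfl h1, rfl, rfl, rfl]
  let N₄ : StackProg (K ⊕ FoldStack) Δ τ :=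
    scatter (Γ := Δ) (R := B ⊕ A) (.inl k₁) (.inr .state) (.inr .inp) (fun x => .inl (j.symm x))
      (Sum.elim (fun b => [b]) fun _ => []) (fun _ => [])
  have hN₄ : ∀ (s : List B) (l : List A), N₄.Run (2 * s.length + 2)
      (c₀, st (single k₁ (s.map j)) [] [] [] l [])
      (c₀, st (fun _ => []) [] s.reverse [] l []) := by
    intro s l
    have e0 : 2 * (single k₁ (s.map j) k₁).length + 2 ≤ 2 * s.length + 2 := by
      simp [single_self]
    have e1 : s.reverse = ((single k₁ (s.map j) k₁).reverse.flatMap fun b => [j.symm b]) ++ [] := by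
      simp [single_self, ← List.map_eq_flatMap, Function.comp_def]
    have e2 : [] = ((single k₁ (s.map j) k₁).reverse.flatMap fun _ => ([] : List (B ⊕ A))) ++ ([] : List (B ⊕ A)) := by
      simp
    refine run_scatter (Γ := Δ) (by simp) (by simp) (by simp) s₀ none
      (S := st (single k₁ (s.map j)) [] [] [] l [])
      (S' := st (fun _ => []) [] s.reverse [] l []) e0 rfl e1 e2 ?_
    rintro (k | _ | _ | _ | _ | _) h1 h2 h3
    exacts [(single_of_ne (by simpa using h1) _).symm, rfl, absurd rfl h2, rfl, rfl, rfl]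
  let N₅ : StackProg (K ⊕ FoldStack) Δ τ :=
    scatter (Γ := Δ) (R := B ⊕ A) (.inr .state) (.inr .out) (.inr .inp) Sum.inl
      (Sum.elim (fun b => [b]) fun _ => []) (fun _ => [])
  have hN₅ : ∀ (s : List B), N₅.Run (2 * s.length + 2)
      (c₀, st (fun _ => []) [] s.reverse [] [] []) (c₀, st (fun _ => []) [] [] [] [] s) := by
    intro s
    have e0 : 2 * s.reverse.length + 2 ≤ 2 * s.length + 2 := by simp
    have e1 : s = (s.reverse.reverse.flatMap fun b => [b]) ++ [] := by simp
    have e2 : [] = (s.reverse.reverse.flatMap fun _ => ([] : List (B ⊕ A))) ++ ([] : List (B ⊕ A)) := by simp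
    refine run_scatter (Γ := Δ) (by simp) (by simp) (by simp) s₀ none
      (S := st (fun _ => []) [] s.reverse [] [] [])
      (S' := st (fun _ => []) [] [] [] [] s) e0 rfl e1 e2 ?_
    rintro (k | _ | _ | _ | _ | _) h1 h2 h3
    exacts [rfl, rfl, absurd rfl h1, rfl, rfl, absurd rfl h2]
  -- The machine expects the state followed by the letter, so the letter is pushed before the state
  -- is moved on top of it.
  let body : Option (B ⊕ A) → StackProg (K ⊕ FoldStack) Δ τ
    | some (.inr a) =>
      (prim (pushWord (Γ := Δ) (.inl k₀) .halt [i (.inr a)])).seq (N₃.seq (Q.seq N₄))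
    | _ => prim .halt
  let put : τ → Option (Δ (.inr .list)) → τ := fun s x => (s.1, Option.map Sum.inr x)
  let L : StackProg (K ⊕ FoldStack) Δ τ :=
    loop (Γ := Δ) (.inr .list) put (ι := Option (B ⊕ A))
      (fun s => s.2) body Option.isSome
  have hbody : ∀ b a l, (body (some (.inr a))).Run
      (1 + ((2 * (eb b).length + 2) + (time.eval ((eb b).length + 1)
        + (2 * (eb (step b a)).length + 2))))
      ((s₀, some (.inr a)), st (fun _ => []) [] (eb b).reverse [] l [])
      (c₀, st (fun _ => []) [] (eb (step b a)).reverse [] l []) := by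
    intro b a l
    refine Run.seq (c' := ((s₀, some (.inr a)), st (single k₀ [i (.inr a)]) [] (eb b).reverse [] l []))
      (run_prim ?_) ((hN₃ _ _ _ _).seq ((hQ _ _ _ _ _ _ _).seq (hN₄ _ _)))
    rw [stepAux_pushWord]
    refine congrArg (TM2.Cfg.mk none (s₀, some (Sum.inr a))) (funext fun k => ?_)
    rcases k with k | k
    · by_cases hk : k = k₀
      · subst hk
        refine (Function.update_self (β := fun k => List (Δ k)) (Sum.inl k) _ _).trans ?_
        exact (single_self (Γ := Γ) k [i (.inr a)]).symm
      · refine (Function.update_of_ne (β := fun k => List (Δ k)) (by simpa using hk) _ _).trans ?_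
        exact (single_of_ne (Γ := Γ) hk [i (.inr a)]).symm
    · exact Function.update_of_ne (β := fun k => List (Δ k)) (by simp) _ _
  -- A common bound `M` for all intermediate states makes every round equally expensive.
  have hL : ∀ (l : List A) (b : β) (M : ℕ), (∀ l', l' <+: l → (eb (l'.foldl step b)).length ≤ M) →
      L.Run (l.length * (2 * (2 * M + 2) + time.eval (M + 1) + 2) + 2)
        (c₀, st (fun _ => []) [] (eb b).reverse [] l [])
        (c₀, st (fun _ => []) [] (eb (l.foldl step b)).reverse [] [] []) := by
    intro l
    induction l with
    | nil =>
      intro b M hM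
      have e : Function.update (st (fun _ => []) [] (eb b).reverse [] [] []) (.inr .list) []
          = st (fun _ => []) [] (eb b).reverse [] [] [] := Function.update_eq_self _ _
      have h0 : (body none).Run 1
          (c₀, Function.update (st (fun _ => []) [] (eb b).reverse [] [] []) (.inr .list) [])
          (c₀, st (fun _ => []) [] (eb b).reverse [] [] []) :=
        run_prim (congrArg (TM2.Cfg.mk none c₀) e)
      exact (run_loop_stop (Γ := Δ) (src := (Sum.inr .list : K ⊕ FoldStack))
        (put := put) (dec := fun s : τ => s.2)
        (P := body) (more := Option.isSome) (s := c₀)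
        (S := st (fun _ => []) [] (eb b).reverse [] [] []) rfl h0).mono (by omega)
    | cons a l ih =>
      intro b M hM
      have h0 := hM [] (List.nil_prefix)
      have h1 := hM [a] (by simp)
      have h2 := time.monotone_eval_nat (Nat.add_le_add_right h0 1)
      have e : Function.update (st (fun _ => []) [] (eb b).reverse [] (a :: l) []) (.inr .list) l
          = st (fun _ => []) [] (eb b).reverse [] l [] := by
        funext k
        by_cases hk : k = .inr .list
        · subst hk
          exact Function.update_self (β := fun k => List (Δ k)) _ _ _
        · refine (Function.update_of_ne (β := fun k => List (Δ k)) hk _ _).trans ?_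
          rcases k with k | _ | _ | _ | _ | _
          exacts [rfl, rfl, rfl, rfl, absurd rfl hk, rfl]
      have h3 := ih (step b a) M fun l' hl' => hM (a :: l') (by simpa using hl')
      have h4 := hbody b a l
      rw [← e] at h4
      refine (run_loop_more (Γ := Δ) (src := (Sum.inr .list : K ⊕ FoldStack))
        (put := put) (dec := fun s : τ => s.2)
        (P := body) (more := Option.isSome) (s := c₀)
        (S := st (fun _ => []) [] (eb b).reverse [] (a :: l) []) rfl h4 h3).mono ?_
      simp only [List.foldl_nil, List.foldl_cons] at h0 h1 h2
      simp only [List.length_cons, Nat.succ_mul]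
      omega
  refine computableInPolyTime_of_stacks (Γ := Δ) (N₁.seq (N₂.seq (L.seq N₅))) c₀
    (k₀ := .inr .inp) (k₁ := .inr .out) (Equiv.refl (B ⊕ A)) (Equiv.refl B)
    ((2 * .X + 2) + ((2 * .X + 2) + (.X * (2 * (2 * q + 2) + time.comp (q + 1) + 2) + 2
      + (2 * q + 2))))
    (fun x => st (fun _ => []) ((eb (init x)).map .inl ++ (list x).map .inr) [] [] [] [])
    (fun x => st (fun _ => []) [] [] [] [] (eb ((list x).foldl step (init x))))
    (fun x => (List.map_id _).symm) ?_ (fun x => (List.map_id _).symm) ?_ fun x => ?_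
  · rintro a (k | _ | _ | _ | _ | _) hk
    exacts [rfl, absurd rfl hk, rfl, rfl, rfl, rfl]
  · rintro a (k | _ | _ | _ | _ | _) hk
    exacts [rfl, rfl, rfl, rfl, rfl, absurd rfl hk]
  have h1 := hL (list x) (init x) _ (fun l hl => hq x l hl)
  refine ((hN₁ (eb (init x)) (list x)).seq ((hN₂ _ _).seq (h1.seq (hN₅ _)))).mono ?_
  have h2 := hq x _ (List.prefix_refl _)
  have h3 : (list x).length ≤ (eb (init x)).length + (list x).length := by omega
  simp only [Polynomial.eval_add, Polynomial.eval_mul, Polynomial.eval_ofNat, Polynomial.eval_X,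
    Polynomial.eval_comp, Polynomial.eval_one, List.length_append, List.length_map]
  have h4 := Nat.mul_le_mul_right (2 * (2 * q.eval ((eb (init x)).length + (list x).length) + 2)
    + time.eval (q.eval ((eb (init x)).length + (list x).length) + 1) + 2) h3
  omega

end Turing.TM2ComputableInPolyTime

end

/-! ### Closure properties of polynomial-time functions -/

section

open Turing Computability

/-- A type whose elements are written as words over a finite alphabet. -/
class Enc (α : Type) where
  Sym : Type
  [fintype : Fintype Sym]
  enc : α → List Sym

/-- A finite type whose elements are used as symbols. -/
class Letter (α : Type) extends Fintype α

instance : Letter Bool where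
instance {α : Type} [Letter α] : Letter (Option α) where
instance {n : ℕ} : Letter (Fin n) where

namespace Enc

attribute [reducible, instance] Enc.fintype

instance {α : Type} [Letter α] : Enc α := ⟨α, fun a => [a]⟩
instance {α : Type} [Letter α] : Enc (List α) := ⟨α, id⟩
instance : Enc ℕ := ⟨Bool, unaryEncodeNat⟩
instance {α β : Type} [Enc α] [Enc β] : Enc (α × β) :=
  ⟨Sym α ⊕ Sym β, fun x => (enc x.1).map Sum.inl ++ (enc x.2).map Sum.inr⟩

/-- The length of the encoding. -/
abbrev len {α : Type} [Enc α] (a : α) : ℕ := (enc a).length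

theorem enc_prod {α β : Type} [Enc α] [Enc β] (x : α × β) :
    enc x = (enc x.1).map Sum.inl ++ (enc x.2).map Sum.inr := rfl
theorem enc_letter {α : Type} [Letter α] (x : α) : enc x = [x] := rfl
theorem enc_list {α : Type} [Letter α] (x : List α) : enc x = x := rfl
theorem enc_nat (n : ℕ) : enc n = List.replicate n true := by
  change unaryEncodeNat n = _
  induction n with
  | zero => rfl
  | succ n ih => simp [unaryEncodeNat, ih, List.replicate_succ]

@[simp] theorem len_prod {α β : Type} [Enc α] [Enc β] (x : α × β) : len x = len x.1 + len x.2 := by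
  simp [len, enc_prod]
@[simp] theorem len_letter {α : Type} [Letter α] (x : α) : len x = 1 := rfl
@[simp] theorem len_list {α : Type} [Letter α] (x : List α) : len x = x.length := rfl
@[simp] theorem len_nat (n : ℕ) : len n = n := by simp [len, enc_nat]

end Enc

open Enc

variable {α β γ δ : Type} [Enc α] [Enc β] [Enc γ] [Enc δ]

/-- Computability in polynomial time with respect to the encodings given by `Enc`. -/
@[fun_prop]
def PT (f : α → β) : Prop :=
  Nonempty (TM2ComputableInPolyTime (enc : α → _) (enc : β → _) f)

namespace PT

theorem exists_len_le {f : α → β} (hf : PT f) : ∃ q : Polynomial ℕ, ∀ a, len (f a) ≤ q.eval (len a) :=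
  hf.elim fun h => h.exists_length_le

theorem of_transduce {Q : Type} [Fintype Q] (d : Q → Sym α → Q × List (Sym β))
    (fin : Q → List (Sym β)) (q₀ : Q) {f : α → β}
    (h : ∀ a, enc (f a) = transduce d fin q₀ (enc a)) : PT f :=
  TM2ComputableInPolyTime.of_transduce d fin q₀ h

theorem transduce_unit {A B : Type} (g : A → List B) (l : List A) :
    transduce (fun (_ : Unit) a => ((), g a)) (fun _ => []) () l = l.flatMap g := by
  induction l with
  | nil => rfl
  | cons a l ih => simp [transduce, ih]

theorem of_flatMap (g : Sym α → List (Sym β)) {f : α → β} (h : ∀ a, enc (f a) = (enc a).flatMap g) :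
    PT f :=
  of_transduce (Q := Unit) (fun _ a => ((), g a)) (fun _ => []) () fun a => by
    rw [h, transduce_unit]

theorem of_enc_eq {f : α → β} (e : Sym α → Sym β) (h : ∀ a, enc (f a) = (enc a).map e) : PT f :=
  of_flatMap (fun a => [e a]) fun a => by rw [h, List.map_eq_flatMap]

@[fun_prop] theorem id : PT (fun a : α => a) := of_enc_eq (fun a => a) fun a => by simp

@[fun_prop] theorem const (b : β) : PT (fun _ : α => b) :=
  of_transduce (Q := Unit) (fun _ _ => ((), [])) (fun _ => enc b) () fun a => by
    induction enc a with
    | nil => rfl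
    | cons a l ih => exact ih

@[fun_prop] theorem comp {g : β → γ} {f : α → β} (hg : PT g) (hf : PT f) : PT fun a => g (f a) :=
  hg.elim fun hg => hf.elim fun hf => hg.comp hf

@[fun_prop] theorem prodMk {f : α → β} {g : α → γ} (hf : PT f) (hg : PT g) :
    PT fun a => (f a, g a) :=
  hf.elim fun hf => hg.elim fun hg => hf.pair hg

theorem fst' : PT (Prod.fst : α × β → α) :=
  of_flatMap (Sum.elim (fun a => [a]) fun _ => []) fun a => by
    simp [enc_prod, List.flatMap_map]

theorem snd' : PT (Prod.snd : α × β → β) :=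
  of_flatMap (Sum.elim (fun _ => []) fun a => [a]) fun a => by
    simp [enc_prod, List.flatMap_map]

@[fun_prop] theorem fst {f : α → β × γ} (hf : PT f) : PT fun a => (f a).1 := fst'.comp hf
@[fun_prop] theorem snd {f : α → β × γ} (hf : PT f) : PT fun a => (f a).2 := snd'.comp hf

section List

variable {A B : Type} [Letter A] [Letter B]

@[fun_prop] theorem append {f g : α → List A} (hf : PT f) (hg : PT g) : PT fun a => f a ++ g a := by
  have : PT fun x : List A × List A => x.1 ++ x.2 :=
    of_enc_eq (α := List A × List A) (Sum.elim (fun a : A => a) fun a : A => a) fun a => by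
      change a.1 ++ a.2 = (a.1.map Sum.inl ++ a.2.map Sum.inr).map
        (Sum.elim (fun a : A => a) fun a : A => a)
      simp
  exact this.comp (hf.prodMk hg)

@[fun_prop] theorem cons {f : α → A} {g : α → List A} (hf : PT f) (hg : PT g) :
    PT fun a => f a :: g a := by
  have : PT fun x : A × List A => x.1 :: x.2 :=
    of_enc_eq (α := A × List A) (Sum.elim (fun a : A => a) fun a : A => a) fun a => by
      change a.1 :: a.2 = ([a.1].map Sum.inl ++ a.2.map Sum.inr).map
        (Sum.elim (fun a : A => a) fun a : A => a)
      simp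
  exact this.comp (hf.prodMk hg)

theorem flatMap (g : A → List B) {f : α → List A} (hf : PT f) : PT fun a => (f a).flatMap g := by
  have : PT fun x : List A => x.flatMap g := of_flatMap g fun a => rfl
  exact this.comp hf

@[fun_prop] theorem head? {f : α → List A} (hf : PT f) : PT fun a => (f a).head? := by
  have : PT fun x : List A => x.head? :=
    of_transduce (Q := Bool) (fun q a => (false, if q then [some a] else []))
      (fun q => if q then [none] else []) true fun l => by
        have h : ∀ l : List A, transduce (fun (q : Bool) (a : A) =>
          (false, if q then [some a] else [])) (fun q => if q then [none] else []) false l = [] := by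
            intro l
            induction l with
            | nil => rfl
            | cons a l ih => simpa [transduce] using ih
        cases l with
        | nil => rfl
        | cons a l =>
          exact congrArg ([some a] ++ ·) (h l).symm
  exact this.comp hf

@[fun_prop] theorem tail {f : α → List A} (hf : PT f) : PT fun a => (f a).tail := by
  have : PT fun x : List A => x.tail :=
    of_transduce (Q := Bool) (fun q a => (false, if q then [] else [a])) (fun q => []) true fun l => by
        have h : ∀ l : List A, transduce (fun (q : Bool) (a : A) =>
          (false, if q then [] else [a])) (fun q => []) false l = l := by
            intro l
            induction l with
            | nil => rfl
            | cons a l ih => simpa [transduce] using ih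
        cases l with
        | nil => rfl
        | cons a l =>
          exact (h l).symm
  exact this.comp hf

/-- Any function on a finite alphabet is a table built into a transducer. -/
theorem letter (g : A → β) {f : α → A} (hf : PT f) : PT fun a => g (f a) := by
  have : PT g := of_flatMap (fun a => enc (g a)) fun a => by simp [enc_letter]
  exact this.comp hf

theorem letter₂ (g : A → B → β) {f : α → A} {f' : α → B} (hf : PT f) (hf' : PT f') :
    PT fun a => g (f a) (f' a) := by
  let d : Option A → A ⊕ B → Option A × List (Sym β)
    | some a, .inr b => (none, enc (g a b))
    | _, .inl a => (some a, [])
    | _, _ => (none, [])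
  have : PT fun x : A × B => g x.1 x.2 :=
    of_transduce (α := A × B) d (fun _ => []) none fun x => by
      change _ = enc (g x.1 x.2) ++ ([] ++ [])
      simp
  exact this.comp (hf.prodMk hf')

end List

/-- Both branches are computed, and a transducer erases one of them. The selecting symbol comes
first in the encoding, so it is known before either result is read. -/
theorem cond {p : α → Bool} {f g : α → β} (hp : PT p) (hf : PT f) (hg : PT g) :
    PT fun a => bif p a then f a else g a := by
  let d : Bool → Bool ⊕ (Sym β ⊕ Sym β) → Bool × List (Sym β)
    | _, .inl b => (b, [])
    | q, .inr (.inl s) => (q, if q then [s] else [])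
    | q, .inr (.inr s) => (q, if q then [] else [s])
  have : PT fun x : Bool × (β × β) => bif x.1 then x.2.1 else x.2.2 :=
    of_transduce (α := Bool × (β × β)) d (fun _ => []) true fun x => by
      obtain ⟨b, x, y⟩ := x
      have h2 : ∀ l : List (Sym β), transduce d (fun _ => []) b (l.map fun s => .inr (.inr s))
          = bif b then [] else l := by
        intro l
        induction l with
        | nil => cases b <;> rfl
        | cons a l ih => cases b <;> simp_all [transduce, d]
      have h1 : ∀ l : List (Sym β), transduce d (fun _ => []) b ((l.map fun s => .inr (.inl s))
          ++ ((enc y).map fun s => .inr (.inr s))) = bif b then l else enc y := by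
        intro l
        induction l with
        | nil => rw [List.map_nil, List.nil_append, h2]
        | cons a l ih => cases b <;> simp_all [transduce, d]
      have h3 := h1 (enc x)
      have : enc (b, x, y) = Sum.inl b :: ((enc x).map (fun s => Sum.inr (Sum.inl s))
          ++ ((enc y).map fun s => Sum.inr (Sum.inr s))) := by
        simp [enc_prod, enc_letter, Function.comp_def]
      rw [this]
      cases b <;> exact h3.symm
  exact this.comp (hp.prodMk (hf.prodMk hg))

@[fun_prop] theorem ite {p : α → Prop} [∀ a, Decidable (p a)] {f g : α → β}
    (hp : PT fun a => decide (p a)) (hf : PT f) (hg : PT g) :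
    PT fun a => if p a then f a else g a := by
  simpa [Bool.cond_decide] using hp.cond hf hg

/-- Here the step may depend on the parameter `c`, which the fold on the level of machines does not
offer. Therefore `c` is carried along in the state, which adds `X` to the size bound. -/
theorem foldl {A : Type} [Letter A] {init : γ → β} {list : γ → List A} {step : γ × β × A → β}
    (hi : PT init) (hl : PT list) (hs : PT step) (q : Polynomial ℕ)
    (hq : ∀ c l, l <+: list c → len (l.foldl (fun s a => step (c, s, a)) (init c)) ≤ q.eval (len c)) :
    PT fun c => (list c).foldl (fun s a => step (c, s, a)) (init c) := by
  have hs' : PT fun x : (γ × β) × A => (x.1.1, step (x.1.1, x.1.2, x.2)) := by fun_prop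
  have hf : ∀ (l : List A) c s, l.foldl (fun (x : γ × β) a => (x.1, step (x.1, x.2, a))) (c, s)
      = (c, l.foldl (fun s a => step (c, s, a)) s) := by
    intro l
    induction l with
    | nil => intros; rfl
    | cons a l ih => intro c s; simpa using ih _ _
  have hp : PT fun c => ((c, init c), list c) := by fun_prop
  obtain ⟨T⟩ := hs'
  obtain ⟨U⟩ := hp
  obtain ⟨V⟩ := TM2ComputableInPolyTime.foldl (step := fun (x : γ × β) a => (x.1, step (x.1, x.2, a)))
    T (fun c => (c, init c)) list (.X + q) fun c l hl => by
      rw [hf]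
      have h1 := hq c l hl
      have h2 := q.monotone_eval_nat (show len c ≤ len (c, init c) + (list c).length by simp; omega)
      change len _ ≤ Polynomial.eval (len (c, init c) + (list c).length) (.X + q)
      simp only [len_prod, Polynomial.eval_add, Polynomial.eval_X] at h1 h2 ⊢
      omega
  -- The word for `((c, init c), list c)` is regarded as an encoding of `c` itself, which is the
  -- input format of the fold.
  let U' : TM2ComputableInPolyTime enc (fun c => enc ((c, init c), list c)) (fun c : γ => c) :=
    { U with outputsFun := U.outputsFun }
  have : PT fun c => (list c).foldl (fun (x : γ × β) a => (x.1, step (x.1, x.2, a))) (c, init c) :=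
    TM2ComputableInPolyTime.comp V U'
  simpa only [hf] using this.snd

end PT

end

/-! ### Unary and binary arithmetic -/

section

open Turing Computability Enc

variable {α β γ δ : Type} [Enc α] [Enc β] [Enc γ] [Enc δ]

/-- Polynomially bounded functions. -/
def PolyBounded (f : α → ℕ) : Prop := ∃ q : Polynomial ℕ, ∀ a, f a ≤ q.eval (len a)

namespace PolyBounded

theorem mono {f g : α → ℕ} (hg : PolyBounded g) (h : ∀ a, f a ≤ g a) : PolyBounded f :=
  hg.imp fun _ hq a => (h a).trans (hq a)

theorem const (n : ℕ) : PolyBounded fun _ : α => n := ⟨.C n, by simp⟩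

theorem add {f g : α → ℕ} (hf : PolyBounded f) (hg : PolyBounded g) :
    PolyBounded fun a => f a + g a := by
  obtain ⟨p, hp⟩ := hf
  obtain ⟨q, hq⟩ := hg
  exact ⟨p + q, fun a => by simpa using add_le_add (hp a) (hq a)⟩

theorem mul {f g : α → ℕ} (hf : PolyBounded f) (hg : PolyBounded g) :
    PolyBounded fun a => f a * g a := by
  obtain ⟨p, hp⟩ := hf
  obtain ⟨q, hq⟩ := hg
  exact ⟨p * q, fun a => by simpa using Nat.mul_le_mul (hp a) (hq a)⟩

end PolyBounded

namespace PT

theorem len {f : α → β} (hf : PT f) : PolyBounded fun a => len (f a) := hf.exists_len_le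

theorem polyBounded {f : α → ℕ} (hf : PT f) : PolyBounded f := hf.len.mono fun a => by simp

@[fun_prop] theorem length {A : Type} [Letter A] {f : α → List A} (hf : PT f) :
    PT fun a => (f a).length := by
  have : PT fun x : List A => x.length := of_enc_eq (fun _ => true) fun a => by
    rw [enc_nat]
    exact (List.map_const' ..).symm
  exact this.comp hf

@[fun_prop] theorem ones {f : α → ℕ} (hf : PT f) : PT fun a => List.replicate (f a) true := by
  have : PT fun x : ℕ => List.replicate x true := of_enc_eq (fun b => b) fun a => by
    rw [enc_nat]
    exact (List.map_id' _).symm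
  exact this.comp hf

/-- Functions that are defined by primitive recursion on a number in unary. -/
theorem primrec {F : γ → ℕ → β} {init : γ → β} {step : γ × ℕ × β → β} {n : γ → ℕ} {b : γ → ℕ}
    (hi : PT init) (hs : PT step) (hn : PT n) (h₀ : ∀ c, F c 0 = init c)
    (h : ∀ c i, F c (i + 1) = step (c, i, F c i)) (hb : PolyBounded b)
    (hF : ∀ c i, i ≤ n c → Enc.len (F c i) ≤ b c) : PT fun c => F c (n c) := by
  have h1 : PT fun n : ℕ × Bool => n.1 + 1 := by
    have : PT fun n : ℕ × Bool => (true :: List.replicate n.1 true).length := by fun_prop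
    simpa using this
  -- The recursion is a fold over `n c` ticks whose state carries the counter next to the value.
  have h2 : PT fun x : γ × (ℕ × β) × Bool => (x.2.1.1 + 1, step (x.1, x.2.1.1, x.2.1.2)) := by
    have : PT fun x : γ × (ℕ × β) × Bool => x.2.1.1 + 1 := h1.comp (by fun_prop : PT fun
      x : γ × (ℕ × β) × Bool => (x.2.1.1, x.2.2))
    fun_prop
  have h3 : ∀ c j, (List.replicate j true).foldl (fun (s : ℕ × β) _ => (s.1 + 1, step (c, s.1, s.2)))
      (0, init c) = (j, F c j) := by
    intro c j
    induction j with
    | zero => simp [h₀]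
    | succ j ih => rw [List.replicate_succ', List.foldl_append, ih]; simp [h]
  have h4 : PT fun c => (0, init c) := by fun_prop
  have h5 : PT fun c => List.replicate (n c) true := by fun_prop
  obtain ⟨q, hq⟩ := hn.polyBounded.add hb
  have := (h4.foldl h5 h2 q fun c l hl => ?_).snd
  · simpa only [h3] using this
  · have h6 := (List.prefix_replicate_iff.1 hl)
    rw [h6.2, h3, len_prod, len_nat]
    exact (Nat.add_le_add h6.1 (hF c _ h6.1)).trans (hq c)

section Nat

variable {f g : α → ℕ}

@[fun_prop] theorem add (hf : PT f) (hg : PT g) : PT fun a => f a + g a := by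
  have : PT fun a => (List.replicate (f a) true ++ List.replicate (g a) true).length := by fun_prop
  simpa using this

@[fun_prop] theorem pred (hf : PT f) : PT fun a => f a - 1 := by
  have : PT fun a => (List.replicate (f a) true).tail.length := by fun_prop
  simpa using this

@[fun_prop] theorem sub (hf : PT f) (hg : PT g) : PT fun a => f a - g a :=
  primrec (F := fun a i => f a - i) (step := fun x => x.2.2 - 1) hf (by fun_prop) hg (by simp)
    (by intros; simp only; omega) hf.polyBounded (by simp)

@[fun_prop] theorem mul (hf : PT f) (hg : PT g) : PT fun a => f a * g a :=
  primrec (F := fun a i => f a * i) (init := fun _ => 0) (step := fun x => x.2.2 + f x.1)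
    (by fun_prop) (by fun_prop) hg (by simp) (by intros; simp only; ring)
    (hf.polyBounded.mul hg.polyBounded) (fun c i hi => by
      rw [len_nat]; exact Nat.mul_le_mul_left _ hi)

theorem eval (p : Polynomial ℕ) (hf : PT f) : PT fun a => p.eval (f a) := by
  induction p using Polynomial.induction_on' with
  | add p q hp hq => simpa using hp.add hq
  | monomial n c =>
    simp only [Polynomial.eval_monomial]
    refine PT.mul (by fun_prop) ?_
    induction n with
    | zero => simpa using PT.const 1
    | succ n ih => simpa only [pow_succ] using ih.mul hf

end Nat

section Bool

variable {f g : α → Bool}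

@[fun_prop] theorem not (hf : PT f) : PT fun a => !(f a) := letter (fun b => !b) hf
@[fun_prop] theorem and (hf : PT f) (hg : PT g) : PT fun a => f a && g a :=
  letter₂ (fun a b => a && b) hf hg
@[fun_prop] theorem or (hf : PT f) (hg : PT g) : PT fun a => f a || g a :=
  letter₂ (fun a b => a || b) hf hg
@[fun_prop] theorem xor (hf : PT f) (hg : PT g) : PT fun a => f a ^^ g a :=
  letter₂ (fun a b => a ^^ b) hf hg

theorem if_bool {h k : α → β} (hf : PT f) (hh : PT h) (hk : PT k) :
    PT fun a => if f a then h a else k a := by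
  simpa only [cond_eq_ite] using hf.cond hh hk

@[fun_prop] theorem bitD {f : α → List Bool} (hf : PT f) : PT fun a => (f a).headD false := by
  have : PT fun a => (f a).head?.getD false :=
    letter (fun o : Option Bool => o.getD false) hf.head?
  simpa using this

-- The inequality holds if and only if the truncated difference, written in unary, is the empty
-- word.
@[fun_prop] theorem le {f g : α → ℕ} (hf : PT f) (hg : PT g) : PT fun a => decide (f a ≤ g a) := by
  have : PT fun a => !(List.replicate (f a - g a) true).headD false := by fun_prop
  convert this using 2 with a
  rcases h : f a - g a with _ | n <;> simp [List.replicate_succ] <;> omega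

@[fun_prop] theorem lt {f g : α → ℕ} (hf : PT f) (hg : PT g) : PT fun a => decide (f a < g a) :=
  (hf.add (.const 1)).le hg

@[fun_prop] theorem eq {f g : α → ℕ} (hf : PT f) (hg : PT g) : PT fun a => decide (f a = g a) := by
  have : PT fun a => decide (f a ≤ g a) && decide (g a ≤ f a) := by fun_prop
  simpa [← Bool.decide_and, ← le_antisymm_iff] using this

end Bool

section List

variable {A : Type} [Letter A]

@[fun_prop] theorem drop {f : α → List A} {n : α → ℕ} (hf : PT f) (hn : PT n) :
    PT fun a => (f a).drop (n a) :=
  primrec (F := fun a i => (f a).drop i) (step := fun x => x.2.2.tail) hf (by fun_prop) hn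
    (by simp) (by simp [← List.drop_one]) hf.len (by simp)

@[fun_prop] theorem replicate {n : α → ℕ} (a : A) (hn : PT n) :
    PT fun x => List.replicate (n x) a := by
  have := flatMap (A := Bool) (fun _ => [a]) hn.ones
  simpa only [← List.map_eq_flatMap, List.map_replicate] using this

@[fun_prop] theorem reverse {f : α → List A} (hf : PT f) : PT fun a => (f a).reverse := by
  have h : ∀ l : List A, l.foldl (fun s a => a :: s) [] = l.reverse := by simp
  have := foldl (init := fun _ : α => ([] : List A)) (step := fun x => x.2.2 :: x.2.1)
    (by fun_prop) hf (by fun_prop) hf.exists_len_le.choose fun c l hl => by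
      simp only [h]
      exact (by simpa using hl.length_le : Enc.len l.reverse ≤ (f c).length).trans
        (hf.exists_len_le.choose_spec c)
  simpa only [h] using this

/-- Pieces are appended one by one. Their indices are below `r (len c)`, so each piece has length at
most `q (len c + r (len c))`, and there are at most `r (len c)` of them. -/
theorem flatMap_range {n : γ → ℕ} {g : γ → ℕ → List A} (hn : PT n)
    (hg : PT fun x : γ × ℕ => g x.1 x.2) : PT fun c => (List.range (n c)).flatMap (g c) := by
  obtain ⟨q, hq⟩ := hg.exists_len_le
  obtain ⟨r, hr⟩ := hn.polyBounded
  have h1 : PT fun x : γ × ℕ × List A => g x.1 x.2.1 :=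
    hg.comp (by fun_prop : PT fun x : γ × ℕ × List A => (x.1, x.2.1))
  refine primrec (F := fun c i => (List.range i).flatMap (g c)) (init := fun _ => [])
    (step := fun x => x.2.2 ++ g x.1 x.2.1) (by fun_prop) (by fun_prop) hn (by simp)
    (by simp [List.range_succ]) (b := fun c => r.eval (Enc.len c) * (q.comp (.X + r)).eval (Enc.len c))
    (.mul ⟨_, fun _ => le_rfl⟩ ⟨_, fun _ => le_rfl⟩) fun c i hi => ?_
  refine le_trans ?_ (Nat.mul_le_mul_right _ (hr c))
  refine le_trans ?_ (Nat.mul_le_mul_right _ hi)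
  rw [len_list, List.length_flatMap]
  refine (List.sum_le_card_nsmul _ ((q.comp (.X + r)).eval (Enc.len c)) ?_).trans (by simp)
  simp only [List.mem_map, List.mem_range, forall_exists_index, and_imp, forall_apply_eq_imp_iff₂]
  intro j hj
  refine (hq (c, j)).trans ?_
  simp only [Polynomial.eval_comp, Polynomial.eval_add, Polynomial.eval_X, len_prod, len_nat]
  exact q.monotone_eval_nat (by have := hr c; omega)

end List

end PT

/-- The number with the given binary digits, the least significant digit first. -/
def bitsVal : List Bool → ℕ
  | [] => 0
  | b :: l => b.toNat + 2 * bitsVal l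

@[simp] theorem bitsVal_append (a b : List Bool) :
    bitsVal (a ++ b) = bitsVal a + 2 ^ a.length * bitsVal b := by
  induction a with
  | nil => simp [bitsVal]
  | cons x a ih => simp only [List.cons_append, bitsVal, ih, List.length_cons, pow_succ]; ring

@[simp] theorem bitsVal_replicate_false (n : ℕ) : bitsVal (List.replicate n false) = 0 := by
  induction n with
  | zero => rfl
  | succ n ih => simp [List.replicate_succ, bitsVal, ih]

theorem bitsVal_lt (l : List Bool) : bitsVal l < 2 ^ l.length := by
  induction l with
  | nil => simp [bitsVal]
  | cons b l ih => cases b <;> simp [bitsVal, pow_succ] <;> omega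

theorem bitsVal_drop (l : List Bool) (n : ℕ) : bitsVal (l.drop n) = bitsVal l / 2 ^ n := by
  induction n generalizing l with
  | zero => simp
  | succ n ih =>
    cases l with
    | nil => simp [bitsVal]
    | cons b l =>
      rw [List.drop_succ_cons, ih, pow_succ', ← Nat.div_div_eq_div_mul]
      congr 1
      cases b
      all_goals simp [bitsVal]
      omega

theorem bitsVal_headD_tail (l : List Bool) :
    bitsVal l = (l.headD false).toNat + 2 * bitsVal l.tail := by
  cases l <;> simp [bitsVal]

/-- The state of an adder: the carry, the remaining digits and the digits of the result. -/
abbrev AdderState := Bool × List Bool × List Bool × List Bool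

/-- One step of a full adder. -/
def addStep (s : AdderState) : AdderState :=
  let a := s.2.1.headD false
  let b := s.2.2.1.headD false
  ((a && b) || (s.1 && (a ^^ b)), s.2.1.tail, s.2.2.1.tail, s.2.2.2 ++ [s.1 ^^ (a ^^ b)])

/-- One step of a full subtractor. -/
def subStep (s : AdderState) : AdderState :=
  let a := s.2.1.headD false
  let b := s.2.2.1.headD false
  ((!a && b) || (s.1 && !(a ^^ b)), s.2.1.tail, s.2.2.1.tail, s.2.2.2 ++ [s.1 ^^ (a ^^ b)])

/-- This is the loop invariant of schoolbook addition: preservation is a case distinction on two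
digits and the carry. -/
theorem addStep_spec (x y : List Bool) (i : ℕ) :
    let s := addStep^[i] (false, x, y, [])
    s.2.1 = x.drop i ∧ s.2.2.1 = y.drop i ∧ s.2.2.2.length = i ∧
      bitsVal s.2.2.2 + 2 ^ i * (s.1.toNat + bitsVal s.2.1 + bitsVal s.2.2.1)
        = bitsVal x + bitsVal y := by
  induction i with
  | zero => simp [bitsVal]
  | succ i ih =>
    simp only [Function.iterate_succ_apply']
    set s := addStep^[i] (false, x, y, [])
    obtain ⟨h1, h2, h3, h4⟩ := ih
    refine ⟨by simp [addStep, h1, ← List.drop_one], by simp [addStep, h2, ← List.drop_one],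
      by simp [addStep, h3], ?_⟩
    rw [← h4, bitsVal_headD_tail s.2.1, bitsVal_headD_tail s.2.2.1]
    simp only [addStep, bitsVal_append, h3, bitsVal, pow_succ]
    generalize s.1 = c
    generalize s.2.1.headD false = a
    generalize s.2.2.1.headD false = b
    cases a <;> cases b <;> cases c <;> simp <;> ring

/-- The invariant lives in the integers, since the unprocessed part minus the borrow may be
negative. -/
theorem subStep_spec (x y : List Bool) (i : ℕ) :
    let s := subStep^[i] (false, x, y, [])
    s.2.1 = x.drop i ∧ s.2.2.1 = y.drop i ∧ s.2.2.2.length = i ∧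
      (bitsVal s.2.2.2 : ℤ) + 2 ^ i * (bitsVal s.2.1 - bitsVal s.2.2.1 - s.1.toNat)
        = bitsVal x - bitsVal y := by
  induction i with
  | zero => simp [bitsVal]
  | succ i ih =>
    simp only [Function.iterate_succ_apply']
    set s := subStep^[i] (false, x, y, [])
    obtain ⟨h1, h2, h3, h4⟩ := ih
    refine ⟨by simp [subStep, h1, ← List.drop_one], by simp [subStep, h2, ← List.drop_one],
      by simp [subStep, h3], ?_⟩
    rw [← h4, bitsVal_headD_tail s.2.1, bitsVal_headD_tail s.2.2.1]
    simp only [subStep, bitsVal_append, h3, bitsVal, pow_succ]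
    generalize s.1 = c
    generalize s.2.1.headD false = a
    generalize s.2.2.1.headD false = b
    cases a <;> cases b <;> cases c <;> simp <;> ring

/-- Addition of binary numbers. -/
def addBits (x y : List Bool) : List Bool :=
  let s := addStep^[x.length + y.length] (false, x, y, [])
  s.2.2.2 ++ [s.1]

/-- Truncated subtraction of binary numbers. -/
def subBits (x y : List Bool) : List Bool :=
  let s := subStep^[x.length + y.length] (false, x, y, [])
  if s.1 then [] else s.2.2.2

@[simp] theorem length_addBits (x y : List Bool) : (addBits x y).length = x.length + y.length + 1 := by
  simp [addBits, (addStep_spec x y _).2.2.1]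

@[simp] theorem bitsVal_addBits (x y : List Bool) :
    bitsVal (addBits x y) = bitsVal x + bitsVal y := by
  obtain ⟨h1, h2, h3, h4⟩ := addStep_spec x y (x.length + y.length)
  simp only [h1, h2] at h4
  rw [List.drop_of_length_le (by omega), List.drop_of_length_le (by omega)] at h4
  simpa [addBits, bitsVal, h3] using h4

@[simp] theorem bitsVal_subBits (x y : List Bool) :
    bitsVal (subBits x y) = bitsVal x - bitsVal y := by
  obtain ⟨h1, h2, h3, h4⟩ := subStep_spec x y (x.length + y.length)
  simp only [h1, h2] at h4
  rw [List.drop_of_length_le (by omega), List.drop_of_length_le (by omega)] at h4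
  -- The digits are worth less than the weight of the borrow, so a borrow that survives means that
  -- the true difference is negative and truncates to zero.
  have h5 := bitsVal_lt (subStep^[x.length + y.length] (false, x, y, [])).2.2.2
  rw [h3] at h5
  zify at h5
  unfold subBits
  rcases h : (subStep^[x.length + y.length] (false, x, y, [])).1 with _ | _ <;>
    simp [h, bitsVal] at h4 ⊢ <;> omega

/-- The state of a multiplier: the shifted first factor, the remaining digits of the second factor
and the accumulated result. -/
def mulStep (s : List Bool × List Bool × List Bool) : List Bool × List Bool × List Bool :=
  (false :: s.1, s.2.1.tail, addBits s.2.2 (if s.2.1.headD false then s.1 else []))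

/-- The length is part of the invariant because `addBits` never trims: the accumulator grows in
every round by the length of the shifted factor, hence quadratically in all. -/
theorem mulStep_spec (x y : List Bool) (i : ℕ) :
    let s := mulStep^[i] (x, y, [])
    s.1 = List.replicate i false ++ x ∧ s.2.1 = y.drop i ∧ s.2.2.length ≤ i * (i + x.length + 1) ∧
      bitsVal s.2.2 + 2 ^ i * (bitsVal x * bitsVal s.2.1) = bitsVal x * bitsVal y := by
  induction i with
  | zero => simp [bitsVal]
  | succ i ih =>
    simp only [Function.iterate_succ_apply']
    set s := mulStep^[i] (x, y, [])
    obtain ⟨h1, h2, h3, h4⟩ := ih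
    refine ⟨by simp [mulStep, h1, List.replicate_succ], by simp [mulStep, h2, ← List.drop_one], ?_, ?_⟩
    · have : (if s.2.1.headD false then s.1 else []).length ≤ i + x.length := by
        split_ifs <;> simp [h1]
      simp only [mulStep, length_addBits]
      nlinarith
    · rw [← h4, bitsVal_headD_tail s.2.1]
      simp only [mulStep, bitsVal_addBits, pow_succ]
      generalize s.2.1.headD false = a
      cases a <;> simp [h1, bitsVal] <;> ring

/-- Multiplication of binary numbers. -/
def mulBits (x y : List Bool) : List Bool := (mulStep^[y.length] (x, y, [])).2.2

@[simp] theorem bitsVal_mulBits (x y : List Bool) :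
    bitsVal (mulBits x y) = bitsVal x * bitsVal y := by
  obtain ⟨h1, h2, h3, h4⟩ := mulStep_spec x y y.length
  rw [h2, List.drop_length] at h4
  simp only [bitsVal, mul_zero, add_zero] at h4
  exact h4

namespace PT

theorem adder {step : AdderState → AdderState} (hs : PT step)
    (h : ∀ x y i, let s := step^[i] (false, x, y, []); s.2.1 = x.drop i ∧ s.2.2.1 = y.drop i ∧
      s.2.2.2.length = i) {f g : α → List Bool} (hf : PT f) (hg : PT g) :
    PT fun a => step^[(f a).length + (g a).length] (false, f a, g a, []) := by
  refine primrec (F := fun a i => step^[i] (false, f a, g a, [])) (init := fun a => (false, f a, g a, []))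
    (step := fun x => step x.2.2) (by fun_prop) (by fun_prop) (by fun_prop) (fun _ => rfl)
    (fun c i => by simp [Function.iterate_succ_apply'])
    ((PolyBounded.const 1).add (hf.len.add (hg.len.add (hf.len.add hg.len)))) fun c i hi => ?_
  obtain ⟨h1, h2, h3⟩ := h (f c) (g c) i
  simp only [len_prod, len_list, len_letter, h1, h2, h3, List.length_drop]
  omega

@[fun_prop] theorem addBits {f g : α → List Bool} (hf : PT f) (hg : PT g) :
    PT fun a => addBits (f a) (g a) := by
  have := adder (step := addStep) (by unfold addStep; fun_prop)
    (fun x y i => ⟨(addStep_spec x y i).1, (addStep_spec x y i).2.1, (addStep_spec x y i).2.2.1⟩) hf hg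
  unfold _root_.addBits
  fun_prop

@[fun_prop] theorem subBits {f g : α → List Bool} (hf : PT f) (hg : PT g) :
    PT fun a => subBits (f a) (g a) := by
  have := adder (step := subStep) (by unfold subStep; fun_prop)
    (fun x y i => ⟨(subStep_spec x y i).1, (subStep_spec x y i).2.1, (subStep_spec x y i).2.2.1⟩) hf hg
  unfold _root_.subBits
  exact if_bool this.fst (by fun_prop) (by fun_prop)

@[fun_prop] theorem mulBits {f g : α → List Bool} (hf : PT f) (hg : PT g) :
    PT fun a => mulBits (f a) (g a) := by
  have h1 : PT mulStep := by
    have : PT fun s : List Bool × List Bool × List Bool => if s.2.1.headD false then s.1 else [] :=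
      if_bool (by fun_prop) (by fun_prop) (by fun_prop)
    unfold mulStep
    fun_prop
  refine PT.snd (PT.snd (primrec (F := fun a i => mulStep^[i] (f a, g a, []))
    (init := fun a => (f a, g a, []))
    (step := fun x => mulStep x.2.2) (by fun_prop) (by fun_prop) (by fun_prop) (fun _ => rfl)
    (fun c i => by simp [Function.iterate_succ_apply'])
    ((hg.len.add hf.len).add (hg.len.add (hg.len.mul ((hg.len.add hf.len).add (.const 1)))))
    fun c i hi => ?_))
  obtain ⟨h1, h2, h3, -⟩ := mulStep_spec (f c) (g c) i
  simp only [len_prod, len_list, h1, h2, List.length_drop, List.length_append,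
    List.length_replicate] at h3 ⊢
  have : i * (i + (f c).length + 1) ≤ (g c).length * ((g c).length + (f c).length + 1) :=
    Nat.mul_le_mul hi (by omega)
  omega

end PT

end

/-! ### Efficiently computable real numbers -/

section

open Turing Computability Enc

variable {α β γ δ : Type} [Enc α] [Enc β] [Enc γ] [Enc δ]

/-- Natural numbers that are written in binary. -/
structure BinaryNat where
  val : ℕ

instance : Enc BinaryNat := ⟨Bool, fun b => encodeNat b.val⟩

theorem bitsVal_encodePosNum (n : PosNum) : bitsVal (encodePosNum n) = n := by
  induction n with
  | one => rfl
  | bit0 n ih => simp [encodePosNum, bitsVal, ih, PosNum.cast_bit0]; ring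
  | bit1 n ih => simp [encodePosNum, bitsVal, ih, PosNum.cast_bit1]; ring

theorem bitsVal_encodeNat (n : ℕ) : bitsVal (encodeNat n) = n := by
  unfold encodeNat
  conv_rhs => rw [← Num.to_of_nat n]
  cases (n : Num) with
  | zero => rfl
  | pos p => exact bitsVal_encodePosNum p

theorem encodePosNum_getLast (n : PosNum) : (encodePosNum n).getLast? = some true := by
  induction n with
  | one => rfl
  | bit0 n ih => simp [encodePosNum, List.getLast?_cons, ih]
  | bit1 n ih => simp [encodePosNum, List.getLast?_cons, ih]

theorem encodeNat_getLast (n : ℕ) : (encodeNat n).getLast? ≠ some false := by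
  unfold encodeNat
  cases (n : Num) with
  | zero => simp [encodeNum]
  | pos p => simp [encodeNum, encodePosNum_getLast]

/-- The most significant digit is the last one, so the hypotheses exclude superfluous zeros. Parity
determines the first digit, and halving continues. -/
theorem eq_of_bitsVal_eq {l l' : List Bool} (h : l.getLast? ≠ some false) (h' : l'.getLast? ≠ some false)
    (e : bitsVal l = bitsVal l') : l = l' := by
  have key : ∀ l : List Bool, l.getLast? ≠ some false → bitsVal l = 0 → l = [] := by
    intro l
    induction l with
    | nil => simp
    | cons b l ih =>
      intro h e
      cases b
      · have : l = [] := ih (fun h' => h (by simp [List.getLast?_cons, h'])) (by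
          simpa [bitsVal] using e)
        simp [this] at h
      · simp [bitsVal] at e
  induction l generalizing l' with
  | nil => exact (key l' h' e.symm).symm
  | cons b l ih =>
    cases l' with
    | nil => exact key _ h e
    | cons b' l' =>
      have hb : b = b' := by
        cases b <;> cases b' <;> simp [bitsVal] at e ⊢ <;> omega
      subst hb
      have h2 : l.getLast? ≠ some false := fun h1 => h (by simp [List.getLast?_cons, h1])
      have h3 : l'.getLast? ≠ some false := fun h1 => h' (by simp [List.getLast?_cons, h1])
      rw [ih h2 h3 (by simpa [bitsVal] using e)]

/-- Normalizing arbitrary digits thus amounts to a trimming transducer between two reversals. -/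
theorem encodeNat_bitsVal (l : List Bool) :
    encodeNat (bitsVal l) = (l.reverse.dropWhile (fun b => !b)).reverse := by
  refine eq_of_bitsVal_eq (encodeNat_getLast _) ?_ ?_
  · rw [List.getLast?_reverse]
    intro h
    have := List.head?_dropWhile_not (fun b => !b) l.reverse
    rw [h] at this
    simp at this
  · rw [bitsVal_encodeNat]
    conv_lhs => rw [← List.reverse_reverse l,
      ← List.takeWhile_append_dropWhile (p := fun b => !b) (l := l.reverse)]
    rw [List.reverse_append, bitsVal_append]
    have : (l.reverse.takeWhile fun b => !b).reverse
        = List.replicate (l.reverse.takeWhile fun b => !b).reverse.length false := by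
      rw [List.eq_replicate_iff]
      refine ⟨rfl, fun b hb => ?_⟩
      have := List.mem_takeWhile_imp (List.mem_reverse.1 hb)
      simpa using this
    rw [this, bitsVal_replicate_false]
    simp

namespace PT

theorem bits {f : α → BinaryNat} (hf : PT f) : PT fun a => encodeNat (f a).val := by
  have : PT fun x : BinaryNat => encodeNat x.val := of_enc_eq (fun b => b) fun a =>
    (List.map_id _).symm
  exact this.comp hf

theorem ofBits {f : α → List Bool} (hf : PT f) : PT fun a => BinaryNat.mk (bitsVal (f a)) := by
  have h1 : PT fun l : List Bool => l.dropWhile fun b => !b := by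
    have h : ∀ l : List Bool, transduce (fun (q a : Bool) => (q || a, if q || a then [a] else []))
        (fun _ => []) true l = l := by
      intro l
      induction l with
      | nil => rfl
      | cons a l ih => simpa [transduce] using ih
    refine of_transduce (Q := Bool) (fun (q a : Bool) => (q || a, if q || a then [a] else []))
      (fun _ => []) false fun l => ?_
    change l.dropWhile _ = transduce _ _ _ l
    induction l with
    | nil => rfl
    | cons a l ih =>
      cases a
      · simpa [transduce] using ih
      · exact congrArg ([true] ++ ·) (h l).symm
  have h2 : PT fun a => ((f a).reverse.dropWhile fun b => !b).reverse := (h1.comp hf.reverse).reverse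
  have h3 : PT fun l : BinaryNat => l := id
  obtain ⟨T⟩ := h2
  refine ⟨{ T with outputsFun := fun a => ?_ }⟩
  have := T.outputsFun a
  change Turing.TM2OutputsInTime _ _ (encodeNat (bitsVal (f a)) |>.map _ |> some) _
  rw [encodeNat_bitsVal]
  exact this

end PT

/-- Reals in `[0, 1]` depending on a number in unary, with binary approximations that are computed in
polynomial time. -/
def ApproxPT (r : ℕ → ℝ) : Prop :=
  ∃ F : ℕ → ℕ → List Bool, (PT fun x : ℕ × ℕ => F x.1 x.2) ∧
    ∃ C : ℕ, ∀ n m, |r n * 2 ^ m - bitsVal (F n m)| ≤ C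

theorem PolyTimeReal.approxPT {r : ℕ → ℝ} (h : PolyTimeReal r) : ApproxPT r := by
  obtain ⟨a, ⟨T⟩, ha⟩ := h
  have : PT fun x : ℕ × ℕ => BinaryNat.mk (a x) := ⟨{ T with outputsFun := T.outputsFun }⟩
  refine ⟨fun n m => encodeNat (a (n, m)), this.bits, 1, fun n m => ?_⟩
  rw [bitsVal_encodeNat]
  have h1 := ha n m
  have h2 : (0 : ℝ) < 2 ^ m := by positivity
  rw [le_div_iff₀ h2, ← abs_of_pos h2, ← abs_mul, abs_of_pos h2] at h1
  rw [sub_mul, div_mul_cancel₀ _ h2.ne'] at h1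
  simpa using h1

namespace ApproxPT

variable {r r' : ℕ → ℝ}

/-- The constant `C` is absorbed by evaluating with `j` additional digits: since `2 C ≤ 2 ^ j`, the
error becomes at most half a unit. Adding `2 ^ C`, which is half of `2 ^ j`, before dropping `j`
digits rounds to the nearest integer and costs at most another half. -/
theorem polyTimeReal (h : ApproxPT r) : PolyTimeReal r := by
  obtain ⟨F, hF, C, h⟩ := h
  let j := C + 1
  have hj : 2 * C ≤ 2 ^ j := by
    have := Nat.lt_two_pow_self (n := C)
    rw [pow_succ]
    omega
  let G : ℕ → ℕ → List Bool := fun n m => (addBits (F n (m + j)) (List.replicate C false ++ [true])).drop j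
  have hG : PT fun x : ℕ × ℕ => G x.1 x.2 := by
    have : PT fun x : ℕ × ℕ => F x.1 (x.2 + j) := hF.comp (f := fun x : ℕ × ℕ => (x.1, x.2 + j))
      (by fun_prop)
    fun_prop
  obtain ⟨T⟩ := hG.ofBits
  refine ⟨fun x => bitsVal (G x.1 x.2), ⟨{ T with outputsFun := T.outputsFun }⟩, fun n m => ?_⟩
  have h1 := abs_le.1 (h n (m + j))
  have hv : bitsVal (G n m) = (bitsVal (F n (m + j)) + 2 ^ C) / 2 ^ j := by
    simp [G, bitsVal_drop, bitsVal]
  simp only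
  rw [hv]
  set N := bitsVal (F n (m + j))
  set D := (N + 2 ^ C) / 2 ^ j with hD
  have h2 : D * 2 ^ j ≤ N + 2 ^ C := Nat.div_mul_le_self _ _
  have h3 : N + 2 ^ C < D * 2 ^ j + 2 ^ j := Nat.lt_div_mul_add (by positivity)
  have h2' : (D : ℝ) * 2 ^ j ≤ N + 2 ^ C := by exact_mod_cast h2
  have h3' : (N : ℝ) + 2 ^ C < D * 2 ^ j + 2 ^ j := by exact_mod_cast h3
  have hj' : (2 : ℝ) * C ≤ 2 ^ j := by exact_mod_cast hj
  have e : (2 : ℝ) ^ j = 2 * 2 ^ C := by rw [pow_succ]; ring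
  have h4 : (0 : ℝ) < 2 ^ m := by positivity
  have h5 : (0 : ℝ) < 2 ^ j := by positivity
  rw [pow_add] at h1
  have e2 : r n - D / 2 ^ m = (r n * 2 ^ m - D) / 2 ^ m := by field_simp
  rw [e2, abs_div, abs_of_pos h4]
  gcongr
  rw [abs_le]
  constructor <;> refine le_of_mul_le_mul_right ?_ h5 <;> nlinarith [h1.1, h1.2]

/-- Truncation does no harm: if the difference of the approximations is negative while `r' ≤ r`,
then the true scaled difference is itself within the error. -/
theorem sub (h : ApproxPT r) (h' : ApproxPT r') (hr : ∀ n, r' n ≤ r n) :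
    ApproxPT fun n => r n - r' n := by
  obtain ⟨F, hF, C, h⟩ := h
  obtain ⟨F', hF', C', h'⟩ := h'
  refine ⟨fun n m => subBits (F n m) (F' n m), hF.subBits hF', C + C', fun n m => ?_⟩
  have h1 := abs_le.1 (h n m)
  have h2 := abs_le.1 (h' n m)
  have h3 : r' n * 2 ^ m ≤ r n * 2 ^ m := by have := hr n; gcongr
  rw [bitsVal_subBits, sub_mul, abs_le]
  push_cast
  rcases le_total (bitsVal (F' n m)) (bitsVal (F n m)) with h4 | h4
  · rw [Nat.cast_sub h4]
    constructor <;> linarith [h1.1, h1.2, h2.1, h2.2]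
  · rw [Nat.sub_eq_zero_of_le h4]
    have : (bitsVal (F n m) : ℝ) ≤ bitsVal (F' n m) := by exact_mod_cast h4
    push_cast
    constructor <;> linarith [h1.1, h1.2, h2.1, h2.2]

/-- Since both reals lie in `[0, 1]`, the error of one scaled factor is multiplied by at most `2 ^
m` and that of the other by at most `(1 + C') 2 ^ m`. Dropping `m` digits divides this by `2 ^ m`,
and the rounding adds 1. -/
theorem mul (h : ApproxPT r) (h' : ApproxPT r') (hr : ∀ n, 0 ≤ r n ∧ r n ≤ 1)
    (hr' : ∀ n, 0 ≤ r' n ∧ r' n ≤ 1) : ApproxPT fun n => r n * r' n := by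
  obtain ⟨F, hF, C, h⟩ := h
  obtain ⟨F', hF', C', h'⟩ := h'
  have hp : PT fun x : ℕ × ℕ => (mulBits (F x.1 x.2) (F' x.1 x.2)).drop x.2 := by fun_prop
  refine ⟨fun n m => (mulBits (F n m) (F' n m)).drop m, hp, C' + C * (1 + C') + 1, fun n m => ?_⟩
  have h1 := h n m
  have h2 := h' n m
  have hM : (0 : ℝ) < 2 ^ m := by positivity
  rw [bitsVal_drop, bitsVal_mulBits]
  set a := bitsVal (F n m)
  set b := bitsVal (F' n m)
  have h3 : ((a * b / 2 ^ m : ℕ) : ℝ) * 2 ^ m ≤ a * b := by exact_mod_cast Nat.div_mul_le_self _ _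
  have h4 : (a : ℝ) * b < ((a * b / 2 ^ m : ℕ) : ℝ) * 2 ^ m + 2 ^ m := by
    exact_mod_cast Nat.lt_div_mul_add (by positivity)
  set d := ((a * b / 2 ^ m : ℕ) : ℝ)
  have h5 : |r n * 2 ^ m * (r' n * 2 ^ m) - a * b| ≤ C' * 2 ^ m + C * ((1 + C') * 2 ^ m) := by
    have e : r n * 2 ^ m * (r' n * 2 ^ m) - a * b
        = r n * 2 ^ m * (r' n * 2 ^ m - b) + (r n * 2 ^ m - a) * b := by ring
    rw [e]
    refine (abs_add_le _ _).trans ?_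
    rw [abs_mul, abs_mul (r n * 2 ^ m - a)]
    have e1 : |r n * 2 ^ m| ≤ 2 ^ m := by
      rw [abs_of_nonneg (mul_nonneg (hr n).1 hM.le)]
      nlinarith [(hr n).2]
    have e2 : |(b : ℝ)| ≤ (1 + C') * 2 ^ m := by
      rw [abs_of_nonneg (by positivity)]
      have := (abs_le.1 h2).1
      have := (hr' n).2
      have : (1 : ℝ) ≤ 2 ^ m := one_le_pow₀ (by norm_num)
      have : (C' : ℝ) ≤ C' * 2 ^ m := le_mul_of_one_le_right (by positivity) this
      nlinarith
    rw [mul_comm (C' : ℝ)]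
    exact add_le_add (mul_le_mul e1 h2 (abs_nonneg _) (by positivity))
      (mul_le_mul h1 e2 (abs_nonneg _) (by positivity))
  have h6 := abs_le.1 h5
  push_cast
  rw [abs_le]
  constructor <;> refine le_of_mul_le_mul_right ?_ hM <;> nlinarith [h6.1, h6.2]

/-- Long division: the remainder, and the binary digits of the quotient. -/
def divStep (v : ℕ) [NeZero v] (x : Fin v × List Bool) : Fin v × List Bool :=
  (Fin.ofNat v (2 * x.1), decide (v ≤ 2 * (x.1 : ℕ)) :: x.2)

theorem divStep_spec (v : ℕ) [NeZero v] (u : Fin v) (m : ℕ) :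
    ((divStep v)^[m] (u, [])).2.length = m ∧
      bitsVal ((divStep v)^[m] (u, [])).2 * v + ((divStep v)^[m] (u, [])).1 = u * 2 ^ m := by
  induction m with
  | zero => simp [bitsVal]
  | succ m ih =>
    simp only [Function.iterate_succ_apply']
    obtain ⟨h1, h2⟩ := ih
    set x := (divStep v)^[m] (u, [])
    refine ⟨by simp [divStep, h1], ?_⟩
    have hx := x.1.isLt
    rw [pow_succ, ← mul_assoc, ← h2]
    simp only [divStep, bitsVal, Fin.val_ofNat]
    rcases lt_or_ge (2 * (x.1 : ℕ)) v with h | h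
    · rw [Nat.mod_eq_of_lt h, decide_eq_false (by omega)]
      simp; ring
    · rw [Nat.mod_eq_sub_mod h, Nat.mod_eq_of_lt (by omega), decide_eq_true h]
      simp
      zify [h]
      ring

/-- The denominator is fixed, so remainders are letters of a finite alphabet and long division uses
only a table lookup per digit. The hypothesis `q < 1` makes the numerator an admissible first
remainder. -/
theorem const {q : ℚ} (h₀ : 0 ≤ q) (h₁ : q < 1) : ApproxPT fun _ => q := by
  obtain ⟨v, hv⟩ : ∃ v, v = q.den := ⟨_, rfl⟩
  have : NeZero v := ⟨hv ▸ q.den_nz⟩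
  have hnum : q.num.toNat < v := by
    have := Rat.num_lt_denom_iff.2 h₁
    have := Rat.num_nonneg.2 h₀
    omega
  let u : Fin v := ⟨q.num.toNat, hnum⟩
  have hu : (q : ℝ) * v = (u : ℕ) := by
    have h1 : q * q.den = q.num := Rat.mul_den_eq_num q
    have h2 : (q.num.toNat : ℤ) = q.num := Int.toNat_of_nonneg (Rat.num_nonneg.2 h₀)
    have h3 : q * v = (q.num.toNat : ℤ) := by rw [h2, ← h1, hv]
    have h4 : (q : ℝ) * v = q.num.toNat := by exact_mod_cast congrArg (fun x : ℚ => (x : ℝ)) h3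
    exact h4
  have hs : PT (divStep v) := by
    have h1 : PT fun x : Fin v × List Bool => Fin.ofNat v (2 * x.1) :=
      PT.letter (fun r : Fin v => Fin.ofNat v (2 * r)) (by fun_prop)
    have h2 : PT fun x : Fin v × List Bool => decide (v ≤ 2 * (x.1 : ℕ)) :=
      PT.letter (fun r : Fin v => decide (v ≤ 2 * (r : ℕ))) (by fun_prop)
    unfold divStep
    fun_prop
  refine ⟨fun _ m => ((divStep v)^[m] (u, [])).2, ?_, 1, fun _ m => ?_⟩
  · refine PT.snd (PT.primrec (F := fun _ m => (divStep v)^[m] (u, [])) (n := fun x : ℕ × ℕ => x.2)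
      (init := fun _ => (u, [])) (step := fun x => divStep v x.2.2) (by fun_prop) (by fun_prop)
      (by fun_prop) (fun _ => rfl) (fun _ _ => by simp [Function.iterate_succ_apply'])
      (b := fun x => 1 + x.2) ((PolyBounded.const 1).add (PT.polyBounded (by fun_prop)))
      fun x i hi => ?_)
    simp only [len_prod, len_letter, len_list, (divStep_spec v u i).1]
    omega
  · have h1 := (divStep_spec v u m).2
    have h2 := ((divStep v)^[m] (u, [])).1.isLt
    set x := (divStep v)^[m] (u, [])
    have hv' : (0 : ℝ) < v := by exact_mod_cast NeZero.pos v
    have h3 : (bitsVal x.2 : ℝ) * v + (x.1 : ℕ) = (u : ℕ) * 2 ^ m := by exact_mod_cast h1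
    have h4 : ((x.1 : ℕ) : ℝ) < v := by exact_mod_cast h2
    have h5 : (0 : ℝ) ≤ (x.1 : ℕ) := by positivity
    rw [← hu] at h3
    rw [abs_le]
    push_cast
    constructor <;> refine le_of_mul_le_mul_right ?_ hv' <;> nlinarith

theorem one : ApproxPT fun _ => 1 :=
  ⟨fun _ m => List.replicate m false ++ [true], by fun_prop, 0, by simp [bitsVal]⟩

end ApproxPT

end

/-! ### Gates as permutations and the echo formula for acceptance -/

section

namespace StoqGate

variable {ι κ : Type}

/-- Relabel the wires of a gate. -/
def map (f : ι → κ) : StoqGate ι → StoqGate κ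
  | .x t => .x (f t)
  | .cnot a t => .cnot (f a) (f t)
  | .toffoli a b t => .toffoli (f a) (f b) (f t)

theorem IsValid.map {f : ι → κ} (hf : Function.Injective f) {g : StoqGate ι} (hg : g.IsValid) :
    (g.map f).IsValid := by
  cases g <;> simp_all [StoqGate.map, IsValid, hf.ne_iff]

variable [DecidableEq κ]

theorem act_map_of_notMem {f : ι → κ} (g : StoqGate ι) (z : κ → Bool) {j : κ}
    (hj : j ∉ Set.range f) : (g.map f).act z j = z j := by
  have : ∀ t, j ≠ f t := fun t h => hj ⟨t, h.symm⟩
  cases g <;> simp [map, act, this]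

/-- Run a list of gates on a computational-basis string. -/
def run (L : List (StoqGate κ)) (z : κ → Bool) : κ → Bool := L.foldl (fun z g => g.act z) z

@[simp] theorem run_nil (z : κ → Bool) : run [] z = z := rfl
@[simp] theorem run_cons (g : StoqGate κ) (L : List (StoqGate κ)) (z : κ → Bool) :
    run (g :: L) z = run L (g.act z) := rfl
@[simp] theorem run_append (L L' : List (StoqGate κ)) (z : κ → Bool) :
    run (L ++ L') z = run L' (run L z) := List.foldl_append

theorem run_map_of_notMem {f : ι → κ} (L : List (StoqGate ι)) (z : κ → Bool) {j : κ}
    (hj : j ∉ Set.range f) : run (L.map (map f)) z j = z j := by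
  induction L generalizing z with
  | nil => rfl
  | cons g L ih => simp [ih, act_map_of_notMem g z hj]

variable [DecidableEq ι]

theorem act_act {g : StoqGate ι} (hg : g.IsValid) (z : ι → Bool) : g.act (g.act z) = z := by
  cases g with
  | x t => simp [act]
  | cnot a t =>
    have : a ≠ t := hg
    simp [act, this]
  | toffoli a b t =>
    obtain ⟨-, h1, h2⟩ : a ≠ b ∧ a ≠ t ∧ b ≠ t := hg
    simp [act, h1, h2]

theorem act_map_comp {f : ι → κ} (hf : Function.Injective f) (g : StoqGate ι) (z : κ → Bool) :
    (g.map f).act z ∘ f = g.act (z ∘ f) := by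
  cases g <;> simp only [map, act] <;> rw [Function.update_comp_eq_of_injective _ hf] <;> rfl

theorem run_map_comp {f : ι → κ} (hf : Function.Injective f) (L : List (StoqGate ι)) (z : κ → Bool) :
    run (L.map (map f)) z ∘ f = run L (z ∘ f) := by
  induction L generalizing z with
  | nil => rfl
  | cons g L ih => simp [ih, act_map_comp hf]

/-- A list of valid gates permutes the computational basis. -/
def runEquiv (L : List (StoqGate ι)) (hL : ∀ g ∈ L, g.IsValid) : Equiv.Perm (ι → Bool) where
  toFun := run L
  invFun z := L.foldr (fun g z => g.act z) z
  left_inv z := by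
    induction L generalizing z with
    | nil => rfl
    | cons g L ih =>
      simp only [List.forall_mem_cons] at hL
      simp [ih hL.2, act_act hL.1]
  right_inv z := by
    induction L generalizing z with
    | nil => rfl
    | cons g L ih =>
      simp only [List.forall_mem_cons] at hL
      simp [ih hL.2, act_act hL.1]

/-- Amplitudes transform by the inverse permutation: later gates are applied closer to the argument,
and every valid gate is its own inverse. -/
theorem foldl_amplitudes (L : List (StoqGate ι)) (hL : ∀ g ∈ L, g.IsValid) (φ : (ι → Bool) → ℝ) :
    L.foldl (fun φ g z => φ (g.act z)) φ = φ ∘ (runEquiv L hL).symm := by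
  induction L generalizing φ with
  | nil => rfl
  | cons g L ih =>
    rw [List.foldl_cons, ih (List.forall_mem_cons.1 hL).2]
    rfl

end StoqGate

/-- Flip one bit. -/
def flipAt {ι : Type} [DecidableEq ι] (i : ι) : Equiv.Perm (ι → Bool) where
  toFun z := Function.update z i (!z i)
  invFun z := Function.update z i (!z i)
  left_inv z := by simp
  right_inv z := by simp

namespace StoqCircuit

open StoqGate

variable (C : StoqCircuit)

/-- The basis string with the given witness, with zeros, and with the given values of the ancillas
that are initialized to `|+⟩`. -/
def start (u : Fin C.numWitness → Bool) (r : Fin C.numPlus → Bool) : C.Basis :=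
  Fin.append (Fin.append u fun _ => false) r

theorem initialState_start (ψ : (Fin C.numWitness → Bool) → ℝ) (u) (r) :
    C.initialState ψ (C.start u r) = ψ u * (√2)⁻¹ ^ C.numPlus := by
  simp [initialState, start]

theorem sum_eq_sum_start {f : C.Basis → ℝ}
    (hf : ∀ z, (¬ ∀ j, z (Fin.castAdd C.numPlus (Fin.natAdd C.numWitness j)) = false) → f z = 0) :
    ∑ z, f z = ∑ u, ∑ r, f (C.start u r) := by
  rw [← (Fin.appendEquiv (C.numWitness + C.numZero) C.numPlus).sum_comp, Fintype.sum_prod_type,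
    ← (Fin.appendEquiv C.numWitness C.numZero).sum_comp, Fintype.sum_prod_type]
  refine Finset.sum_congr rfl fun u _ => ?_
  rw [Finset.sum_eq_single fun _ => false]
  · rfl
  · intro b _ hb
    refine Finset.sum_eq_zero fun r _ => hf _ fun h => hb (funext fun j => ?_)
    simpa [Fin.appendEquiv] using h j
  · simp

/-- The permutation of the computational basis that runs the gates, flips the output qubit and runs
the gates backwards. -/
def echo : Equiv.Perm C.Basis :=
  (runEquiv C.gates C.valid).trans ((flipAt C.output).trans (runEquiv C.gates C.valid).symm)

theorem run_echo (z : C.Basis) : run C.gates (C.echo z) = flipAt C.output (run C.gates z) :=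
  (runEquiv C.gates C.valid).apply_symm_apply _

/-- Gates are injective on basis strings, so an echo can be recognized by forward runs only. -/
theorem eq_echo {z z' : C.Basis} (h : run C.gates z' = flipAt C.output (run C.gates z)) :
    z' = C.echo z :=
  (runEquiv C.gates C.valid).injective (h.trans (C.run_echo z).symm)

theorem sum_initialState_sq {ψ : (Fin C.numWitness → Bool) → ℝ} :
    ∑ z, C.initialState ψ z ^ 2 = ∑ u, ψ u ^ 2 := by
  rw [C.sum_eq_sum_start fun z hz => by simp [initialState, hz]]
  refine Finset.sum_congr rfl fun u _ => ?_
  simp only [initialState_start, mul_pow, ← pow_mul, mul_comm C.numPlus 2]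
  have : (2 : ℝ) ^ C.numPlus ≠ 0 := by positivity
  simp [pow_mul]
  field_simp

/-- The amplitude of a basis string up to the normalization of the ancillas. -/
noncomputable def amplitude (ψ : (Fin C.numWitness → Bool) → ℝ) (z : C.Basis) : ℝ :=
  if ∀ j, z (Fin.castAdd C.numPlus (Fin.natAdd C.numWitness j)) = false then
    ψ fun i => z (Fin.castAdd C.numPlus (Fin.castAdd C.numZero i)) else 0

/-- The projection onto `|+⟩` is `(1 + X) / 2`. Expanding the square, the two diagonal terms have
norm 1 because the echo permutes basis strings; the cross term is the overlap of the initial state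
with its echo. -/
theorem acceptProb_eq_sum {ψ : (Fin C.numWitness → Bool) → ℝ} (hψ : ∑ u, ψ u ^ 2 = 1) :
    C.acceptProb ψ = 1 / 2 + 1 / 2 * ∑ z, C.initialState ψ z * C.initialState ψ (C.echo z) := by
  have h1 : ∑ z, C.initialState ψ (C.echo z) ^ 2 = 1 := by
    rw [Equiv.sum_comp C.echo fun z => C.initialState ψ z ^ 2, sum_initialState_sq, hψ]
  have h2 : ∑ z, C.initialState ψ z ^ 2 = 1 := by rw [sum_initialState_sq, hψ]
  unfold acceptProb finalState
  rw [foldl_amplitudes C.gates C.valid, ← Equiv.sum_comp (runEquiv C.gates C.valid)]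
  have h4 : ∀ z, (((C.initialState ψ ∘ (runEquiv C.gates C.valid).symm) (runEquiv C.gates C.valid z) +
      (C.initialState ψ ∘ (runEquiv C.gates C.valid).symm) (Function.update
        (runEquiv C.gates C.valid z) C.output (!(runEquiv C.gates C.valid z) C.output))) / 2) ^ 2
      = 1 / 4 * C.initialState ψ z ^ 2 + 1 / 4 * C.initialState ψ (C.echo z) ^ 2
        + 1 / 2 * (C.initialState ψ z * C.initialState ψ (C.echo z)) := by
    intro z
    simp only [Function.comp_apply, Equiv.symm_apply_apply]
    change ((C.initialState ψ z + C.initialState ψ (C.echo z)) / 2) ^ 2 = _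
    ring
  rw [Finset.sum_congr rfl fun z _ => h4 z]
  simp only [Finset.sum_add_distrib, ← Finset.mul_sum, h1, h2]
  ring

/-- Only strings of the form `start u r` have a non-zero initial amplitude, and the normalizations
of the two factors multiply to `2 ^ (-numPlus)`. -/
theorem acceptProb_eq {ψ : (Fin C.numWitness → Bool) → ℝ} (hψ : ∑ u, ψ u ^ 2 = 1) :
    C.acceptProb ψ = 1 / 2 + 1 / 2 *
      ((1 / 2) ^ C.numPlus * ∑ u, ∑ r, ψ u * C.amplitude ψ (C.echo (C.start u r))) := by
  have h3 : ∑ z, C.initialState ψ z * C.initialState ψ (C.echo z)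
      = (1 / 2) ^ C.numPlus * ∑ u, ∑ r, ψ u * C.amplitude ψ (C.echo (C.start u r)) := by
    rw [C.sum_eq_sum_start fun z hz => by simp [initialState, hz], Finset.mul_sum]
    refine Finset.sum_congr rfl fun u _ => ?_
    rw [Finset.mul_sum]
    refine Finset.sum_congr rfl fun r _ => ?_
    have h4 : ∀ z, C.initialState ψ z = C.amplitude ψ z * (√2)⁻¹ ^ C.numPlus := by
      intro z
      unfold initialState amplitude
      split_ifs <;> simp
    have h5 : ((√2)⁻¹ ^ C.numPlus * (√2)⁻¹ ^ C.numPlus : ℝ) = (1 / 2) ^ C.numPlus := by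
      rw [← mul_pow, ← mul_inv, Real.mul_self_sqrt (by norm_num), one_div]
    rw [initialState_start, h4, ← h5]
    ring
  rw [C.acceptProb_eq_sum hψ, h3]

end StoqCircuit

end

/-! ### The gates of the swap-test verifier -/

section

open StoqGate

namespace StoqGate

variable {ι : Type} [DecidableEq ι]

/-- A loop of gates is analysed by naming the state `z i` after `i` rounds; only a single round has
to be computed. -/
theorem run_flatMap_finRange {m : ℕ} (g : Fin m → List (StoqGate ι)) (z : ℕ → ι → Bool)
    (h : ∀ j : Fin m, run (g j) (z j) = z (j + 1)) : run ((List.finRange m).flatMap g) (z 0) = z m := by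
  induction m with
  | zero => rfl
  | succ m ih =>
    rw [List.finRange_succ_last, List.flatMap_append, run_append, List.flatMap_map,
      ih _ fun j => h j.castSucc]
    simpa using h (Fin.last m)

end StoqGate

namespace SwapTest

/-- The wires: two witnesses; the zeros, which consist of a target of controlled swaps, the partial
results of a comparison, the permission to swap a block, and the zeros of the given circuit; the
ancillas in `|+⟩`, which consist of those of the given circuit, the control qubit, the number that is
compared, and the choice of the blocks that are swapped. -/
abbrev Wire (W Z P k m : ℕ) : Type :=
  ((Fin W ⊕ Fin W) ⊕ ((Fin 1 ⊕ Fin (m + 1)) ⊕ (Fin k ⊕ Fin Z))) ⊕ (Fin P ⊕ ((Fin 1 ⊕ Fin m) ⊕ Fin k))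

instance (W Z P k m : ℕ) : DecidableEq (Wire W Z P k m) := instDecidableEqSum

variable {W Z P k m : ℕ}

namespace Wire

abbrev fst (j : Fin W) : Wire W Z P k m := .inl (.inl (.inl j))
abbrev snd (j : Fin W) : Wire W Z P k m := .inl (.inl (.inr j))
abbrev tmp : Wire W Z P k m := .inl (.inr (.inl (.inl 0)))
abbrev cmp (j : Fin (m + 1)) : Wire W Z P k m := .inl (.inr (.inl (.inr j)))
abbrev perm (i : Fin k) : Wire W Z P k m := .inl (.inr (.inr (.inl i)))
abbrev zero (j : Fin Z) : Wire W Z P k m := .inl (.inr (.inr (.inr j)))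
abbrev plus (j : Fin P) : Wire W Z P k m := .inr (.inl j)
abbrev ctrl : Wire W Z P k m := .inr (.inr (.inl (.inl 0)))
abbrev coin (j : Fin m) : Wire W Z P k m := .inr (.inr (.inl (.inr j)))
abbrev choice (i : Fin k) : Wire W Z P k m := .inr (.inr (.inr i))

end Wire

/-- A basis string of the whole register. -/
def state (u v : Fin W → Bool) (d : Bool) (b : Fin (m + 1) → Bool) (s : Fin k → Bool)
    (y : Fin Z → Bool) (r : Fin P → Bool) (o : Bool) (c : Fin m → Bool) (S : Fin k → Bool) :
    Wire W Z P k m → Bool :=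
  Sum.elim (Sum.elim (Sum.elim u v) (Sum.elim (Sum.elim (fun _ => d) b) (Sum.elim s y)))
    (Sum.elim r (Sum.elim (Sum.elim (fun _ => o) c) S))

section Update

variable (u v : Fin W → Bool) (d : Bool) (b : Fin (m + 1) → Bool) (s : Fin k → Bool)
    (y : Fin Z → Bool) (r : Fin P → Bool) (o : Bool) (c : Fin m → Bool) (S : Fin k → Bool) (a : Bool)

@[simp] theorem update_fst (j : Fin W) : Function.update (state u v d b s y r o c S) (Wire.fst j) a
    = state (Function.update u j a) v d b s y r o c S := by unfold state; rw [Sum.update_elim_inl, Sum.update_elim_inl, Sum.update_elim_inl]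
@[simp] theorem update_snd (j : Fin W) : Function.update (state u v d b s y r o c S) (Wire.snd j) a
    = state u (Function.update v j a) d b s y r o c S := by unfold state; rw [Sum.update_elim_inl, Sum.update_elim_inl, Sum.update_elim_inr]
@[simp] theorem update_tmp : Function.update (state u v d b s y r o c S) Wire.tmp a
    = state u v a b s y r o c S := by
  have : Function.update (fun _ : Fin 1 => d) 0 a = fun _ => a := by
    funext i; rw [Subsingleton.elim i 0]; simp
  unfold state; rw [Sum.update_elim_inl, Sum.update_elim_inr, Sum.update_elim_inl, Sum.update_elim_inl, this]
@[simp] theorem update_cmp (j : Fin (m + 1)) :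
    Function.update (state u v d b s y r o c S) (Wire.cmp j) a
      = state u v d (Function.update b j a) s y r o c S := by unfold state; rw [Sum.update_elim_inl, Sum.update_elim_inr, Sum.update_elim_inl, Sum.update_elim_inr]
@[simp] theorem update_perm (j : Fin k) :
    Function.update (state u v d b s y r o c S) (Wire.perm j) a
      = state u v d b (Function.update s j a) y r o c S := by unfold state; rw [Sum.update_elim_inl, Sum.update_elim_inr, Sum.update_elim_inr, Sum.update_elim_inl]
@[simp] theorem update_ctrl : Function.update (state u v d b s y r o c S) Wire.ctrl a
    = state u v d b s y r a c S := by
  have : Function.update (fun _ : Fin 1 => o) 0 a = fun _ => a := by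
    funext i; rw [Subsingleton.elim i 0]; simp
  unfold state; rw [Sum.update_elim_inr, Sum.update_elim_inr, Sum.update_elim_inl, Sum.update_elim_inl, this]

@[simp] theorem state_fst (j : Fin W) : state u v d b s y r o c S (Wire.fst j) = u j := rfl
@[simp] theorem state_snd (j : Fin W) : state u v d b s y r o c S (Wire.snd j) = v j := rfl
@[simp] theorem state_tmp : state u v d b s y r o c S Wire.tmp = d := rfl
@[simp] theorem state_cmp (j : Fin (m + 1)) : state u v d b s y r o c S (Wire.cmp j) = b j := rfl
@[simp] theorem state_perm (j : Fin k) : state u v d b s y r o c S (Wire.perm j) = s j := rfl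
@[simp] theorem state_zero (j : Fin Z) : state u v d b s y r o c S (Wire.zero j) = y j := rfl
@[simp] theorem state_plus (j : Fin P) : state u v d b s y r o c S (Wire.plus j) = r j := rfl
@[simp] theorem state_ctrl : state u v d b s y r o c S Wire.ctrl = o := rfl
@[simp] theorem state_coin (j : Fin m) : state u v d b s y r o c S (Wire.coin j) = c j := rfl
@[simp] theorem state_choice (j : Fin k) : state u v d b s y r o c S (Wire.choice j) = S j := rfl

end Update

/-- A comparison of `m` random bits with the number with binary digits `t`: it is true for exactly
this number of values of the random bits. -/
def less (t : ℕ → Bool) : ∀ {m : ℕ}, (Fin m → Bool) → ℕ → Bool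
  | _, _, 0 => false
  | m, c, j + 1 =>
    let a := if h : j < m then c ⟨j, h⟩ else false
    if t j then a || less t c j else a && less t c j

/-- Comparison of a uniformly random number with the number with binary digits `t`. -/
def coinGates (t : ℕ → Bool) : List (StoqGate (Wire W Z P k m)) :=
  (List.finRange m).flatMap fun j =>
    .toffoli (Wire.coin j) (Wire.cmp j.castSucc) (Wire.cmp j.succ) ::
      if t j then [.cnot (Wire.coin j) (Wire.cmp j.succ), .cnot (Wire.cmp j.castSucc) (Wire.cmp j.succ)]
      else []

theorem run_coinGates (t : ℕ → Bool) (u v : Fin W → Bool) (d : Bool) (s : Fin k → Bool)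
    (y : Fin Z → Bool) (r : Fin P → Bool) (o : Bool) (c : Fin m → Bool) (S : Fin k → Bool) :
    run (coinGates t) (state u v d (fun _ => false) s y r o c S)
      = state u v d (fun j : Fin (m + 1) => less t c j) s y r o c S := by
  -- After `i` rounds the partial results with index at most `i` have been written, and the later
  -- ones still hold their initial zero.
  have h := run_flatMap_finRange (fun j => StoqGate.toffoli (Wire.coin j) (Wire.cmp j.castSucc)
      (Wire.cmp j.succ) ::
      if t j then [.cnot (Wire.coin j) (Wire.cmp j.succ), .cnot (Wire.cmp j.castSucc) (Wire.cmp j.succ)]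
      else []) (fun i => state u v d (fun j : Fin (m + 1) => decide ((j : ℕ) ≤ i) && less t c j) s y r o c S) ?_
  · have e1 : (fun j : Fin (m + 1) => decide ((j : ℕ) ≤ 0) && less t c j) = fun _ => false := by
      funext j
      rcases Nat.eq_zero_or_pos (j : ℕ) with h | h
      · simp [h, less]
      · simp [h.ne']
    have e2 : (fun j : Fin (m + 1) => decide ((j : ℕ) ≤ m) && less t c j) = fun j : Fin (m + 1) => less t c j := by
      funext j
      simp [Nat.lt_succ_iff.1 j.isLt]
    rw [e1, e2] at h
    exact h
  · intro j
    have key : ∀ a, a = less t c (j + 1) →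
        state u v d (Function.update (fun i : Fin (m + 1) => decide ((i : ℕ) ≤ j) && less t c i) j.succ a)
          s y r o c S
        = state (Z := Z) u v d (fun i => decide ((i : ℕ) ≤ j + 1) && less t c i) s y r o c S := by
      intro a ha
      congr 1
      funext i
      by_cases hi : i = j.succ
      · subst hi; simp [ha]
      · have : (i : ℕ) ≠ j + 1 := fun h => hi (Fin.ext (by simpa using h))
        have : (i : ℕ) ≤ j ↔ (i : ℕ) ≤ j + 1 := by omega
        simp [hi, this]
    have hne : j.castSucc ≠ j.succ := Fin.castSucc_lt_succ.ne
    have hne' : ¬ j.succ ≤ j.castSucc := by simp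
    cases ht : t j
    · simp only [run_cons, act, update_cmp, state_cmp, state_coin, Bool.false_eq_true, if_false, run_nil]
      refine key _ ?_
      simp [less, ht]
    · simp only [run_cons, act, update_cmp, state_cmp, state_coin, if_true, run_nil,
        Function.update_idem, Function.update_self, Function.update_of_ne hne]
      refine key _ ?_
      simp [less, ht]
      -- A disjunction is the exclusive or of both bits and their conjunction, which is what the
      -- Toffoli and the two CNOT gates add up.
      cases c j <;> cases less t c j <;> rfl

/-- Permission to swap a block: it has been chosen, and the comparison has failed. -/
def permGates : List (StoqGate (Wire W Z P k m)) :=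
  (List.finRange k).flatMap fun i =>
    [.toffoli (Wire.cmp (Fin.last m)) (Wire.choice i) (Wire.perm i),
      .cnot (Wire.choice i) (Wire.perm i)]

theorem run_permGates (u v : Fin W → Bool) (d : Bool) (b : Fin (m + 1) → Bool)
    (y : Fin Z → Bool) (r : Fin P → Bool) (o : Bool) (c : Fin m → Bool) (S : Fin k → Bool) :
    run permGates (state u v d b (fun _ => false) y r o c S)
      = state u v d b (fun i => S i && !b (Fin.last m)) y r o c S := by
  have h := run_flatMap_finRange (fun i => [StoqGate.toffoli (Wire.cmp (Fin.last m)) (Wire.choice i)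
      (Wire.perm i), .cnot (Wire.choice i) (Wire.perm i)])
    (fun j => state u v d b (fun i => decide ((i : ℕ) < j) && (S i && !b (Fin.last m))) y r o c S) ?_
  · simp only [Nat.not_lt_zero, decide_false, Bool.false_and, Fin.is_lt, decide_true,
      Bool.true_and] at h
    exact h
  · intro j
    simp only [run_cons, act, update_perm, state_cmp, state_perm, state_choice, run_nil,
      Function.update_idem, Function.update_self]
    congr 1
    funext i
    by_cases hi : i = j
    · subst hi
      simp
      -- The exclusive or of `S` and `b ∧ S` is `S ∧ ¬ b`.
      cases S i <;> cases b (Fin.last m) <;> rfl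
    · have : (i : ℕ) ≠ j := fun h => hi (Fin.ext h)
      have : (i : ℕ) < j ↔ (i : ℕ) < j + 1 := by omega
      simp only [this, Function.update_of_ne hi]

variable {ℓ : ℕ}

/-- The position of a qubit of a block. -/
def pos (h : W = k * ℓ) (i : Fin k) (t : Fin ℓ) : Fin W := Fin.cast h.symm (finProdFinEquiv (i, t))

/-- The block of a qubit. -/
def blk (h : W = k * ℓ) (j : Fin W) : Fin k := (finProdFinEquiv.symm (Fin.cast h j)).1

@[simp] theorem blk_pos (h : W = k * ℓ) (i : Fin k) (t : Fin ℓ) : blk h (pos h i t) = i := by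
  simp [blk, pos]

theorem val_pos (h : W = k * ℓ) (i : Fin k) (t : Fin ℓ) : (pos h i t : ℕ) = t + ℓ * i := rfl

/-- The result of swapping the blocks that are marked. -/
def mix (h : W = k * ℓ) (S : Fin k → Bool) (u v : Fin W → Bool) : Fin W → Bool :=
  fun j => if S (blk h j) then v j else u j

/-- Controlled swaps of the marked blocks of the witnesses. -/
def swapGates (h : W = k * ℓ) : List (StoqGate (Wire W Z P k m)) :=
  (List.finRange k).flatMap fun i => (List.finRange ℓ).flatMap fun t =>
    -- A swap consists of three CNOT gates, of which only the middle one needs a control. That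
    -- control is the conjunction of two qubits, so it is computed into `tmp` and cleared again by
    -- the last gate.
    [.toffoli Wire.ctrl (Wire.perm i) Wire.tmp,
      .cnot (Wire.snd (pos h i t)) (Wire.fst (pos h i t)),
      .toffoli Wire.tmp (Wire.fst (pos h i t)) (Wire.snd (pos h i t)),
      .cnot (Wire.snd (pos h i t)) (Wire.fst (pos h i t)),
      .toffoli Wire.ctrl (Wire.perm i) Wire.tmp]

theorem run_swapGates (h : W = k * ℓ) (u v : Fin W → Bool) (b : Fin (m + 1) → Bool) (s : Fin k → Bool)
    (y : Fin Z → Bool) (r : Fin P → Bool) (o : Bool) (c : Fin m → Bool) (S : Fin k → Bool) :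
    run (swapGates h) (state u v false b s y r o c S)
      = state (mix h (fun i => o && s i) u v) (mix h (fun i => o && s i) v u) false b s y r o c S := by
  -- The qubits at positions below `n` have been treated. Blocks are consecutive, so a round of the
  -- outer loop advances `n` by `ℓ`.
  let f (n : ℕ) (u v : Fin W → Bool) : Fin W → Bool := fun j =>
    if (decide ((j : ℕ) < n) && (o && s (blk h j))) = true then v j else u j
  let z (n : ℕ) : Wire W Z P k m → Bool := state (f n u v) (f n v u) false b s y r o c S
  have h0 : ∀ u v, f 0 u v = u := fun u v => by funext j; simp [f]
  have hk : ∀ u v, f (ℓ * k) u v = mix h (fun i => o && s i) u v := fun u v => by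
    funext j
    have : (j : ℕ) < ℓ * k := by have := j.isLt; rw [mul_comm]; omega
    simp [f, mix, this]
  have key := run_flatMap_finRange (fun i => (List.finRange ℓ).flatMap fun t =>
    [StoqGate.toffoli Wire.ctrl (Wire.perm i) Wire.tmp,
      .cnot (Wire.snd (pos h i t)) (Wire.fst (pos h i t)),
      .toffoli Wire.tmp (Wire.fst (pos h i t)) (Wire.snd (pos h i t)),
      .cnot (Wire.snd (pos h i t)) (Wire.fst (pos h i t)),
      .toffoli Wire.ctrl (Wire.perm i) Wire.tmp]) (fun i => z (ℓ * i)) ?_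
  · simp only [z, mul_zero, h0, hk] at key
    exact key
  intro i
  have key := run_flatMap_finRange (fun t =>
    [StoqGate.toffoli Wire.ctrl (Wire.perm i) Wire.tmp,
      .cnot (Wire.snd (pos h i t)) (Wire.fst (pos h i t)),
      .toffoli Wire.tmp (Wire.fst (pos h i t)) (Wire.snd (pos h i t)),
      .cnot (Wire.snd (pos h i t)) (Wire.fst (pos h i t)),
      .toffoli Wire.ctrl (Wire.perm i) Wire.tmp]) (fun t => z (t + ℓ * i)) ?_
  · simp only [zero_add] at key
    have e : ℓ * ((i : ℕ) + 1) = ℓ + ℓ * i := by ring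
    rw [e]
    exact key
  intro t
  have hp := val_pos h i t
  have e : ∀ u v, f (t + 1 + ℓ * i) u v = Function.update (f (t + ℓ * i) u v) (pos h i t)
      (if (o && s i) = true then v (pos h i t) else u (pos h i t)) := by
    intro u v
    funext j
    by_cases hj : j = pos h i t
    · subst hj
      simp [f, hp]
    · have : (j : ℕ) ≠ t + ℓ * i := fun h' => hj (Fin.ext (h'.trans hp.symm))
      have : (j : ℕ) < t + 1 + ℓ * i ↔ (j : ℕ) < t + ℓ * i := by omega
      simp [f, hj, this]
  have e0 : ∀ u v, f (t + ℓ * i) u v (pos h i t) = u (pos h i t) := by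
    intro u v
    simp [f, hp]
  simp only [z, run_cons, act, update_tmp, update_fst, update_snd, state_tmp, state_fst, state_snd,
    state_ctrl, state_perm, run_nil, Function.update_idem, Function.update_self, e0, e]
  cases o <;> cases s i <;> cases u (pos h i t) <;> cases v (pos h i t) <;> rfl

end SwapTest

end

/-! ### Correctness of the list of gates -/

section

open StoqGate SwapTest

namespace SwapTest

/-- Induction on the most significant bit: if `t m` is set, all `2 ^ m` strings with top bit 1 count
and those with top bit 0 are counted recursively; otherwise only strings with top bit 1 are counted
recursively. -/
theorem card_less (t : ℕ → Bool) (m : ℕ) :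
    ∑ c : Fin m → Bool, (less t c m).toNat = ∑ j ∈ Finset.range m, (t j).toNat * 2 ^ j := by
  have hs : ∀ (n m : ℕ) (c : Fin m → Bool) (a : Bool), n ≤ m →
      less t (Fin.snoc (α := fun _ => Bool) c a) n = less t c n := by
    intro n m c a hn
    induction n with
    | zero => rfl
    | succ n ih =>
      have h1 : n < m := hn
      have h2 : n < m + 1 := by omega
      have h3 : Fin.snoc (α := fun _ => Bool) c a ⟨n, h2⟩ = c ⟨n, h1⟩ :=
        Fin.snoc_castSucc (α := fun _ => Bool) a c ⟨n, h1⟩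
      simp only [less, h1, h2, dite_true, ih (by omega), h3]
  induction m with
  | zero => simp [less]
  | succ m ih =>
    rw [← (Fin.snocEquiv fun _ : Fin (m + 1) => Bool).sum_comp, Fintype.sum_prod_type,
      Finset.sum_range_succ, ← ih]
    have h : ∀ (a : Bool) (c : Fin m → Bool),
        less t ((Fin.snocEquiv fun _ : Fin (m + 1) => Bool) (a, c)) (m + 1)
          = if t m then a || less t c m else a && less t c m := by
      intro a c
      have h1 : Fin.snoc (α := fun _ => Bool) c a ⟨m, m.lt_succ_self⟩ = a :=
        Fin.snoc_last (α := fun _ => Bool) a c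
      have h2 := hs m m c a le_rfl
      simp only [Fin.snocEquiv, Equiv.coe_fn_mk, less, m.lt_succ_self, dite_true, h1, h2]
    simp only [h, Fintype.sum_bool]
    cases t m <;> simp [add_comm]

variable (V : StoqCircuit) {k ℓ m : ℕ}

/-- The wires of the given circuit; its witness is the first of the two witnesses. -/
def emb (j : Fin (V.numWitness + V.numZero + V.numPlus)) : Wire V.numWitness V.numZero V.numPlus k m :=
  Fin.addCases (Fin.addCases Wire.fst Wire.zero) Wire.plus j

theorem emb_castAdd_castAdd (j : Fin V.numWitness) :
    emb V (k := k) (m := m) (Fin.castAdd _ (Fin.castAdd _ j)) = Wire.fst j := by simp [emb]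
theorem emb_castAdd_natAdd (j : Fin V.numZero) :
    emb V (k := k) (m := m) (Fin.castAdd _ (Fin.natAdd _ j)) = Wire.zero j := by simp [emb]
theorem emb_natAdd (j : Fin V.numPlus) :
    emb V (k := k) (m := m) (Fin.natAdd _ j) = Wire.plus j := by simp [emb]

/-- A property of all wires of a circuit. -/
theorem forall_wire {p : Fin (V.numWitness + V.numZero + V.numPlus) → Prop}
    (h1 : ∀ j, p (Fin.castAdd _ (Fin.castAdd _ j))) (h2 : ∀ j, p (Fin.castAdd _ (Fin.natAdd _ j)))
    (h3 : ∀ j, p (Fin.natAdd _ j)) : ∀ j, p j :=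
  Fin.addCases (fun j => Fin.addCases (motive := fun j => p (Fin.castAdd _ j)) h1 h2 j) h3

theorem emb_injective : Function.Injective (emb V (k := k) (m := m)) := by
  refine forall_wire V (fun i => ?_) (fun i => ?_) (fun i => ?_) <;>
  refine forall_wire V (fun j => ?_) (fun j => ?_) (fun j => ?_) <;>
  simp [emb]

/-- The basis string in which the wires of the given circuit have the values `y`. -/
def stateOf (y : V.Basis) (v : Fin V.numWitness → Bool) (d : Bool) (b : Fin (m + 1) → Bool)
    (s : Fin k → Bool) (o : Bool) (c : Fin m → Bool) (S : Fin k → Bool) :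
    Wire V.numWitness V.numZero V.numPlus k m → Bool :=
  state (fun j => y (Fin.castAdd _ (Fin.castAdd _ j))) v d b s
    (fun j => y (Fin.castAdd _ (Fin.natAdd _ j))) (fun j => y (Fin.natAdd _ j)) o c S

section

variable (y : V.Basis) (v : Fin V.numWitness → Bool) (d : Bool) (b : Fin (m + 1) → Bool)
    (s : Fin k → Bool) (o : Bool) (c : Fin m → Bool) (S : Fin k → Bool)

theorem stateOf_comp_emb : stateOf V y v d b s o c S ∘ emb V = y := by
  funext j
  refine forall_wire V (p := fun j => (stateOf V y v d b s o c S ∘ emb V) j = y j)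
    (fun i => ?_) (fun i => ?_) (fun i => ?_) j <;> simp [emb, stateOf]

theorem eq_stateOf {z : Wire V.numWitness V.numZero V.numPlus k m → Bool}
    (h : ∀ w, w ∉ Set.range (emb V (k := k) (m := m)) → z w = stateOf V y v d b s o c S w) :
    z = stateOf V (z ∘ emb V) v d b s o c S := by
  funext w
  by_cases hw : w ∈ Set.range (emb V (k := k) (m := m))
  · obtain ⟨j, rfl⟩ := hw
    exact (congrFun (stateOf_comp_emb V (z ∘ emb V) v d b s o c S) j).symm
  · rw [h w hw]
    rcases w with ((w | w) | ((w | w) | (w | w))) | (w | ((w | w) | w))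
    · exact absurd ⟨_, emb_castAdd_castAdd V w⟩ hw
    · rfl
    · rfl
    · rfl
    · rfl
    · exact absurd ⟨_, emb_castAdd_natAdd V w⟩ hw
    · exact absurd ⟨_, emb_natAdd V w⟩ hw
    all_goals rfl

theorem run_map_emb (L : List (StoqGate (Fin (V.numWitness + V.numZero + V.numPlus)))) :
    run (L.map (StoqGate.map (emb V))) (stateOf V y v d b s o c S)
      = stateOf V (run L y) v d b s o c S := by
  have := eq_stateOf V y v d b s o c S (z := run (L.map (StoqGate.map (emb V))) (stateOf V y v d b s o c S))
    fun w hw => run_map_of_notMem L _ hw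
  rwa [run_map_comp (emb_injective V), stateOf_comp_emb] at this

theorem update_emb (j : Fin (V.numWitness + V.numZero + V.numPlus)) (a : Bool) :
    Function.update (stateOf V y v d b s o c S) (emb V j) a
      = stateOf V (Function.update y j a) v d b s o c S := by
  have := eq_stateOf V y v d b s o c S (z := Function.update (stateOf V y v d b s o c S) (emb V j) a)
    fun w hw => Function.update_of_ne (fun h => hw ⟨j, h.symm⟩) _ _
  rwa [Function.update_comp_eq_of_injective _ (emb_injective V), stateOf_comp_emb] at this

end

/-- The gates of the verifier for two proofs. -/
def gates (t : ℕ → Bool) (m : ℕ) (h : V.numWitness = k * ℓ) :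
    List (StoqGate (Wire V.numWitness V.numZero V.numPlus k m)) :=
  coinGates t ++ permGates ++ swapGates h ++ V.gates.map (StoqGate.map (emb V)) ++
    [.toffoli Wire.ctrl (Wire.cmp (Fin.last m)) (emb V V.output)]

theorem isValid_gates (t : ℕ → Bool) (m : ℕ) (h : V.numWitness = k * ℓ) :
    ∀ g ∈ gates V t m h, g.IsValid := by
  intro g hg
  simp only [gates, List.mem_append, List.mem_singleton, List.mem_map] at hg
  rcases hg with (((hg | hg) | hg) | ⟨g, hg, rfl⟩) | rfl
  · simp only [coinGates, List.mem_flatMap, List.mem_cons] at hg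
    obtain ⟨j, -, rfl | hg⟩ := hg
    · simp [IsValid, Fin.castSucc_lt_succ.ne]
    · split_ifs at hg
      · simp only [List.mem_cons, List.not_mem_nil, or_false] at hg
        rcases hg with rfl | rfl <;> simp [IsValid, Fin.castSucc_lt_succ.ne]
      · simp at hg
  · simp only [permGates, List.mem_flatMap, List.mem_cons, List.not_mem_nil, or_false] at hg
    obtain ⟨j, -, rfl | rfl⟩ := hg <;> simp [IsValid]
  · simp only [swapGates, List.mem_flatMap, List.mem_cons, List.not_mem_nil, or_false] at hg
    obtain ⟨i, -, j, -, rfl | rfl | rfl | rfl | rfl⟩ := hg <;> simp [IsValid]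
  · exact (V.valid g hg).map (emb_injective V)
  · refine ⟨by simp, ?_, ?_⟩ <;>
    refine forall_wire V (p := fun j => _ ≠ emb V j) (fun i => ?_) (fun i => ?_) (fun i => ?_) V.output <;>
    simp [emb]

/-- At most one test acts: a successful comparison withholds every permission to swap, and a failed
one leaves the last Toffoli gate idle. Scratch qubits need not be uncomputed, because an echo runs
the gates backwards anyway. -/
theorem run_gates (t : ℕ → Bool) (m : ℕ) (h : V.numWitness = k * ℓ) (y : V.Basis)
    (v : Fin V.numWitness → Bool) (o : Bool) (c : Fin m → Bool) (S : Fin k → Bool) :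
    run (gates V t m h) (stateOf V y v false (fun _ => false) (fun _ => false) o c S) =
      let s := fun i => S i && !less t c m
      let u := fun j => y (Fin.castAdd _ (Fin.castAdd _ j))
      let y' : V.Basis := run V.gates (Fin.append (Fin.append (mix h (fun i => o && s i) u v)
        fun j => y (Fin.castAdd _ (Fin.natAdd _ j))) fun j => y (Fin.natAdd _ j))
      stateOf V (if (o && less t c m) = true then flipAt V.output y' else y')
        (mix h (fun i => o && s i) v u) false (fun j => less t c j) s o c S := by
  simp only
  set s : Fin k → Bool := fun i => S i && !less t c m
  set u := fun j => y (Fin.castAdd _ (Fin.castAdd _ j))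
  unfold gates
  simp only [run_append, run_cons, run_nil]
  have e : run (swapGates h) (run permGates (run (coinGates t)
      (stateOf V y v false (fun _ => false) (fun _ => false) o c S)))
      = stateOf V (Fin.append (Fin.append (mix h (fun i => o && s i) u v)
        fun j => y (Fin.castAdd _ (Fin.natAdd _ j))) fun j => y (Fin.natAdd _ j))
        (mix h (fun i => o && s i) v u) false (fun j => less t c j) s o c S := by
    unfold stateOf
    rw [run_coinGates, run_permGates, run_swapGates]
    simp [s, u]
  rw [e, run_map_emb]
  set y' : V.Basis := run V.gates (Fin.append (Fin.append (mix h (fun i => o && s i) u v)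
        fun j => y (Fin.castAdd _ (Fin.natAdd _ j))) fun j => y (Fin.natAdd _ j))
  have e2 := congrFun (stateOf_comp_emb V y' (mix h (fun i => o && s i) v u) false
    (fun j : Fin (m + 1) => less t c j) s o c S) V.output
  simp only [Function.comp_apply] at e2
  simp only [act, update_emb, e2]
  congr 1
  have e3 : stateOf V y' (mix h (fun i => o && s i) v u) false
    (fun j : Fin (m + 1) => less t c j) s o c S Wire.ctrl = o := rfl
  have e4 : stateOf V y' (mix h (fun i => o && s i) v u) false
    (fun j : Fin (m + 1) => less t c j) s o c S (Wire.cmp (Fin.last m)) = less t c m := rfl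
  rw [e3, e4]
  cases o <;> cases less t c m <;> simp [flipAt]

theorem mix_mix (h : V.numWitness = k * ℓ) (S : Fin k → Bool) (u v : Fin V.numWitness → Bool) :
    mix h S (mix h S u v) (mix h S v u) = u := by
  funext j
  simp only [mix]
  cases S (blk h j) <;> rfl

theorem append_eta (y : V.Basis) : Fin.append (Fin.append
    (fun j => y (Fin.castAdd _ (Fin.castAdd _ j))) fun j => y (Fin.castAdd _ (Fin.natAdd _ j)))
      (fun j => y (Fin.natAdd _ j)) = y := by
  funext j
  refine forall_wire V (p := fun j => Fin.append _ _ j = y j) (fun i => ?_) (fun i => ?_)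
    (fun i => ?_) j <;> simp

/-- The effect of flipping the control qubit between the gates and their inverses. -/
theorem run_gates_flip (t : ℕ → Bool) (m : ℕ) (h : V.numWitness = k * ℓ) (u v : Fin V.numWitness → Bool)
    (r : Fin V.numPlus → Bool) (o : Bool) (c : Fin m → Bool) (S : Fin k → Bool) :
    run (gates V t m h) (if less t c m then
        stateOf V (V.echo (V.start u r)) v false (fun _ => false) (fun _ => false) (!o) c S
      else stateOf V (V.start (mix h S u v) r) (mix h S v u) false (fun _ => false)
        (fun _ => false) (!o) c S)
      = flipAt Wire.ctrl (run (gates V t m h)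
        (stateOf V (V.start u r) v false (fun _ => false) (fun _ => false) o c S)) := by
  have hm : ∀ u v : Fin V.numWitness → Bool, mix h (fun _ => false) u v = u := fun u v => by
    funext j; simp [mix]
  have hf : ∀ y v (b : Fin (m + 1) → Bool) s o (c : Fin m → Bool) S,
      flipAt Wire.ctrl (stateOf (k := k) V y v false b s o c S)
      = stateOf V y v false b s (!o) c S := by
    intros
    simp [flipAt, stateOf]
  cases hl : less t c m
  -- Exactly one of the two control values performs the exchange. Exchanging the blocks of the input
  -- as well compensates for this, since the exchange is an involution.
  · simp only [Bool.false_eq_true, if_false, run_gates, hf, hl, Bool.not_false, Bool.and_true,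
      Bool.and_false]
    cases o <;> simp [hm, StoqCircuit.start, mix_mix]
  -- The run of `V` on an echo differs by a flip of its output, and the last Toffoli gate makes that
  -- flip for exactly one of the two control values.
  · simp only [if_true, run_gates, hf, hl, Bool.not_true, Bool.and_false, Bool.and_true, hm]
    have e1 := append_eta V (V.echo (V.start u r))
    have e2 := append_eta V (V.start u r)
    rw [e1, e2, V.run_echo]
    cases o
    · simp [flipAt]
    · simp

end SwapTest

end

/-! ### Acceptance probability of the verifier for two proofs -/

section

open StoqGate

namespace StoqCircuit

variable (C : StoqCircuit) {ι : Type} [DecidableEq ι]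

/-- Transports the characterization of the echo from numbered wires to structured ones, where the
runs have been computed. -/
theorem echo_comp (e : ι ≃ Fin (C.numWitness + C.numZero + C.numPlus)) {L : List (StoqGate ι)} {o : ι}
    (hL : C.gates = L.map (StoqGate.map e)) (ho : C.output = e o) {z : C.Basis} {w : ι → Bool}
    (hw : run L w = flipAt o (run L (z ∘ e))) : C.echo z ∘ e = w := by
  have h : ∀ w : ι → Bool, (w ∘ e.symm) ∘ e = w := fun w => by funext; simp
  have : w ∘ e.symm = C.echo z := by
    apply C.eq_echo
    apply e.surjective.injective_comp_right
    simp only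
    rw [hL, run_map_comp e.injective, h, hw, ← run_map_comp e.injective, ho]
    exact (Function.update_comp_eq_of_injective _ e.injective _ _).symm
  rw [← this, h]

theorem amplitude_of_zero (ψ : (Fin C.numWitness → Bool) → ℝ) {z : C.Basis}
    (h : ∀ j, z (Fin.castAdd C.numPlus (Fin.natAdd C.numWitness j)) = false) :
    C.amplitude ψ z = ψ fun i => z (Fin.castAdd C.numPlus (Fin.castAdd C.numZero i)) := if_pos h

theorem amplitude_of_ne_zero (ψ : (Fin C.numWitness → Bool) → ℝ) {z : C.Basis}
    (h : ¬ ∀ j, z (Fin.castAdd C.numPlus (Fin.natAdd C.numWitness j)) = false) :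
    C.amplitude ψ z = 0 := if_neg h

end StoqCircuit

namespace SwapTest

/-- The numbering of the wires. -/
def numbering (W Z P k m : ℕ) : Wire W Z P k m ≃
    Fin ((W + W) + ((1 + (m + 1)) + (k + Z)) + (P + ((1 + m) + k))) :=
  (((finSumFinEquiv.sumCongr (((finSumFinEquiv.sumCongr finSumFinEquiv).trans finSumFinEquiv))).trans
    finSumFinEquiv).sumCongr (((Equiv.refl _).sumCongr ((finSumFinEquiv.sumCongr (Equiv.refl _)).trans
      finSumFinEquiv)).trans finSumFinEquiv)).trans finSumFinEquiv

variable (V : StoqCircuit) {k ℓ m : ℕ}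

/-- The verifier for two proofs. -/
def verifier (t : ℕ → Bool) (m : ℕ) (h : V.numWitness = k * ℓ) : StoqCircuit where
  numWitness := V.numWitness + V.numWitness
  numZero := (1 + (m + 1)) + (k + V.numZero)
  numPlus := V.numPlus + ((1 + m) + k)
  gates := (gates V t m h).map (StoqGate.map (numbering _ _ _ _ _))
  valid g hg := by
    obtain ⟨g', hg', rfl⟩ := List.mem_map.1 hg
    exact (isValid_gates V t m h g' hg').map (Equiv.injective _)
  output := numbering _ _ _ _ _ Wire.ctrl

theorem start_verifier_comp (t : ℕ → Bool) (m : ℕ) (h : V.numWitness = k * ℓ)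
    (u v : Fin V.numWitness → Bool) (r : Fin V.numPlus → Bool) (o : Fin 1 → Bool) (c : Fin m → Bool)
    (S : Fin k → Bool) :
    (verifier V t m h).start (Fin.append u v) (Fin.append r (Fin.append (Fin.append o c) S))
        ∘ numbering _ _ _ _ _
      = stateOf V (V.start u r) v false (fun _ => false) (fun _ => false) (o 0) c S := by
  have h1 : ∀ j, Fin.append (Fin.append (Fin.append u v) fun _ : Fin ((1 + (m + 1)) + (k + V.numZero)) => false)
      (Fin.append r (Fin.append (Fin.append o c) S)) (numbering _ _ _ _ _ j)
      = stateOf V (V.start u r) v false (fun _ => false) (fun _ => false) (o 0) c S j := by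
    rintro (((w | w) | ((w | w) | (w | w))) | (w | ((w | w) | w)))
    all_goals simp [numbering, StoqCircuit.start, stateOf, state, -Fin.natAdd_eq_addNat]
    rw [Subsingleton.elim w 0]
  exact funext h1

/-- The new zeros hold zero by the form of `z`. The echo of `V` may disturb the zeros of `V`; in
that case both sides vanish. -/
theorem amplitude_verifier (t : ℕ → Bool) (m : ℕ) (h : V.numWitness = k * ℓ)
    (ψ₀ ψ₁ : (Fin V.numWitness → Bool) → ℝ) {z : (verifier V t m h).Basis} {y v o c S}
    (hz : z ∘ numbering _ _ _ _ _ = stateOf V y v false (fun _ => false) (fun _ => false) o c S) :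
    (verifier V t m h).amplitude (fun u => ψ₀ (fun j => u (Fin.castAdd _ j))
      * ψ₁ (fun j => u (Fin.natAdd _ j))) z = V.amplitude ψ₀ y * ψ₁ v := by
  have hz' := congrFun hz
  by_cases hy : ∀ j, y (Fin.castAdd V.numPlus (Fin.natAdd V.numWitness j)) = false
  · rw [V.amplitude_of_zero ψ₀ hy]
    refine ((verifier V t m h).amplitude_of_zero _ fun j => ?_).trans ?_
    · obtain ⟨j, rfl⟩ := (((finSumFinEquiv.sumCongr finSumFinEquiv).trans finSumFinEquiv) :
        (Fin 1 ⊕ Fin (m + 1)) ⊕ (Fin k ⊕ Fin V.numZero) ≃ _).surjective j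
      refine (hz' (.inl (.inr j))).trans ?_
      rcases j with (j | j) | (j | j)
      exacts [rfl, rfl, rfl, hy j]
    · exact congrArg₂ (· * ·) (congrArg ψ₀ (funext fun j => hz' (Wire.fst j)))
        (congrArg ψ₁ (funext fun j => hz' (Wire.snd j)))
  · rw [V.amplitude_of_ne_zero ψ₀ hy, zero_mul]
    refine (verifier V t m h).amplitude_of_ne_zero _ fun H => hy fun j => ?_
    exact (hz' (Wire.zero j)).symm.trans (H (Fin.natAdd (1 + (m + 1)) (Fin.natAdd k j)))

/-- The average overlap of `ψ₀ ⊗ ψ₁` with the states in which some of the blocks are swapped. -/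
noncomputable def swapOverlap {W : ℕ} (h : W = k * ℓ) (ψ₀ ψ₁ : (Fin W → Bool) → ℝ) : ℝ :=
  (1 / 2) ^ k * ∑ S : Fin k → Bool, ∑ u, ∑ v, ψ₀ u * ψ₁ v * (ψ₀ (mix h S u v) * ψ₁ (mix h S v u))

theorem sum_append {a b : ℕ} (f : (Fin (a + b) → Bool) → ℝ) :
    ∑ w, f w = ∑ u, ∑ v, f (Fin.append u v) := by
  rw [← (Fin.appendEquiv a b).sum_comp, Fintype.sum_prod_type]
  rfl

/-- By the echo formula the acceptance probability is affine in an overlap, and `run_gates_flip`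
describes the echo string by string: values of the coins below the threshold, a fraction `p`,
contribute the echo of `V` on the first proof, the others an exchange of blocks. The affine map is
the same for `V`, so the mixture of overlaps becomes a mixture of probabilities. -/
theorem acceptProb_verifier (t : ℕ → Bool) (m : ℕ) (h : V.numWitness = k * ℓ)
    {ψ₀ ψ₁ : (Fin V.numWitness → Bool) → ℝ} (h₀ : ∑ u, ψ₀ u ^ 2 = 1) (h₁ : ∑ u, ψ₁ u ^ 2 = 1)
    {p : ℝ} (hp : p = ((∑ j ∈ Finset.range m, (t j).toNat * 2 ^ j : ℕ) : ℝ) / 2 ^ m) :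
    (verifier V t m h).acceptProb (fun u => ψ₀ (fun j => u (Fin.castAdd _ j))
      * ψ₁ (fun j => u (Fin.natAdd _ j)))
      = p * V.acceptProb ψ₀ + (1 - p) * (1 / 2 + 1 / 2 * swapOverlap h ψ₀ ψ₁) := by
  set ψ : (Fin (verifier V t m h).numWitness → Bool) → ℝ :=
    fun u => ψ₀ (fun j => u (Fin.castAdd _ j)) * ψ₁ (fun j => u (Fin.natAdd _ j)) with hψ
  have hψ1 : ∑ u, ψ u ^ 2 = 1 := by
    refine (sum_append (a := V.numWitness) (b := V.numWitness) _).trans ?_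
    simp only [hψ, Fin.append_left, Fin.append_right, mul_pow, ← Finset.mul_sum]
    rw [h₁]
    simpa using h₀
  rw [StoqCircuit.acceptProb_eq _ hψ1, StoqCircuit.acceptProb_eq _ h₀]
  set A := ∑ u, ∑ r, ψ₀ u * V.amplitude ψ₀ (V.echo (V.start u r)) with hA
  set B : ℝ := ∑ S : Fin k → Bool, ∑ u, ∑ v, ψ₀ u * ψ₁ v * (ψ₀ (mix h S u v) * ψ₁ (mix h S v u)) with hB
  have hval : ∀ u v r (o : Fin 1 → Bool) (c : Fin m → Bool) S, ψ (Fin.append u v) *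
      (verifier V t m h).amplitude ψ ((verifier V t m h).echo ((verifier V t m h).start (Fin.append u v)
        (Fin.append r (Fin.append (Fin.append o c) S))))
      = ((less t c m).toNat : ℝ) * (ψ₀ u * V.amplitude ψ₀ (V.echo (V.start u r)) * ψ₁ v ^ 2)
        + (1 - (less t c m).toNat : ℝ) *
          (ψ₀ u * ψ₁ v * (ψ₀ (mix h S u v) * ψ₁ (mix h S v u))) := by
    intro u v r o c S
    have e1 := run_gates_flip V t m h u v r (o 0) c S
    rw [← start_verifier_comp V t m h u v r o c S] at e1
    have e2 := (verifier V t m h).echo_comp (numbering _ _ _ _ _) rfl rfl e1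
    have e3 : ψ (Fin.append u v) = ψ₀ u * ψ₁ v := by
      simp only [hψ, Fin.append_left, Fin.append_right]
    cases hl : less t c m
    · simp only [hl, Bool.false_eq_true, if_false] at e2
      rw [e3, amplitude_verifier V t m h ψ₀ ψ₁ e2]
      have : V.amplitude ψ₀ (V.start (mix h S u v) r) = ψ₀ (mix h S u v) := by
        simp [StoqCircuit.amplitude, StoqCircuit.start]
      rw [this]
      simp
    · simp only [hl, if_true] at e2
      rw [e3, amplitude_verifier V t m h ψ₀ ψ₁ e2]
      simp
      ring
  have hsum : ∑ u, ∑ r, ψ u * (verifier V t m h).amplitude ψ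
      ((verifier V t m h).echo ((verifier V t m h).start u r))
      = ∑ u, ∑ v, ∑ r, ∑ o : Fin 1 → Bool, ∑ c : Fin m → Bool, ∑ S : Fin k → Bool,
        (((less t c m).toNat : ℝ) * (ψ₀ u * V.amplitude ψ₀ (V.echo (V.start u r)) * ψ₁ v ^ 2)
        + (1 - (less t c m).toNat : ℝ) *
          (ψ₀ u * ψ₁ v * (ψ₀ (mix h S u v) * ψ₁ (mix h S v u)))) := by
    refine (sum_append (a := V.numWitness) (b := V.numWitness) _).trans ?_
    refine Finset.sum_congr rfl fun u _ => Finset.sum_congr rfl fun v _ => ?_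
    refine (sum_append (a := V.numPlus) (b := (1 + m) + k) _).trans ?_
    refine Finset.sum_congr rfl fun r _ => ?_
    refine (sum_append (a := 1 + m) (b := k) _).trans ((sum_append (a := 1) (b := m) _).trans ?_)
    exact Finset.sum_congr rfl fun o _ => Finset.sum_congr rfl fun c _ => Finset.sum_congr rfl fun S _ =>
      hval u v r o c S
  have hc : ∑ c : Fin m → Bool, ((less t c m).toNat : ℝ) = p * 2 ^ m := by
    have := card_less t m
    rw [hp, div_mul_cancel₀ _ (by positivity), ← this]
    push_cast
    rfl
  have hc' : ∑ c : Fin m → Bool, (1 - (less t c m).toNat : ℝ) = (1 - p) * 2 ^ m := by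
    rw [Finset.sum_sub_distrib, hc]
    simp [Finset.card_univ]
    ring
  -- Registers that a test does not use contribute the number of their values: the `2 ^ k` choices
  -- of blocks for the first test, the `2 ^ numPlus` ancillas of `V` for the second, and 2 for the
  -- control qubit in both.
  have hfin : ∑ u, ∑ v, ∑ r : Fin V.numPlus → Bool, ∑ o : Fin 1 → Bool, ∑ c : Fin m → Bool,
      ∑ S : Fin k → Bool,
        (((less t c m).toNat : ℝ) * (ψ₀ u * V.amplitude ψ₀ (V.echo (V.start u r)) * ψ₁ v ^ 2)
        + (1 - (less t c m).toNat : ℝ) *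
          (ψ₀ u * ψ₁ v * (ψ₀ (mix h S u v) * ψ₁ (mix h S v u))))
      = 2 ^ k * 2 * (p * 2 ^ m) * A + 2 ^ V.numPlus * 2 * ((1 - p) * 2 ^ m) * B := by
    simp only [Finset.sum_add_distrib, Finset.sum_const, Finset.card_univ, Fintype.card_pi,
      Fintype.card_bool, Finset.prod_const, Fintype.card_fin, nsmul_eq_mul, ← Finset.mul_sum,
      ← Finset.sum_mul, hc, hc']
    have hA' : ∑ u, ψ₀ u * ∑ r, V.amplitude ψ₀ (V.echo (V.start u r)) = A := by
      simp only [hA, Finset.mul_sum]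
    have hB' : ∑ u, ∑ v, ψ₀ u * ψ₁ v * ∑ S : Fin k → Bool, ψ₀ (mix h S u v) * ψ₁ (mix h S v u) = B := by
      simp only [hB, Finset.mul_sum]
      rw [Finset.sum_comm]
      conv_rhs => rw [Finset.sum_comm]
      rw [Finset.sum_comm]
      refine Finset.sum_congr rfl fun u _ => ?_
      rw [Finset.sum_comm]
    rw [hA', hB', h₁]
    push_cast
    ring
  rw [hsum, hfin]
  unfold swapOverlap
  rw [← hB]
  simp only [verifier]
  have e1 : (1 / 2 : ℝ) ^ (V.numPlus + ((1 + m) + k)) * (2 ^ k * 2 * (p * 2 ^ m) * A)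
      = p * ((1 / 2) ^ V.numPlus * A) := by
    simp only [pow_add, one_div, inv_pow]
    field_simp
  have e2 : (1 / 2 : ℝ) ^ (V.numPlus + ((1 + m) + k)) * (2 ^ V.numPlus * 2 * ((1 - p) * 2 ^ m) * B)
      = (1 - p) * ((1 / 2) ^ k * B) := by
    simp only [pow_add, one_div, inv_pow]
    field_simp
  rw [mul_add, e1, e2]
  ring

end SwapTest

end

/-! ### Analysis of the product test -/

section

open Finset

namespace SwapTest

variable {X : Type} {k : ℕ}

/-- Take the coordinates that are marked by `S` from `q` and the other ones from `p`. -/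
def mixing (S : Fin k → Bool) (p q : Fin k → X) : Fin k → X := fun i => if S i then q i else p i

theorem mixing_mixing (S : Fin k → Bool) (p q : Fin k → X) :
    mixing S (mixing S p q) (mixing S q p) = p := by
  funext i
  simp only [mixing]
  cases S i <;> rfl

theorem mixing_cons (b : Bool) (S : Fin k → Bool) (x y : X) (p q : Fin k → X) :
    mixing (Fin.cons b S : Fin (k + 1) → Bool) (Fin.cons x p) (Fin.cons y q)
      = Fin.cons (if b then y else x) (mixing S p q) := by
  funext i
  refine Fin.cases ?_ (fun i => ?_) i <;> simp [mixing]

/-- Exchange the coordinates that are marked by `S`. -/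
def exchange (S : Fin k → Bool) : Equiv.Perm ((Fin k → X) × (Fin k → X)) where
  toFun x := (mixing S x.1 x.2, mixing S x.2 x.1)
  invFun x := (mixing S x.1 x.2, mixing S x.2 x.1)
  left_inv x := by simp [mixing_mixing]
  right_inv x := by simp [mixing_mixing]

variable [Fintype X]

/-- The overlap of `f ⊗ g` and the vector that arises from `f' ⊗ g'` by exchanging the coordinates
that are marked by `S`. -/
def overlap (S : Fin k → Bool) (f g f' g' : (Fin k → X) → ℝ) : ℝ :=
  ∑ x : (Fin k → X) × (Fin k → X), f x.1 * g x.2 * (f' (mixing S x.1 x.2) * g' (mixing S x.2 x.1))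

/-- The exchange is a permutation, so Cauchy–Schwarz bounds the overlap of the symmetrized vector `u
⊗ v + v ⊗ u` with its exchange by its squared norm. Orthogonality makes that norm `2 ‖u‖² ‖v‖²`,
without cross terms. Bounding the two overlaps separately would lose a factor 2. -/
theorem overlap_add_overlap_le (S : Fin k → Bool) (u v : (Fin k → X) → ℝ) (h : ∑ p, u p * v p = 0) :
    overlap S u v u v + overlap S u v v u ≤ (∑ p, u p ^ 2) * ∑ p, v p ^ 2 := by
  let H (x : (Fin k → X) × (Fin k → X)) : ℝ := u x.1 * v x.2 + v x.1 * u x.2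
  have h1 : ∑ x, H x * H (exchange S x) ≤ ∑ x, H x ^ 2 := by
    have := Finset.sum_nonneg fun x (_ : x ∈ univ) => sq_nonneg (H x - H (exchange S x))
    have e := Equiv.sum_comp (exchange (X := X) S) fun x => H x ^ 2
    simp only [sub_sq, Finset.sum_add_distrib, Finset.sum_sub_distrib, mul_assoc,
      ← Finset.mul_sum] at this
    linarith
  have h2 : ∑ x, H x ^ 2 = 2 * ((∑ p, u p ^ 2) * ∑ p, v p ^ 2) := by
    have e : ∀ x : (Fin k → X) × (Fin k → X), H x ^ 2 = u x.1 ^ 2 * v x.2 ^ 2 + v x.1 ^ 2 * u x.2 ^ 2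
        + 2 * ((u x.1 * v x.1) * (u x.2 * v x.2)) := fun x => by simp only [H]; ring
    rw [Finset.sum_congr rfl fun x _ => e x]
    simp only [Finset.sum_add_distrib, ← Finset.mul_sum, Fintype.sum_prod_type, ← Finset.sum_mul, h]
    ring
  have h3 : ∑ x, H x * H (exchange S x) = 2 * (overlap S u v u v + overlap S u v v u) := by
    have e : ∀ f g f' g' : (Fin k → X) → ℝ, overlap S f g f' g' = overlap S g f g' f' := by
      intro f g f' g'
      unfold overlap
      rw [← Equiv.sum_comp (Equiv.prodComm _ _)]
      refine Finset.sum_congr rfl fun x _ => ?_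
      simp only [Equiv.prodComm_apply, Prod.fst_swap, Prod.snd_swap]
      ring
    have e' : ∑ x, H x * H (exchange S x) = overlap S u v u v + overlap S u v v u
        + (overlap S v u u v + overlap S v u v u) := by
      unfold overlap
      simp only [← Finset.sum_add_distrib]
      refine Finset.sum_congr rfl fun x _ => ?_
      simp only [H, exchange, Equiv.coe_fn_mk]
      ring
    rw [e', e v u u v, e v u v u]
    ring
  linarith

/-- The overlap is the Hilbert–Schmidt inner product of the reduced density matrices `R f` and `R g`
on the coordinates in `S`, and `2 x y ≤ x² + y²` entry by entry. -/
theorem overlap_le (S : Fin k → Bool) (f g : (Fin k → X) → ℝ) :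
    overlap S f g f g ≤ (overlap S f f f f + overlap S g g g g) / 2 := by
  classical
  let e := Equiv.piEquivPiSubtypeProd (fun i => S i = true) fun _ : Fin k => X
  have he : ∀ a b a' b', mixing S (e.symm (a, b)) (e.symm (a', b')) = e.symm (a', b) := by
    intro a b a' b'
    funext i
    by_cases hi : S i = true <;> simp [mixing, e, Equiv.piEquivPiSubtypeProd, hi]
  let R (f : (Fin k → X) → ℝ) (a a' : {i // S i = true} → X) : ℝ :=
    ∑ b, f (e.symm (a, b)) * f (e.symm (a', b))
  have key : ∀ f g : (Fin k → X) → ℝ, overlap S f g f g = ∑ a, ∑ a', R f a a' * R g a a' := by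
    intro f g
    unfold overlap
    rw [Fintype.sum_prod_type, ← e.symm.sum_comp, Fintype.sum_prod_type]
    refine Finset.sum_congr rfl fun a _ => ?_
    have : ∀ b, ∑ q, f (e.symm (a, b)) * g q * (f (mixing S (e.symm (a, b)) q)
        * g (mixing S q (e.symm (a, b))))
        = ∑ a', ∑ b', f (e.symm (a, b)) * f (e.symm (a', b)) *
          (g (e.symm (a, b')) * g (e.symm (a', b'))) := by
      intro b
      rw [← e.symm.sum_comp, Fintype.sum_prod_type]
      refine Finset.sum_congr rfl fun a' _ => Finset.sum_congr rfl fun b' _ => ?_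
      rw [he, he]
      ring
    simp only [this]
    rw [Finset.sum_comm]
    refine Finset.sum_congr rfl fun a' _ => ?_
    simp only [R, Finset.sum_mul_sum]
  rw [key, key, key, ← Finset.sum_add_distrib, Finset.sum_div]
  refine Finset.sum_le_sum fun a _ => ?_
  rw [← Finset.sum_add_distrib, Finset.sum_div]
  refine Finset.sum_le_sum fun a' _ => ?_
  nlinarith [sq_nonneg (R f a a' - R g a a')]

/-- Cauchy–Schwarz for `f ⊗ f` and its image under a permutation of coordinates. -/
theorem overlap_self_le (S : Fin k → Bool) (f : (Fin k → X) → ℝ) :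
    overlap S f f f f ≤ (∑ p, f p ^ 2) ^ 2 := by
  let H (x : (Fin k → X) × (Fin k → X)) : ℝ := f x.1 * f x.2
  have h1 : ∑ x, H x * H (exchange S x) ≤ ∑ x, H x ^ 2 := by
    have := Finset.sum_nonneg fun x (_ : x ∈ univ) => sq_nonneg (H x - H (exchange S x))
    have e := Equiv.sum_comp (exchange (X := X) S) fun x => H x ^ 2
    simp only [sub_sq, Finset.sum_add_distrib, Finset.sum_sub_distrib, mul_assoc,
      ← Finset.mul_sum] at this
    linarith
  have h2 : ∑ x, H x ^ 2 = (∑ p, f p ^ 2) ^ 2 := by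
    rw [sq, Finset.sum_mul_sum, Fintype.sum_prod_type]
    simp only [H, mul_pow]
  rw [← h2]
  exact h1

/-- The sum of the overlaps over all choices of the coordinates that are exchanged. -/
def totalOverlap (f : (Fin k → X) → ℝ) : ℝ := ∑ S : Fin k → Bool, overlap S f f f f

theorem sum_cons {k : ℕ} {Y : Type} [Fintype Y] (F : (Fin (k + 1) → Y) → ℝ) :
    ∑ p, F p = ∑ x, ∑ p : Fin k → Y, F (Fin.cons x p) := by
  rw [← (Fin.consEquiv fun _ : Fin (k + 1) => Y).sum_comp, Fintype.sum_prod_type]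
  rfl

/-- The vector is sliced by its first coordinate. The first bit of `S` decides whether the two first
coordinates `a` and `b` are exchanged, which gives the two kinds of summands. -/
theorem totalOverlap_succ (f : (Fin (k + 1) → X) → ℝ) :
    let ψ : X → (Fin k → X) → ℝ := fun x p => f (Fin.cons x p)
    totalOverlap f = ∑ S : Fin k → Bool, ∑ a, ∑ b,
      (overlap S (ψ a) (ψ b) (ψ a) (ψ b) + overlap S (ψ a) (ψ b) (ψ b) (ψ a)) := by
  intro ψ
  have h : ∀ (b : Bool) (S : Fin k → Bool), overlap (Fin.cons b S : Fin (k + 1) → Bool) f f f f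
      = ∑ x, ∑ y, if b then overlap S (ψ x) (ψ y) (ψ y) (ψ x) else overlap S (ψ x) (ψ y) (ψ x) (ψ y) := by
    intro b S
    unfold overlap
    rw [Fintype.sum_prod_type, sum_cons]
    refine Finset.sum_congr rfl fun x _ => ?_
    simp only [sum_cons (Y := X) (k := k), mixing_cons]
    rw [Finset.sum_comm]
    refine Finset.sum_congr rfl fun y _ => ?_
    cases b <;> simp only [Bool.false_eq_true, if_false, if_true, Fintype.sum_prod_type] <;> rfl
  unfold totalOverlap
  rw [sum_cons]
  simp only [h, Fintype.sum_bool, if_true, Bool.false_eq_true, if_false]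
  rw [← Finset.sum_add_distrib]
  refine Finset.sum_congr rfl fun S _ => ?_
  rw [← Finset.sum_add_distrib]
  refine Finset.sum_congr rfl fun a _ => ?_
  rw [← Finset.sum_add_distrib]
  exact Finset.sum_congr rfl fun b _ => add_comm _ _

/-- The right side involves the family only through the kernel `∑ a, ψ a p * ψ a q`, so the left
side does not change when the family is rotated. -/
theorem sum_overlap_eq (S : Fin k → Bool) (ψ : X → (Fin k → X) → ℝ) :
    ∑ a, ∑ b, (overlap S (ψ a) (ψ b) (ψ a) (ψ b) + overlap S (ψ a) (ψ b) (ψ b) (ψ a))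
      = ∑ x : (Fin k → X) × (Fin k → X),
        ((∑ a, ψ a x.1 * ψ a (mixing S x.1 x.2)) * (∑ a, ψ a x.2 * ψ a (mixing S x.2 x.1))
        + (∑ a, ψ a x.1 * ψ a (mixing S x.2 x.1)) * (∑ a, ψ a x.2 * ψ a (mixing S x.1 x.2))) := by
  simp only [overlap, ← Finset.sum_add_distrib, Finset.sum_mul_sum]
  rw [Finset.sum_congr rfl fun a _ => Finset.sum_comm, Finset.sum_comm]
  exact Finset.sum_congr rfl fun x _ => Finset.sum_congr rfl fun a _ => Finset.sum_congr rfl fun b _ => by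
    ring

/-- Real vectors can be rotated such that they become orthogonal. -/
theorem exists_rotation {X Y : Type} [Fintype X] [Fintype Y] (ψ : X → Y → ℝ) :
    ∃ φ : X → Y → ℝ, (∀ a b, a ≠ b → ∑ p, φ a p * φ b p = 0) ∧
      (∀ p q, ∑ a, φ a p * φ a q = ∑ x, ψ x p * ψ x q) ∧
      ∃ U : X → X → ℝ, (∀ a, ∑ x, U x a ^ 2 = 1) ∧ ∀ a p, φ a p = ∑ x, U x a * ψ x p := by
  classical
  -- An orthogonal matrix that diagonalizes the Gram matrix of the family does it; the rotated
  -- family gives the Schmidt decomposition.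
  let G : Matrix X X ℝ := .of fun x y => ∑ p, ψ x p * ψ y p
  have hG : G.IsHermitian := by
    ext x y
    simp [G, mul_comm]
  let U : Matrix X X ℝ := hG.eigenvectorUnitary
  have hU : U * star U = 1 := Unitary.mul_star_self_of_mem hG.eigenvectorUnitary.2
  have hU' : star U * U = 1 := Unitary.star_mul_self_of_mem hG.eigenvectorUnitary.2
  have hd : star U * G * U = Matrix.diagonal hG.eigenvalues := by
    have := hG.conjStarAlgAut_star_eigenvectorUnitary
    simpa [Unitary.conjStarAlgAut_apply, U] using this
  refine ⟨fun a p => ∑ x, U x a * ψ x p, fun a b hab => ?_, fun p q => ?_, U, fun a => ?_, fun _ _ => rfl⟩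
  · have := congrFun (congrFun hd a) b
    rw [Matrix.diagonal_apply_ne _ hab] at this
    rw [← this]
    simp only [Matrix.mul_apply, Matrix.star_apply, star_trivial, G, Matrix.of_apply,
      Finset.sum_mul_sum]
    simp only [Finset.sum_mul, Finset.mul_sum]
    rw [Finset.sum_congr rfl fun p _ => Finset.sum_comm, Finset.sum_comm]
    refine Finset.sum_congr rfl fun y _ => ?_
    rw [Finset.sum_comm]
    exact Finset.sum_congr rfl fun x _ => Finset.sum_congr rfl fun p _ => by ring
  · have h1 : ∀ x y, ∑ a, U x a * U y a = if x = y then 1 else 0 := fun x y => by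
      have := congrFun (congrFun hU x) y
      simpa [Matrix.mul_apply, Matrix.one_apply] using this
    have h2 : ∑ a, (∑ x, U x a * ψ x p) * (∑ x, U x a * ψ x q)
        = ∑ x, ∑ y, (∑ a, U x a * U y a) * (ψ x p * ψ y q) := by
      simp only [Finset.sum_mul_sum]
      rw [Finset.sum_comm]
      refine Finset.sum_congr rfl fun x _ => ?_
      rw [Finset.sum_comm]
      refine Finset.sum_congr rfl fun y _ => ?_
      rw [Finset.sum_mul]
      exact Finset.sum_congr rfl fun a _ => by ring
    rw [h2]
    simp [h1]
  · have := congrFun (congrFun hU' a) a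
    simpa [Matrix.mul_apply, sq] using this

/-- Induction on `k`. After a rotation the slices `φ a` along the first coordinate are orthogonal,
with squared norms `N a` that add up to `‖f‖²`. A pair `a ≠ b` contributes at most `N a * N b` for
each `S`. A diagonal pair contributes `2 totalOverlap (φ a)`, which by induction is at most `2 ^ k
(N a ^ 2 + B * N a)`. Together this is `2 ^ k ((∑ N)² + B ∑ N)`. -/
theorem totalOverlap_le (f : (Fin k → X) → ℝ) {B : ℝ}
    (hB : ∀ π : Fin k → X → ℝ, (∀ i, ∑ x, π i x ^ 2 = 1) → (∑ p, f p * ∏ i, π i (p i)) ^ 2 ≤ B) :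
    totalOverlap f ≤ 2 ^ k * (((∑ p, f p ^ 2) ^ 2 + B * ∑ p, f p ^ 2) / 2) := by
  induction k with
  | zero =>
    -- Without coordinates `f` is a scalar and its overlap with the empty product is `f` itself, so
    -- `B` is at least its square.
    have h := hB (fun _ _ => 0) (fun i => i.elim0)
    simp only [Finset.univ_unique, Finset.sum_singleton, Finset.prod_empty, mul_one,
      Finset.univ_eq_empty] at h
    have e : ∀ S : Fin 0 → Bool, mixing S (default : Fin 0 → X) default = default :=
      fun S => Subsingleton.elim _ _
    simp only [totalOverlap, overlap, Fintype.sum_prod_type, Finset.univ_unique,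
      Finset.sum_singleton, e]
    nlinarith [sq_nonneg (f default)]
  | succ k ih =>
    obtain ⟨φ, hφ, hK, U, hU, hφU⟩ := exists_rotation fun x p => f (Fin.cons x p)
    let N (a : X) : ℝ := ∑ p, φ a p ^ 2
    have hN : ∑ p, f p ^ 2 = ∑ a, N a := by
      rw [sum_cons, Finset.sum_comm]
      simp only [N]
      rw [Finset.sum_comm (f := fun a p => φ a p ^ 2)]
      refine Finset.sum_congr rfl fun p _ => ?_
      simpa only [sq] using (hK p p).symm
    have hN0 : ∀ a, 0 ≤ N a := fun a => Finset.sum_nonneg fun _ _ => sq_nonneg _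
    have hdiag : ∀ a, totalOverlap (φ a) ≤ 2 ^ k * ((N a ^ 2 + B * N a) / 2) := by
      intro a
      refine ih (φ a) fun π hπ => ?_
      -- A product vector for the slice `φ a` extends, by the unit column `a` of the rotation, to a
      -- product vector for `f` with the same inner product; hence the slice inherits `B`.
      have := hB (Fin.cons (fun x => U x a) π) (Fin.cases (hU a) hπ)
      rw [sum_cons] at this
      convert this using 2
      rw [Finset.sum_comm]
      refine Finset.sum_congr rfl fun p _ => ?_
      simp only [hφU, Fin.prod_univ_succ, Fin.cons_zero, Fin.cons_succ, Finset.sum_mul]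
      exact Finset.sum_congr rfl fun x _ => by ring
    have hexp : totalOverlap f = ∑ S : Fin k → Bool, ∑ a, ∑ b,
        (overlap S (φ a) (φ b) (φ a) (φ b) + overlap S (φ a) (φ b) (φ b) (φ a)) := by
      rw [totalOverlap_succ]
      simp only [sum_overlap_eq, hK]
    have hS : ∀ S : Fin k → Bool, ∑ a, ∑ b,
        (overlap S (φ a) (φ b) (φ a) (φ b) + overlap S (φ a) (φ b) (φ b) (φ a))
        ≤ ∑ a, (2 * overlap S (φ a) (φ a) (φ a) (φ a) - N a ^ 2) + (∑ a, N a) ^ 2 := by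
      classical
      intro S
      have : (∑ a, N a) ^ 2 = ∑ a, ∑ b, N a * N b := by rw [sq, Finset.sum_mul_sum]
      rw [this, ← Finset.sum_add_distrib]
      refine Finset.sum_le_sum fun a _ => ?_
      rw [← Finset.add_sum_erase _ _ (Finset.mem_univ a),
        ← Finset.add_sum_erase _ (fun b => N a * N b) (Finset.mem_univ a)]
      have := Finset.sum_le_sum fun b (hb : b ∈ univ.erase a) =>
        overlap_add_overlap_le S (φ a) (φ b) (hφ a b (Finset.ne_of_mem_erase hb).symm)
      simp only [N] at this ⊢
      linarith
    calc totalOverlap f ≤ ∑ S : Fin k → Bool,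
          (∑ a, (2 * overlap S (φ a) (φ a) (φ a) (φ a) - N a ^ 2) + (∑ a, N a) ^ 2) := by
          rw [hexp]
          exact Finset.sum_le_sum fun S _ => hS S
      _ = ∑ a, (2 * totalOverlap (φ a) - 2 ^ k * N a ^ 2) + 2 ^ k * (∑ a, N a) ^ 2 := by
          rw [Finset.sum_add_distrib, Finset.sum_comm]
          simp [totalOverlap, Finset.sum_sub_distrib, Finset.mul_sum]
      _ ≤ ∑ a, 2 ^ k * (B * N a) + 2 ^ k * (∑ a, N a) ^ 2 := by
          gcongr with a
          have := hdiag a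
          linarith
      _ = _ := by
          rw [hN, ← Finset.mul_sum, ← Finset.mul_sum]
          ring

end SwapTest

end

/-! ### Soundness of the test -/

section

open StoqGate

namespace StoqCircuit

variable (C : StoqCircuit)

theorem echo_echo (z : C.Basis) : C.echo (C.echo z) = z := by
  refine (C.eq_echo ?_).symm
  rw [run_echo]
  exact ((flipAt C.output).left_inv _).symm

/-- The acceptance probabilities of states with a large overlap are close to each other. -/
theorem sq_acceptProb_sub_le {ψ π : (Fin C.numWitness → Bool) → ℝ} (hψ : ∑ u, ψ u ^ 2 = 1)
    (hπ : ∑ u, π u ^ 2 = 1) :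
    (C.acceptProb ψ - C.acceptProb π) ^ 2 ≤ 1 - (∑ u, ψ u * π u) ^ 2 := by
  let M (f g : (Fin C.numWitness → Bool) → ℝ) : ℝ :=
    ∑ z, C.initialState f z * C.initialState g (C.echo z)
  have hM : ∀ f g, M f g = M g f := by
    intro f g
    simp only [M]
    rw [← Equiv.sum_comp C.echo]
    exact Finset.sum_congr rfl fun z _ => by rw [echo_echo, mul_comm]
  have hsub : ∀ z, C.initialState (fun u => ψ u - π u) z = C.initialState ψ z - C.initialState π z := by
    intro z
    unfold initialState
    split_ifs <;> ring
  have hadd : ∀ z, C.initialState (fun u => ψ u + π u) z = C.initialState ψ z + C.initialState π z := by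
    intro z
    unfold initialState
    split_ifs <;> ring
  -- The echo is an involution, so `M` is symmetric and the difference of its two values factorizes.
  -- With overlap `o`, Cauchy–Schwarz then gives `(2 - 2 o)(2 + 2 o) = 4 (1 - o²)`, and the factor
  -- `1 / 2` in the acceptance probability removes the 4.
  have h1 : M (fun u => ψ u - π u) (fun u => ψ u + π u) = M ψ ψ - M π π := by
    have : M (fun u => ψ u - π u) (fun u => ψ u + π u) = M ψ ψ - M π π + (M ψ π - M π ψ) := by
      simp only [M, hsub, hadd, ← Finset.sum_add_distrib, ← Finset.sum_sub_distrib]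
      exact Finset.sum_congr rfl fun z _ => by ring
    rw [this, hM ψ π, sub_self, add_zero]
  have h2 : M (fun u => ψ u - π u) (fun u => ψ u + π u) ^ 2
      ≤ (∑ u, (ψ u - π u) ^ 2) * ∑ u, (ψ u + π u) ^ 2 := by
    rw [← C.sum_initialState_sq, ← C.sum_initialState_sq,
      ← Equiv.sum_comp C.echo fun z => C.initialState (fun u => ψ u + π u) z ^ 2]
    exact Finset.sum_mul_sq_le_sq_mul_sq _ _ _
  have h3 : ∑ u, (ψ u - π u) ^ 2 = 2 - 2 * ∑ u, ψ u * π u := by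
    simp only [sub_sq, Finset.sum_add_distrib, Finset.sum_sub_distrib, mul_assoc, ← Finset.mul_sum,
      hψ, hπ]
    ring
  have h4 : ∑ u, (ψ u + π u) ^ 2 = 2 + 2 * ∑ u, ψ u * π u := by
    simp only [add_sq, Finset.sum_add_distrib, mul_assoc, ← Finset.mul_sum, hψ, hπ]
    ring
  rw [h1, h3, h4] at h2
  rw [C.acceptProb_eq_sum hψ, C.acceptProb_eq_sum hπ]
  change (1 / 2 + 1 / 2 * M ψ ψ - (1 / 2 + 1 / 2 * M π π)) ^ 2 ≤ _
  nlinarith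

end StoqCircuit

namespace SwapTest

variable {W k ℓ : ℕ} (h : W = k * ℓ)

/-- A string is the same as the list of its blocks. -/
def blocks : (Fin k → Fin ℓ → Bool) ≃ (Fin W → Bool) where
  toFun p j := p (blk h j) (finProdFinEquiv.symm (Fin.cast h j)).2
  invFun u i t := u (pos h i t)
  left_inv p := by
    funext i t
    simp [pos, blk]
  right_inv u := by
    funext j
    simp only [pos, blk, Prod.mk.eta, Equiv.apply_symm_apply]
    rfl

theorem mix_blocks (S : Fin k → Bool) (p q : Fin k → Fin ℓ → Bool) :
    mix h S (blocks h p) (blocks h q) = blocks h (mixing S p q) := by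
  funext j
  simp only [mix, blocks, Equiv.coe_fn_mk, mixing]
  cases S (blk h j) <;> rfl

theorem productWitness_blocks (ψ : Fin k → (Fin ℓ → Bool) → ℝ) (p : Fin k → Fin ℓ → Bool) :
    productWitness h ψ (blocks h p) = ∏ i, ψ i (p i) := by
  refine Finset.prod_congr rfl fun i _ => congrArg (ψ i) ?_
  exact congrFun ((blocks h).left_inv p) i

theorem sum_blocks (f : (Fin W → Bool) → ℝ) : ∑ u, f u = ∑ p, f (blocks h p) :=
  (Equiv.sum_comp (blocks h) f).symm

theorem isNonnegState_productWitness {ψ : Fin k → (Fin ℓ → Bool) → ℝ} (hψ : ∀ i, IsNonnegState (ψ i)) :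
    IsNonnegState (productWitness h ψ) := by
  refine ⟨fun u => Finset.prod_nonneg fun i _ => (hψ i).1 _, ?_⟩
  rw [sum_blocks h]
  simp only [productWitness_blocks, ← Finset.prod_pow]
  have := Finset.prod_univ_sum (fun _ : Fin k => (Finset.univ : Finset (Fin ℓ → Bool)))
    (fun i x => ψ i x ^ 2)
  rw [Fintype.piFinset_univ] at this
  rw [← this]
  exact Finset.prod_eq_one fun i _ => (hψ i).2

theorem swapOverlap_eq (ψ₀ ψ₁ : (Fin W → Bool) → ℝ) :
    swapOverlap h ψ₀ ψ₁ = (1 / 2) ^ k * ∑ S : Fin k → Bool,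
      overlap S (ψ₀ ∘ blocks h) (ψ₁ ∘ blocks h) (ψ₀ ∘ blocks h) (ψ₁ ∘ blocks h) := by
  unfold swapOverlap overlap
  congr 1
  refine Finset.sum_congr rfl fun S _ => ?_
  rw [sum_blocks h, Fintype.sum_prod_type]
  refine Finset.sum_congr rfl fun p _ => ?_
  rw [sum_blocks h]
  refine Finset.sum_congr rfl fun q _ => ?_
  simp only [mix_blocks, Function.comp_apply]

theorem swapOverlap_le (ψ₀ ψ₁ : (Fin W → Bool) → ℝ) :
    swapOverlap h ψ₀ ψ₁ ≤ (1 / 2) ^ k *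
      ((totalOverlap (ψ₀ ∘ blocks h) + totalOverlap (ψ₁ ∘ blocks h)) / 2) := by
  rw [swapOverlap_eq]
  gcongr
  unfold totalOverlap
  rw [← Finset.sum_add_distrib, Finset.sum_div]
  exact Finset.sum_le_sum fun S _ => overlap_le S _ _

theorem totalOverlap_blocks_le {ψ : (Fin W → Bool) → ℝ} (hψ : ∑ u, ψ u ^ 2 = 1) :
    totalOverlap (ψ ∘ blocks h) ≤ 2 ^ k := by
  have : ∑ p, (ψ ∘ blocks h) p ^ 2 = 1 := by rw [← hψ, sum_blocks h]; rfl
  refine (Finset.sum_le_sum fun S _ => overlap_self_le S _).trans ?_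
  simp only [this]
  simp

/-- Exchanging blocks between two copies of a product state only permutes equal factors, so every
choice of blocks has overlap 1. -/
theorem swapOverlap_productWitness {ψ : Fin k → (Fin ℓ → Bool) → ℝ} (hψ : ∀ i, IsNonnegState (ψ i)) :
    swapOverlap h (productWitness h ψ) (productWitness h ψ) = 1 := by
  have h1 := (isNonnegState_productWitness h hψ).2
  rw [sum_blocks h] at h1
  have h2 : ∀ (S : Fin k → Bool) p q, productWitness h ψ (blocks h (mixing S p q))
      * productWitness h ψ (blocks h (mixing S q p))
      = productWitness h ψ (blocks h p) * productWitness h ψ (blocks h q) := by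
    intro S p q
    simp only [productWitness_blocks, ← Finset.prod_mul_distrib]
    refine Finset.prod_congr rfl fun i _ => ?_
    simp only [mixing]
    cases S i
    · rfl
    · exact mul_comm _ _
  have h3 : ∀ S : Fin k → Bool, overlap S (productWitness h ψ ∘ blocks h) (productWitness h ψ ∘ blocks h)
      (productWitness h ψ ∘ blocks h) (productWitness h ψ ∘ blocks h) = 1 := by
    intro S
    simp only [overlap, Function.comp_apply, h2, Fintype.sum_prod_type]
    have : ∀ a b : ℝ, a * b * (a * b) = a ^ 2 * b ^ 2 := fun a b => by ring
    simp only [this, ← Finset.mul_sum, h1, mul_one]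
  rw [swapOverlap_eq]
  simp [h3]

/-- If a circuit accepts no product state with a probability greater than `s`, but accepts `ψ₀`
with probability at least `s + y`, then `ψ₀` is far from all product states. -/
theorem swapOverlap_le_of_sound (V : StoqCircuit) (h : V.numWitness = k * ℓ) {s y : ℝ} (hy : 0 ≤ y)
    (hs : ∀ ψ : Fin k → (Fin ℓ → Bool) → ℝ, (∀ i, IsNonnegState (ψ i)) →
      V.acceptProb (productWitness h ψ) ≤ s)
    {ψ₀ ψ₁ : (Fin V.numWitness → Bool) → ℝ} (h₀ : IsNonnegState ψ₀) (h₁ : IsNonnegState ψ₁)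
    (hv : s + y ≤ V.acceptProb ψ₀) : swapOverlap h ψ₀ ψ₁ ≤ 1 - y ^ 2 / 4 := by
  have e0 : ∑ p, (ψ₀ ∘ blocks h) p ^ 2 = 1 := by rw [← h₀.2, sum_blocks h]; rfl
  have h1 : totalOverlap (ψ₀ ∘ blocks h) ≤ 2 ^ k * ((1 ^ 2 + (1 - y ^ 2) * 1) / 2) := by
    have := totalOverlap_le (ψ₀ ∘ blocks h) (B := 1 - y ^ 2) fun π hπ => ?_
    · rwa [e0] at this
    -- Soundness speaks of non-negative states only. Absolute values preserve the norm and, since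
    -- `ψ₀` is non-negative, do not decrease the absolute value of the overlap.
    have hπ' : ∀ i, IsNonnegState fun x => |π i x| := fun i =>
      ⟨fun _ => abs_nonneg _, by simpa [sq_abs] using hπ i⟩
    have h2 := V.sq_acceptProb_sub_le h₀.2 (isNonnegState_productWitness h hπ').2
    have h3 := hs _ hπ'
    have h4 : (∑ p, (ψ₀ ∘ blocks h) p * ∏ i, π i (p i)) ^ 2
        ≤ (∑ u, ψ₀ u * productWitness h (fun i x => |π i x|) u) ^ 2 := by
      rw [sq_le_sq, sum_blocks h]
      refine le_trans ?_ (le_abs_self _)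
      refine (Finset.abs_sum_le_sum_abs _ _).trans (Finset.sum_le_sum fun p _ => ?_)
      rw [abs_mul, Finset.abs_prod, productWitness_blocks]
      exact le_of_eq (by rw [Function.comp_apply, abs_of_nonneg (h₀.1 _)])
    have h5 : y ^ 2 ≤ (V.acceptProb ψ₀ - V.acceptProb (productWitness h fun i x => |π i x|)) ^ 2 :=
      pow_le_pow_left₀ hy (by linarith) 2
    linarith
  have h2 := totalOverlap_blocks_le h h₁.2
  have h3 : (1 / 2 : ℝ) ^ k * 2 ^ k = 1 := by rw [← mul_pow]; norm_num
  calc swapOverlap h ψ₀ ψ₁ ≤ (1 / 2) ^ k * ((2 ^ k * ((1 ^ 2 + (1 - y ^ 2) * 1) / 2) + 2 ^ k) / 2) := by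
        refine (swapOverlap_le h ψ₀ ψ₁).trans ?_
        gcongr
    _ = ((1 / 2) ^ k * 2 ^ k) * (1 - y ^ 2 / 4) := by ring
    _ = _ := by rw [h3, one_mul]

theorem swapOverlap_le_one {ψ₀ ψ₁ : (Fin W → Bool) → ℝ} (h₀ : ∑ u, ψ₀ u ^ 2 = 1)
    (h₁ : ∑ u, ψ₁ u ^ 2 = 1) : swapOverlap h ψ₀ ψ₁ ≤ 1 := by
  have h3 : (1 / 2 : ℝ) ^ k * 2 ^ k = 1 := by rw [← mul_pow]; norm_num
  calc swapOverlap h ψ₀ ψ₁ ≤ (1 / 2) ^ k * ((2 ^ k + 2 ^ k) / 2) := by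
        refine (swapOverlap_le h ψ₀ ψ₁).trans ?_
        have := totalOverlap_blocks_le h h₀
        have := totalOverlap_blocks_le h h₁
        gcongr
    _ = (1 / 2) ^ k * 2 ^ k := by ring
    _ = 1 := h3

/-- The trade-off between the two tests of the verifier. -/
theorem mixture_le {p lam ε Δ v F : ℝ} (hΔ : 0 ≤ Δ) (hε : 0 ≤ ε) (hs : ε + Δ ≤ 1 / 2)
    (hlam : lam ≤ Δ / 12) (hp : 0 ≤ p) (hpl : p ≤ lam) (hlp : lam - lam * Δ / 2 ≤ p) (hF : F ≤ 1)
    (hF' : ∀ y, 0 ≤ y → 1 - ε - Δ + y ≤ v → F ≤ 1 - y ^ 2 / 4) :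
    p * v + (1 - p) * (1 / 2 + 1 / 2 * F) ≤ 1 - lam * ε - lam * Δ / 2 := by
  have h1 : p ≤ 1 / 24 := by linarith
  have h2 : (lam - lam * Δ / 2) * (ε + Δ) ≤ p * (ε + Δ) := by gcongr
  have h3 : 0 ≤ lam * Δ := mul_nonneg (hp.trans hpl) hΔ
  have h4 : lam * Δ * (ε + Δ) ≤ lam * Δ * (1 / 2) := by gcongr
  rcases le_total (1 - ε - Δ) v with hv | hv
  · have h5 := hF' (v - (1 - ε - Δ)) (by linarith) (by linarith)
    set y := v - (1 - ε - Δ) with hy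
    have h6 : (1 - p) * (1 / 2 + 1 / 2 * F) ≤ (1 - p) * (1 - y ^ 2 / 8) := by
      refine mul_le_mul_of_nonneg_left (by linarith) (by linarith)
    -- Since `p ≤ 1 / 24`, the loss is at least `23 y² / 192`; then `p y - 23 y² / 192` is maximal
    -- at `y = 96 p / 23`, with value `48 p² / 23`.
    have h7 : p * y - (1 - p) * (y ^ 2 / 8) ≤ 48 / 23 * p ^ 2 := by
      nlinarith [sq_nonneg (y - 96 / 23 * p), mul_nonneg (show (0 : ℝ) ≤ 1 / 24 - p by linarith) (sq_nonneg y)]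
    have h8 : p ^ 2 ≤ lam * Δ / 12 := by nlinarith
    have h9 : v = 1 - ε - Δ + y := by rw [hy]; ring
    rw [h9]
    -- Rounding `p` down costs at most `λ Δ / 4` and the trade-off `4 λ Δ / 23`; together this is
    -- less than the available `λ Δ / 2`.
    nlinarith
  · have h6 : (1 - p) * (1 / 2 + 1 / 2 * F) ≤ (1 - p) * 1 :=
      mul_le_mul_of_nonneg_left (by linarith) (by linarith)
    have h7 : p * v ≤ p * (1 - ε - Δ) := by gcongr
    nlinarith

end SwapTest

end

/-! ### Completeness and soundness in terms of two proofs -/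

section

open StoqGate

namespace SwapTest

variable (V : StoqCircuit) {k ℓ : ℕ} (h : V.numWitness = k * ℓ)

include h in
theorem numWitness_verifier (t : ℕ → Bool) (m : ℕ) : (verifier V t m h).numWitness = 2 * (k * ℓ) := by
  change V.numWitness + V.numWitness = _
  omega

theorem isNonnegState_cast {a b : ℕ} (h : a = b) {ψ : (Fin b → Bool) → ℝ} (hψ : IsNonnegState ψ) :
    IsNonnegState fun w : Fin a → Bool => ψ fun j => w (Fin.cast h.symm j) := by
  subst h
  exact hψ

theorem productWitness_two (t : ℕ → Bool) (m : ℕ) (h' : (verifier V t m h).numWitness = 2 * (k * ℓ))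
    (ψ : Fin 2 → (Fin (k * ℓ) → Bool) → ℝ) :
    productWitness h' ψ = fun u => (fun w : Fin V.numWitness → Bool => ψ 0 fun j => w (Fin.cast h.symm j))
        (fun j => u (Fin.castAdd _ j)) *
      (fun w : Fin V.numWitness → Bool => ψ 1 fun j => w (Fin.cast h.symm j))
        (fun j => u (Fin.natAdd _ j)) := by
  funext u
  refine (Fin.prod_univ_two _).trans ?_
  refine congrArg₂ (· * ·) (congrArg (ψ 0) (funext fun j => congrArg u (Fin.ext ?_)))
    (congrArg (ψ 1) (funext fun j => congrArg u (Fin.ext ?_)))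
  · simp
  · simp [h]

theorem acceptProb_verifier_of_yes (t : ℕ → Bool) (m : ℕ)
    {p c : ℝ} (hp : p = ((∑ j ∈ Finset.range m, (t j).toNat * 2 ^ j : ℕ) : ℝ) / 2 ^ m)
    {ψ : Fin k → (Fin ℓ → Bool) → ℝ} (hψ : ∀ i, IsNonnegState (ψ i))
    (hc : c ≤ V.acceptProb (productWitness h ψ)) (h' : (verifier V t m h).numWitness = 2 * (k * ℓ)) :
    ∃ φ : Fin 2 → (Fin (k * ℓ) → Bool) → ℝ, (∀ i, IsNonnegState (φ i)) ∧
      p * c + (1 - p) ≤ (verifier V t m h).acceptProb (productWitness h' φ) := by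
  -- The honest prover sends the tensor product of the `k` proofs twice.
  refine ⟨fun _ => productWitness rfl ψ, fun _ => isNonnegState_productWitness rfl hψ, ?_⟩
  have e : (fun w : Fin V.numWitness → Bool => productWitness rfl ψ fun j => w (Fin.cast h.symm j))
      = productWitness h ψ := rfl
  have h1 := (isNonnegState_productWitness h hψ).2
  have hp0 : 0 ≤ p := hp ▸ by positivity
  rw [productWitness_two V h, e, acceptProb_verifier V t m h h1 h1 hp, swapOverlap_productWitness h hψ]
  have := mul_le_mul_of_nonneg_left hc hp0
  linarith

theorem acceptProb_verifier_of_no (t : ℕ → Bool) (m : ℕ)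
    {p lam ε Δ : ℝ} (hp : p = ((∑ j ∈ Finset.range m, (t j).toNat * 2 ^ j : ℕ) : ℝ) / 2 ^ m)
    (hΔ : 0 ≤ Δ) (hε : 0 ≤ ε) (hεΔ : ε + Δ ≤ 1 / 2)
    (hlam : lam ≤ Δ / 12) (hpl : p ≤ lam) (hlp : lam - lam * Δ / 2 ≤ p)
    (hs : ∀ ψ : Fin k → (Fin ℓ → Bool) → ℝ, (∀ i, IsNonnegState (ψ i)) →
      V.acceptProb (productWitness h ψ) ≤ 1 - ε - Δ)
    (h' : (verifier V t m h).numWitness = 2 * (k * ℓ))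
    {φ : Fin 2 → (Fin (k * ℓ) → Bool) → ℝ} (hφ : ∀ i, IsNonnegState (φ i)) :
    (verifier V t m h).acceptProb (productWitness h' φ) ≤ 1 - lam * ε - lam * Δ / 2 := by
  have hp0 : 0 ≤ p := hp ▸ by positivity
  have h0 := isNonnegState_cast h (hφ 0)
  have h1 := isNonnegState_cast h (hφ 1)
  rw [productWitness_two V h, acceptProb_verifier V t m h h0.2 h1.2 hp]
  exact mixture_le hΔ hε hεΔ hlam hp0 hpl hlp (swapOverlap_le_one h h0.2 h1.2) fun y hy hv =>
    swapOverlap_le_of_sound V h hy hs h0 h1 hv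

end SwapTest

end

/-! ### Circuits that ignore additional proofs -/

section

open StoqGate

namespace StoqCircuit

variable (V : StoqCircuit) (E : ℕ)

/-- The wires of a circuit to whose witness further qubits have been appended. -/
def padWire (j : Fin (V.numWitness + V.numZero + V.numPlus)) :
    Fin (V.numWitness + E + V.numZero + V.numPlus) :=
  Fin.addCases (fun j => Fin.castAdd _ (Fin.addCases (fun j => Fin.castAdd _ (Fin.castAdd _ j))
    (fun j => Fin.natAdd _ j) j)) (fun j => Fin.natAdd _ j) j

theorem val_padWire (j : Fin (V.numWitness + V.numZero + V.numPlus)) :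
    (V.padWire E j : ℕ) = if (j : ℕ) < V.numWitness then (j : ℕ) else j + E := by
  refine SwapTest.forall_wire V (p := fun j => (V.padWire E j : ℕ) =
    if (j : ℕ) < V.numWitness then (j : ℕ) else j + E) (fun i => ?_) (fun i => ?_) (fun i => ?_) j
  · simp [padWire]
  · simp [padWire]; omega
  · have : ¬ (V.numWitness + V.numZero + i < V.numWitness) := by omega
    simp [padWire, this]; omega

theorem padWire_injective : Function.Injective (V.padWire E) := by
  intro i j hij
  have := congrArg Fin.val hij
  rw [val_padWire, val_padWire] at this
  exact Fin.ext (by split_ifs at this <;> omega)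

/-- The same circuit with further witness qubits, which it ignores. -/
def pad : StoqCircuit where
  numWitness := V.numWitness + E
  numZero := V.numZero
  numPlus := V.numPlus
  gates := V.gates.map (StoqGate.map (V.padWire E))
  valid g hg := by
    obtain ⟨g', hg', rfl⟩ := List.mem_map.1 hg
    exact (V.valid g' hg').map (V.padWire_injective E)
  output := V.padWire E V.output

theorem padWire_ne (j : Fin (V.numWitness + V.numZero + V.numPlus)) (e : Fin E) :
    V.padWire E j ≠ Fin.castAdd _ (Fin.castAdd _ (Fin.natAdd _ e)) := by
  intro h
  have := congrArg Fin.val h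
  rw [val_padWire] at this
  simp at this
  split_ifs at this <;> omega

/-- The basis string with the given values on the original wires and on the new ones. -/
def padBasis (y : V.Basis) (e : Fin E → Bool) : (V.pad E).Basis :=
  Fin.append (Fin.append (Fin.append (fun j => y (Fin.castAdd _ (Fin.castAdd _ j))) e)
    (fun j => y (Fin.castAdd _ (Fin.natAdd _ j)))) (fun j => y (Fin.natAdd _ j))

theorem padBasis_comp (y : V.Basis) (e : Fin E → Bool) : V.padBasis E y e ∘ V.padWire E = y := by
  funext j
  have h : ∀ j, Fin.append (Fin.append (Fin.append (fun j => y (Fin.castAdd _ (Fin.castAdd _ j))) e)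
    (fun j => y (Fin.castAdd _ (Fin.natAdd _ j)))) (fun j => y (Fin.natAdd _ j)) (V.padWire E j) = y j :=
    SwapTest.forall_wire V (fun i => by simp [padWire]) (fun i => by simp [padWire])
      fun i => by simp [padWire]
  exact h j

theorem eq_padBasis {z : (V.pad E).Basis} {e : Fin E → Bool}
    (h : ∀ j, z (Fin.castAdd _ (Fin.castAdd _ (Fin.natAdd _ j))) = e j) :
    z = V.padBasis E (z ∘ V.padWire E) e := by
  have key : ∀ z : Fin (V.numWitness + E + V.numZero + V.numPlus) → Bool,
      (∀ j, z (Fin.castAdd _ (Fin.castAdd _ (Fin.natAdd _ j))) = e j) → ∀ j,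
      z j = Fin.append (Fin.append (Fin.append (fun j => (z ∘ V.padWire E) (Fin.castAdd _ (Fin.castAdd _ j))) e)
        (fun j => (z ∘ V.padWire E) (Fin.castAdd _ (Fin.natAdd _ j))))
        (fun j => (z ∘ V.padWire E) (Fin.natAdd _ j)) j := by
    intro z h j
    refine Fin.addCases (fun j => Fin.addCases (fun j => Fin.addCases (fun j => ?_) (fun j => ?_) j)
      (fun j => ?_) j) (fun j => ?_) j
    · simp [padWire]
    · simp [padWire]
    · simp [padWire]
    · simp only [Fin.append_left, Fin.append_right, h]
  exact funext (key z h)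

/-- No relabelled gate touches a new wire, and on the old wires the run is the original one. -/
theorem run_pad (y : V.Basis) (e : Fin E → Bool) :
    run (V.pad E).gates (V.padBasis E y e) = V.padBasis E (run V.gates y) e := by
  have h1 := V.eq_padBasis E (z := run (V.pad E).gates (V.padBasis E y e)) (e := e) fun j => by
    refine (run_map_of_notMem V.gates _ ?_).trans ?_
    · rintro ⟨i, hi⟩
      exact V.padWire_ne E i j hi
    · exact (Fin.append_left _ _ _).trans ((Fin.append_left _ _ _).trans (Fin.append_right _ _ _))
  rw [h1]
  congr 1
  exact (run_map_comp (V.padWire_injective E) V.gates _).trans 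
    (congrArg (run V.gates) (V.padBasis_comp E y e))

theorem flipAt_pad (y : V.Basis) (e : Fin E → Bool) :
    flipAt (V.pad E).output (V.padBasis E y e) = V.padBasis E (flipAt V.output y) e := by
  have h1 := V.eq_padBasis E (z := flipAt (V.pad E).output (V.padBasis E y e)) (e := e) fun j => by
    refine (Function.update_of_ne (fun h => V.padWire_ne E _ j h.symm) _ _).trans ?_
    exact (Fin.append_left _ _ _).trans ((Fin.append_left _ _ _).trans (Fin.append_right _ _ _))
  rw [h1]
  congr 1
  refine (Function.update_comp_eq_of_injective _ (V.padWire_injective E) _ _).trans ?_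
  have h2 := V.padBasis_comp E y e
  exact congrArg₂ (fun y' b => Function.update y' V.output (!b)) h2 (congrFun h2 V.output)

theorem echo_pad (y : V.Basis) (e : Fin E → Bool) :
    (V.pad E).echo (V.padBasis E y e) = V.padBasis E (V.echo y) e := by
  refine ((V.pad E).eq_echo ?_).symm
  rw [run_pad, run_pad, flipAt_pad, V.run_echo]

/-- The echo leaves the new qubits alone, so summing over them yields the factor `∑ e, χ e ^ 2 = 1`.
-/
theorem acceptProb_pad {ψ : (Fin V.numWitness → Bool) → ℝ} {χ : (Fin E → Bool) → ℝ}
    (hψ : ∑ u, ψ u ^ 2 = 1) (hχ : ∑ e, χ e ^ 2 = 1) :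
    (V.pad E).acceptProb (fun u => ψ (fun j => u (Fin.castAdd _ j)) * χ (fun j => u (Fin.natAdd _ j)))
      = V.acceptProb ψ := by
  set φ : (Fin (V.pad E).numWitness → Bool) → ℝ :=
    fun u => ψ (fun j => u (Fin.castAdd _ j)) * χ (fun j => u (Fin.natAdd _ j)) with hφ
  have hφ1 : ∑ u, φ u ^ 2 = 1 := by
    refine (SwapTest.sum_append (a := V.numWitness) (b := E) _).trans ?_
    simp only [hφ, Fin.append_left, Fin.append_right, mul_pow, ← Finset.mul_sum]
    rw [hχ]
    simpa using hψ
  have hamp : ∀ y e, (V.pad E).amplitude φ (V.padBasis E y e) = V.amplitude ψ y * χ e := by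
    intro y e
    have hz : ∀ j, V.padBasis E y e (Fin.castAdd (V.pad E).numPlus (Fin.natAdd (V.pad E).numWitness j))
        = y (Fin.castAdd _ (Fin.natAdd _ j)) := fun j =>
      (Fin.append_left _ _ _).trans (Fin.append_right _ _ _)
    by_cases hy : ∀ j, y (Fin.castAdd V.numPlus (Fin.natAdd V.numWitness j)) = false
    · rw [V.amplitude_of_zero ψ hy, (V.pad E).amplitude_of_zero φ fun j => (hz j).trans (hy j)]
      refine congrArg₂ (· * ·) (congrArg ψ (funext fun j => ?_)) (congrArg χ (funext fun j => ?_))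
      · exact (Fin.append_left _ _ _).trans ((Fin.append_left _ _ _).trans (Fin.append_left _ _ _))
      · exact (Fin.append_left _ _ _).trans ((Fin.append_left _ _ _).trans (Fin.append_right _ _ _))
    · rw [V.amplitude_of_ne_zero ψ hy, zero_mul]
      exact (V.pad E).amplitude_of_ne_zero φ fun H => hy fun j => (hz j).symm.trans (H j)
  have hstart : ∀ u e r, (V.pad E).start (Fin.append u e) r = V.padBasis E (V.start u r) e := by
    intro u e r
    have h : ∀ r : Fin V.numPlus → Bool,
        Fin.append (Fin.append (Fin.append u e) fun _ : Fin V.numZero => false) r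
        = Fin.append (Fin.append (Fin.append
          (fun j => V.start u r (Fin.castAdd _ (Fin.castAdd _ j))) e)
          (fun j => V.start u r (Fin.castAdd _ (Fin.natAdd _ j)))) (fun j => V.start u r (Fin.natAdd _ j)) := by
      intro r
      simp only [start, Fin.append_left, Fin.append_right]
    exact h r
  rw [StoqCircuit.acceptProb_eq _ hφ1, StoqCircuit.acceptProb_eq _ hψ]
  congr 3
  refine (SwapTest.sum_append (a := V.numWitness) (b := E) _).trans ?_
  refine Finset.sum_congr rfl fun u _ => ?_
  have e1 : ∀ e r, φ (Fin.append u e) * (V.pad E).amplitude φ ((V.pad E).echo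
      ((V.pad E).start (Fin.append u e) r)) = ψ u * V.amplitude ψ (V.echo (V.start u r)) * χ e ^ 2 := by
    intro e r
    have e2 : φ (Fin.append u e) = ψ u * χ e := by
      simp only [hφ, Fin.append_left, Fin.append_right]
    rw [hstart, echo_pad, hamp, e2]
    ring
  rw [Finset.sum_congr rfl fun e _ => Finset.sum_congr rfl fun r _ => e1 e r, Finset.sum_comm]
  refine Finset.sum_congr rfl fun r _ => ?_
  rw [← Finset.mul_sum, hχ, mul_one]

variable {V} {ℓ : ℕ}

theorem productWitness_pad {k : ℕ} (h : V.numWitness = 2 * ℓ)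
    (h' : (V.pad (k * ℓ)).numWitness = (2 + k) * ℓ) (φ : Fin (2 + k) → (Fin ℓ → Bool) → ℝ) :
    productWitness h' φ = fun u => productWitness h (fun i => φ (Fin.castAdd k i))
        (fun j => u (Fin.castAdd _ j)) *
      productWitness rfl (fun i => φ (Fin.natAdd 2 i)) (fun j => u (Fin.natAdd _ j)) := by
  funext u
  refine (Fin.prod_univ_add _).trans (congrArg₂ (· * ·) ?_ ?_)
  · refine Finset.prod_congr rfl fun i _ => congrArg _ (funext fun t => congrArg u (Fin.ext ?_))
    simp
  · refine Finset.prod_congr rfl fun i _ => congrArg _ (funext fun t => congrArg u (Fin.ext ?_))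
    simp [h]
    ring

theorem numWitness_pad {k : ℕ} (hk : 2 ≤ k) (h : V.numWitness = 2 * ℓ) :
    (V.pad ((k - 2) * ℓ)).numWitness = k * ℓ := by
  obtain ⟨k, rfl⟩ := Nat.exists_eq_add_of_le hk
  change V.numWitness + _ = _
  rw [h, Nat.add_sub_cancel_left]
  ring

/-- The ignored proofs are copies of `ψ 0`. The sizes are given by equations so that they can be
substituted, which avoids casts between index types. -/
theorem acceptProb_pad_of_yes {k k' E : ℕ} (hk : k = 2 + k') (hE : E = k' * ℓ)
    (h : V.numWitness = 2 * ℓ) {c : ℝ} (h' : (V.pad E).numWitness = k * ℓ)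
    {ψ : Fin 2 → (Fin ℓ → Bool) → ℝ} (hψ : ∀ i, IsNonnegState (ψ i))
    (hc : c ≤ V.acceptProb (productWitness h ψ)) :
    ∃ φ : Fin k → (Fin ℓ → Bool) → ℝ, (∀ i, IsNonnegState (φ i)) ∧
      c ≤ (V.pad E).acceptProb (productWitness h' φ) := by
  subst hk hE
  let φ : Fin (2 + k') → (Fin ℓ → Bool) → ℝ := Fin.addCases ψ fun _ => ψ 0
  have hφ1 : (fun i => φ (Fin.castAdd k' i)) = ψ := by funext i; simp [φ]
  have hφ2 : (fun i => φ (Fin.natAdd 2 i)) = fun _ => ψ 0 := by funext i; simp [φ]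
  refine ⟨φ, ?_, ?_⟩
  · refine Fin.addCases (fun i => ?_) fun i => ?_
    · rw [show φ (Fin.castAdd k' i) = ψ i from congrFun hφ1 i]
      exact hψ i
    · rw [show φ (Fin.natAdd 2 i) = ψ 0 from congrFun hφ2 i]
      exact hψ 0
  · rw [productWitness_pad h, hφ1, hφ2, acceptProb_pad]
    · exact hc
    · exact (SwapTest.isNonnegState_productWitness h hψ).2
    · exact (SwapTest.isNonnegState_productWitness rfl fun _ => hψ 0).2

theorem acceptProb_pad_of_no {k k' E : ℕ} (hk : k = 2 + k') (hE : E = k' * ℓ)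
    (h : V.numWitness = 2 * ℓ) {s : ℝ} (h' : (V.pad E).numWitness = k * ℓ)
    (hs : ∀ ψ : Fin 2 → (Fin ℓ → Bool) → ℝ, (∀ i, IsNonnegState (ψ i)) →
      V.acceptProb (productWitness h ψ) ≤ s)
    {φ : Fin k → (Fin ℓ → Bool) → ℝ} (hφ : ∀ i, IsNonnegState (φ i)) :
    (V.pad E).acceptProb (productWitness h' φ) ≤ s := by
  subst hk hE
  rw [productWitness_pad h, acceptProb_pad]
  · exact hs _ fun i => hφ _
  · exact (SwapTest.isNonnegState_productWitness h fun i => hφ _).2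
  · exact (SwapTest.isNonnegState_productWitness rfl fun i => hφ _).2

end StoqCircuit

end

/-! ### Reading and renumbering descriptions of circuits -/

section

open Turing Computability Enc StoqGate

instance : Finite CircuitSymbol :=
  Finite.of_surjective (fun i : Fin 5 => match i with
    | 0 => CircuitSymbol.tick | 1 => .sep | 2 => .x | 3 => .cnot | 4 => .toffoli) fun a => by
    cases a
    exacts [⟨0, rfl⟩, ⟨1, rfl⟩, ⟨2, rfl⟩, ⟨3, rfl⟩, ⟨4, rfl⟩]

noncomputable instance : Letter CircuitSymbol where
  toFintype := Fintype.ofFinite _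

noncomputable instance : Enc StoqCircuit := ⟨CircuitSymbol, StoqCircuit.encode⟩

/-- The description of a gate whose wires are natural numbers. -/
def StoqGate.write : StoqGate ℕ → List CircuitSymbol
  | .x t => .x :: CircuitSymbol.unary t
  | .cnot a t => .cnot :: (CircuitSymbol.unary a ++ CircuitSymbol.unary t)
  | .toffoli a b t =>
      .toffoli :: (CircuitSymbol.unary a ++ CircuitSymbol.unary b ++ CircuitSymbol.unary t)

theorem StoqGate.encode_eq {n : ℕ} (g : StoqGate (Fin n)) : g.encode = (g.map Fin.val).write := by
  cases g <;> rfl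

theorem StoqGate.map_map {ι κ μ : Type} (f : ι → κ) (f' : κ → μ) (g : StoqGate ι) :
    (g.map f).map f' = g.map (f' ∘ f) := by
  cases g <;> rfl

namespace StoqCircuit

/-- The description of the gates of a circuit. -/
def body (C : StoqCircuit) : List CircuitSymbol := C.gates.flatMap StoqGate.encode

theorem encode_eq (C : StoqCircuit) : C.encode = CircuitSymbol.unary C.numWitness ++
    (CircuitSymbol.unary C.numZero ++ (CircuitSymbol.unary C.numPlus ++
      (CircuitSymbol.unary C.output ++ C.body))) := by
  simp [encode, body]

/-- A transducer that treats the parts of the description of a circuit in different ways. -/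
def phaseStep {B : Type} (emit : Fin 5 → CircuitSymbol → List B) (q : Fin 5) (a : CircuitSymbol) :
    Fin 5 × List B :=
  (match q, a with
    | 0, .sep => 1
    | 1, .sep => 2
    | 2, .sep => 3
    | 3, .sep => 4
    | q, _ => q, emit q a)

theorem transduce_phaseStep_unary {B : Type} (emit : Fin 5 → CircuitSymbol → List B) (q : Fin 5) (n : ℕ)
    (l : List CircuitSymbol) (fin : Fin 5 → List B) :
    transduce (phaseStep emit) fin q (CircuitSymbol.unary n ++ l)
      = (List.replicate n ()).flatMap (fun _ => emit q .tick) ++ (emit q .sep ++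
        transduce (phaseStep emit) fin (phaseStep emit q .sep).1 l) := by
  unfold CircuitSymbol.unary
  rw [List.append_assoc]
  induction n with
  | zero => rfl
  | succ n ih =>
    rw [List.replicate_succ, List.cons_append, List.replicate_succ, List.flatMap_cons,
      List.append_assoc, ← ih]
    have : (phaseStep emit q .tick).1 = q := by fin_cases q <;> rfl
    conv_lhs => rw [transduce, this]
    rfl

theorem transduce_phaseStep_last {B : Type} (emit : Fin 5 → CircuitSymbol → List B)
    (l : List CircuitSymbol) :
    transduce (phaseStep emit) (fun _ => []) 4 l = l.flatMap (emit 4) := by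
  induction l with
  | nil => rfl
  | cons a l ih =>
    rw [List.flatMap_cons, ← ih]
    have : (phaseStep emit 4 a).1 = 4 := by cases a <;> rfl
    conv_lhs => rw [transduce, this]
    rfl

theorem transduce_phaseStep {B : Type} (emit : Fin 5 → CircuitSymbol → List B) (C : StoqCircuit) :
    transduce (phaseStep emit) (fun _ => []) 0 C.encode
      = (List.replicate C.numWitness ()).flatMap (fun _ => emit 0 .tick) ++ (emit 0 .sep ++
        ((List.replicate C.numZero ()).flatMap (fun _ => emit 1 .tick) ++ (emit 1 .sep ++
        ((List.replicate C.numPlus ()).flatMap (fun _ => emit 2 .tick) ++ (emit 2 .sep ++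
        ((List.replicate C.output ()).flatMap (fun _ => emit 3 .tick) ++ (emit 3 .sep ++
        C.body.flatMap (emit 4)))))))) := by
  rw [encode_eq, transduce_phaseStep_unary]
  change _ ++ (_ ++ transduce (phaseStep emit) _ 1 _) = _
  rw [transduce_phaseStep_unary]
  change _ ++ (_ ++ (_ ++ (_ ++ transduce (phaseStep emit) _ 2 _))) = _
  rw [transduce_phaseStep_unary]
  change _ ++ (_ ++ (_ ++ (_ ++ (_ ++ (_ ++ transduce (phaseStep emit) _ 3 _))))) = _
  rw [transduce_phaseStep_unary]
  change _ ++ (_ ++ (_ ++ (_ ++ (_ ++ (_ ++ (_ ++ (_ ++ transduce (phaseStep emit) _ 4 _))))))) = _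
  rw [transduce_phaseStep_last]

end StoqCircuit

namespace PT

variable {α : Type} [Enc α]

/-- The ticks of one part of the header. -/
def headerEmit (i : Fin 5) (q : Fin 5) : CircuitSymbol → List Bool
  | .tick => if q = i then [true] else []
  | _ => []

theorem of_header (i : Fin 5) {g : StoqCircuit → ℕ}
    (h : ∀ C : StoqCircuit, List.replicate (g C) true
      = transduce (StoqCircuit.phaseStep (headerEmit i)) (fun _ => []) 0 C.encode)
    {f : α → StoqCircuit} (hf : PT f) : PT fun a => g (f a) := by
  have : PT g := of_transduce (StoqCircuit.phaseStep (headerEmit i)) (fun _ => []) 0 fun C => by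
    rw [enc_nat]
    exact h C
  exact this.comp hf

theorem flatMap_replicate_unit {B : Type} (n : ℕ) (b : B) :
    (List.replicate n ()).flatMap (fun _ => [b]) = List.replicate n b := by
  rw [← List.map_eq_flatMap, List.map_replicate]

variable {f : α → StoqCircuit}

theorem flatMap_headerEmit {i : Fin 5} (hi : i ≠ 4) (l : List CircuitSymbol) :
    l.flatMap (headerEmit i 4) = [] := by
  rw [List.flatMap_eq_nil_iff]
  intro a _
  cases a <;> simp [headerEmit, hi.symm]

theorem flatMap_nil {A B : Type} (l : List A) : (l.flatMap fun _ => ([] : List B)) = [] := by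
  rw [List.flatMap_eq_nil_iff]
  exact fun _ _ => rfl

@[fun_prop] theorem numWitness (hf : PT f) : PT fun a => (f a).numWitness :=
  of_header 0 (g := fun C => C.numWitness) (fun C => by
    rw [StoqCircuit.transduce_phaseStep, flatMap_headerEmit (by decide)]
    simp [headerEmit, flatMap_replicate_unit, flatMap_nil]) hf

@[fun_prop] theorem numZero (hf : PT f) : PT fun a => (f a).numZero :=
  of_header 1 (g := fun C => C.numZero) (fun C => by
    rw [StoqCircuit.transduce_phaseStep, flatMap_headerEmit (by decide)]
    simp [headerEmit, flatMap_replicate_unit, flatMap_nil]) hf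

@[fun_prop] theorem numPlus (hf : PT f) : PT fun a => (f a).numPlus :=
  of_header 2 (g := fun C => C.numPlus) (fun C => by
    rw [StoqCircuit.transduce_phaseStep, flatMap_headerEmit (by decide)]
    simp [headerEmit, flatMap_replicate_unit, flatMap_nil]) hf

@[fun_prop] theorem output (hf : PT f) : PT fun a => ((f a).output : ℕ) :=
  of_header 3 (g := fun C => C.output) (fun C => by
    rw [StoqCircuit.transduce_phaseStep, flatMap_headerEmit (by decide)]
    simp [headerEmit, flatMap_replicate_unit, flatMap_nil]) hf

@[fun_prop] theorem body (hf : PT f) : PT fun a => (f a).body := by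
  have : PT StoqCircuit.body := of_transduce (α := StoqCircuit) (β := List CircuitSymbol)
    (StoqCircuit.phaseStep fun q a => if q = 4 then [a] else [])
    (fun _ => []) 0 fun C => by
      refine Eq.trans ?_ (StoqCircuit.transduce_phaseStep _ C).symm
      simp [flatMap_nil]
      rfl
  exact this.comp hf

@[fun_prop] theorem unary {n : α → ℕ} (hn : PT n) : PT fun a => CircuitSymbol.unary (n a) := by
  unfold CircuitSymbol.unary
  fun_prop

@[fun_prop] theorem write_cnot {a b : α → ℕ} (ha : PT a) (hb : PT b) :
    PT fun x => (StoqGate.cnot (a x) (b x)).write := by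
  unfold StoqGate.write
  fun_prop

@[fun_prop] theorem write_toffoli {a b c : α → ℕ} (ha : PT a) (hb : PT b) (hc : PT c) :
    PT fun x => (StoqGate.toffoli (a x) (b x) (c x)).write := by
  unfold StoqGate.write
  fun_prop

theorem of_encode (h : PT fun a => (f a).encode) : PT f := by
  obtain ⟨T⟩ := h
  exact ⟨{ T with outputsFun := T.outputsFun }⟩

@[fun_prop] theorem encode (hf : PT f) : PT fun a => (f a).encode := by
  obtain ⟨T⟩ := hf
  exact ⟨{ T with outputsFun := T.outputsFun }⟩

end PT

/-- Make room for `b` wires before the wire `a`. -/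
def shiftWire (a b i : ℕ) : ℕ := if i < a then i else i + b

/-- Renumber the wires in the description of gates, symbol by symbol; the state consists of the
number of ticks that have been read and of the output. -/
def renumberStep (a b : ℕ) (s : ℕ × List CircuitSymbol) (c : CircuitSymbol) : ℕ × List CircuitSymbol :=
  if (match c with | .tick => true | _ => false) then (s.1 + 1, s.2)
  else if (match c with | .sep => true | _ => false) then
    (0, s.2 ++ CircuitSymbol.unary (shiftWire a b s.1))
  else (s.1, s.2 ++ [c])

/-- Renumber the wires in the description of gates. -/
def renumber (a b : ℕ) (l : List CircuitSymbol) : List CircuitSymbol :=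
  (l.foldl (renumberStep a b) (0, [])).2

theorem foldl_renumberStep_unary (a b n i : ℕ) (o l : List CircuitSymbol) :
    (CircuitSymbol.unary n ++ l).foldl (renumberStep a b) (i, o)
      = l.foldl (renumberStep a b) (0, o ++ CircuitSymbol.unary (shiftWire a b (i + n))) := by
  unfold CircuitSymbol.unary
  rw [List.append_assoc]
  induction n generalizing i with
  | zero => rfl
  | succ n ih =>
    rw [List.replicate_succ, List.cons_append, List.foldl_cons]
    change List.foldl _ (i + 1, o) _ = _
    rw [ih, show i + 1 + n = i + (n + 1) by ring]

/-- The separator comes directly after the ticks of a wire, so the counter holds the complete number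
when the new one is written; the names of gates are copied. -/
theorem renumber_flatMap_write (a b : ℕ) (L : List (StoqGate ℕ)) :
    renumber a b (L.flatMap StoqGate.write) = (L.map (StoqGate.map (shiftWire a b))).flatMap StoqGate.write := by
  have key : ∀ o, (L.flatMap StoqGate.write).foldl (renumberStep a b) (0, o)
      = (0, o ++ (L.map (StoqGate.map (shiftWire a b))).flatMap StoqGate.write) := by
    induction L with
    | nil => simp
    | cons g L ih =>
      intro o
      cases g with
      | x t =>
        simp only [List.flatMap_cons, write, List.cons_append, List.foldl_cons]
        change List.foldl _ (0, o ++ [_]) _ = _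
        simp only [foldl_renumberStep_unary, ih]
        simp [StoqGate.map, write]
      | cnot c t =>
        simp only [List.flatMap_cons, write, List.cons_append, List.foldl_cons, List.append_assoc]
        change List.foldl _ (0, o ++ [_]) _ = _
        simp only [foldl_renumberStep_unary, ih]
        simp [StoqGate.map, write]
      | toffoli c d t =>
        simp only [List.flatMap_cons, write, List.cons_append, List.foldl_cons, List.append_assoc]
        change List.foldl _ (0, o ++ [_]) _ = _
        simp only [foldl_renumberStep_unary, ih]
        simp [StoqGate.map, write]
  simp [renumber, key]

/-- A fold needs a size bound for its state. The counter never exceeds its initial value plus the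
number of symbols read, so each symbol adds at most that number plus `b + 1` to the output. -/
theorem foldl_renumberStep_le (a b : ℕ) (l : List CircuitSymbol) (s : ℕ × List CircuitSymbol) :
    (l.foldl (renumberStep a b) s).1 ≤ s.1 + l.length ∧
      (l.foldl (renumberStep a b) s).2.length ≤ s.2.length + l.length * (s.1 + l.length + b + 1) := by
  induction l generalizing s with
  | nil => simp
  | cons c l ih =>
    obtain ⟨h1, h2⟩ := ih (renumberStep a b s c)
    rw [List.foldl_cons]
    have h3 : (renumberStep a b s c).1 ≤ s.1 + 1 := by
      cases c <;> simp [renumberStep]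
    have h4 : (renumberStep a b s c).2.length ≤ s.2.length + (s.1 + b + 1) := by
      cases c <;> simp [renumberStep, CircuitSymbol.unary, shiftWire]
      split_ifs <;> omega
    refine ⟨by rw [List.length_cons]; omega, ?_⟩
    rw [List.length_cons]
    nlinarith

namespace PT

variable {α : Type} [Enc α]

@[fun_prop] theorem shiftWire {a b i : α → ℕ} (ha : PT a) (hb : PT b) (hi : PT i) :
    PT fun x => shiftWire (a x) (b x) (i x) := by
  unfold _root_.shiftWire
  fun_prop

@[fun_prop] theorem renumber {a b : α → ℕ} {l : α → List CircuitSymbol} (ha : PT a) (hb : PT b)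
    (hl : PT l) : PT fun x => renumber (a x) (b x) (l x) := by
  have hs : PT fun x : α × (ℕ × List CircuitSymbol) × CircuitSymbol =>
      renumberStep (a x.1) (b x.1) x.2.1 x.2.2 := by
    unfold renumberStep
    exact if_bool (letter (A := CircuitSymbol) (fun c => match c with | .tick => true | _ => false) (by fun_prop))
      (by fun_prop)
      (if_bool (letter (A := CircuitSymbol) (fun c => match c with | .sep => true | _ => false) (by fun_prop))
        (by fun_prop) (by fun_prop))
  obtain ⟨q, hq⟩ := hl.len.add (hl.len.mul ((hl.len.add hb.polyBounded).add (.const 1)))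
  refine PT.snd (foldl (init := fun _ => ((0 : ℕ), ([] : List CircuitSymbol)))
    (step := fun x => renumberStep (a x.1) (b x.1) x.2.1 x.2.2) (by fun_prop) hl hs q fun c l' hl' => ?_)
  have h1 := foldl_renumberStep_le (a c) (b c) l' (0, [])
  have h2 := hl'.length_le
  refine le_trans ?_ (hq c)
  simp only [List.length_nil, zero_add] at h1
  simp only [len_prod, len_nat, len_list]
  change (l'.foldl (renumberStep (a c) (b c)) (0, [])).1 +
    (l'.foldl (renumberStep (a c) (b c)) (0, [])).2.length ≤ _
  have h3 : l'.length * (l'.length + b c + 1) ≤ (l c).length * ((l c).length + b c + 1) :=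
    Nat.mul_le_mul h2 (by omega)
  omega

end PT

end

/-! ### Writing down the verifier -/

section

open Turing Computability Enc StoqGate

namespace StoqCircuit

theorem body_eq (C : StoqCircuit) :
    C.body = (C.gates.map (StoqGate.map Fin.val)).flatMap StoqGate.write := by
  rw [body, List.flatMap_map]
  exact congrArg₂ _ (funext fun g => g.encode_eq) rfl

theorem body_pad (V : StoqCircuit) (E : ℕ) : (V.pad E).body = renumber V.numWitness E V.body := by
  rw [body_eq, body_eq, renumber_flatMap_write, pad]
  simp only [List.map_map]
  refine congrArg (fun f => (V.gates.map f).flatMap write) (funext fun g => ?_)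
  simp only [Function.comp_apply, StoqGate.map_map]
  exact congrArg (fun f => g.map f) (funext fun j => V.val_padWire E j)

end StoqCircuit

namespace SwapTest

/-- The gates `coinGates` in terms of the numbers of the wires. -/
def coinRow (t : Bool) (coin cmp cmp' : ℕ) : List (StoqGate ℕ) :=
  .toffoli coin cmp cmp' :: if t then [.cnot coin cmp', .cnot cmp cmp'] else []

/-- The gates `permGates` in terms of the numbers of the wires. -/
def permRow (cmp choice perm : ℕ) : List (StoqGate ℕ) :=
  [.toffoli cmp choice perm, .cnot choice perm]

/-- The gates `swapGates` in terms of the numbers of the wires. -/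
def swapRow (ctrl perm tmp fst snd : ℕ) : List (StoqGate ℕ) :=
  [.toffoli ctrl perm tmp, .cnot snd fst, .toffoli tmp fst snd, .cnot snd fst,
    .toffoli ctrl perm tmp]

theorem flatMap_finRange_val {A : Type} (n : ℕ) (f : ℕ → List A) :
    (List.finRange n).flatMap (fun i : Fin n => f i) = (List.range n).flatMap f := by
  rw [← List.map_coe_finRange_eq_range, List.flatMap_map]

variable (W Z P k m : ℕ)

/-- The number of a wire. -/
def wireNumber (w : Wire W Z P k m) : ℕ := numbering W Z P k m w

theorem map_coinGates (t : ℕ → Bool) : (coinGates t).map (StoqGate.map (wireNumber W Z P k m))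
    = (List.range m).flatMap fun j => coinRow (t j)
      (W + W + ((1 + (m + 1)) + (k + Z)) + (P + (1 + j))) (W + W + (1 + j)) (W + W + (1 + (j + 1))) := by
  rw [coinGates, List.map_flatMap, ← flatMap_finRange_val]
  refine congrArg₂ _ (funext fun j => ?_) rfl
  unfold coinRow
  cases t j <;> rfl

theorem map_permGates : permGates.map (StoqGate.map (wireNumber W Z P k m))
    = (List.range k).flatMap fun i => permRow (W + W + (1 + m))
      (W + W + ((1 + (m + 1)) + (k + Z)) + (P + ((1 + m) + i))) (W + W + ((1 + (m + 1)) + i)) := by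
  rw [permGates, List.map_flatMap, ← flatMap_finRange_val]
  rfl

theorem map_swapGates {ℓ : ℕ} (h : W = k * ℓ) :
    (swapGates h).map (StoqGate.map (wireNumber W Z P k m))
    = (List.range k).flatMap fun i => (List.range ℓ).flatMap fun t =>
      swapRow (W + W + ((1 + (m + 1)) + (k + Z)) + P) (W + W + ((1 + (m + 1)) + i)) (W + W)
        (t + ℓ * i) (W + (t + ℓ * i)) := by
  rw [swapGates, List.map_flatMap, ← flatMap_finRange_val]
  refine congrArg₂ _ (funext fun i => ?_) rfl
  rw [List.map_flatMap, ← flatMap_finRange_val]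
  rfl

/-- The second proof and all new zeros are placed directly behind the first proof, and the new
ancillas in `|+⟩` at the very end. So the zeros and the ancillas in `|+⟩` of `V` are shifted by the
same amount, and `renumber` applies. -/
theorem wireNumber_emb (V : StoqCircuit) (j : Fin (V.numWitness + V.numZero + V.numPlus)) :
    wireNumber V.numWitness V.numZero V.numPlus k m (emb V j)
      = shiftWire V.numWitness (V.numWitness + (1 + (m + 1)) + k) j := by
  refine forall_wire V (p := fun j => wireNumber V.numWitness V.numZero V.numPlus k m (emb V j)
    = shiftWire V.numWitness (V.numWitness + (1 + (m + 1)) + k) j) (fun j => ?_) (fun j => ?_)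
    (fun j => ?_) j
  · rw [emb_castAdd_castAdd]
    simp [wireNumber, numbering, shiftWire]
  · rw [emb_castAdd_natAdd]
    simp [wireNumber, numbering, shiftWire]
    omega
  · rw [emb_natAdd]
    have : ¬ (V.numWitness + V.numZero + j < V.numWitness) := by omega
    simp [wireNumber, numbering, shiftWire, this]
    omega

variable {k}

theorem body_verifier (V : StoqCircuit) {ℓ : ℕ} (t : ℕ → Bool) (h : V.numWitness = k * ℓ) :
    (verifier V t m h).body =
      ((List.range m).flatMap fun j => coinRow (t j)
        (V.numWitness + V.numWitness + ((1 + (m + 1)) + (k + V.numZero)) + (V.numPlus + (1 + j)))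
        (V.numWitness + V.numWitness + (1 + j)) (V.numWitness + V.numWitness + (1 + (j + 1)))).flatMap
          write ++
      (((List.range k).flatMap fun i => permRow (V.numWitness + V.numWitness + (1 + m))
        (V.numWitness + V.numWitness + ((1 + (m + 1)) + (k + V.numZero)) + (V.numPlus + ((1 + m) + i)))
        (V.numWitness + V.numWitness + ((1 + (m + 1)) + i))).flatMap write ++
      (((List.range k).flatMap fun i => (List.range ℓ).flatMap fun t =>
        swapRow (V.numWitness + V.numWitness + ((1 + (m + 1)) + (k + V.numZero)) + V.numPlus)
          (V.numWitness + V.numWitness + ((1 + (m + 1)) + i)) (V.numWitness + V.numWitness)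
          (t + ℓ * i) (V.numWitness + (t + ℓ * i))).flatMap write ++
      (renumber V.numWitness (V.numWitness + (1 + (m + 1)) + k) V.body ++
      (StoqGate.toffoli (V.numWitness + V.numWitness + ((1 + (m + 1)) + (k + V.numZero)) + V.numPlus)
        (V.numWitness + V.numWitness + (1 + m))
        (shiftWire V.numWitness (V.numWitness + (1 + (m + 1)) + k) V.output)).write))) := by
  have e : ∀ L : List (StoqGate (Wire V.numWitness V.numZero V.numPlus k m)),
      (L.map (StoqGate.map (numbering _ _ _ _ _))).map (StoqGate.map Fin.val)
        = L.map (StoqGate.map (wireNumber _ _ _ _ _)) := fun L => by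
    rw [List.map_map]
    exact List.map_congr_left fun g _ => StoqGate.map_map _ _ g
  rw [StoqCircuit.body_eq, StoqCircuit.body_eq, renumber_flatMap_write]
  refine (congrArg (List.flatMap write) (e (gates V t m h))).trans ?_
  rw [gates, List.map_append, List.map_append, List.map_append, List.map_append, map_coinGates,
    map_permGates, map_swapGates, List.map_map, List.map_map, List.flatMap_append,
    List.flatMap_append, List.flatMap_append, List.flatMap_append, List.append_assoc,
    List.append_assoc, List.append_assoc]
  refine congrArg₂ _ rfl (congrArg₂ _ rfl (congrArg₂ _ rfl (congrArg₂ _ ?_ ?_)))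
  · refine congrArg (fun f => (V.gates.map f).flatMap write) (funext fun g => ?_)
    simp only [Function.comp_apply, StoqGate.map_map]
    exact congrArg (fun f => g.map f) (funext fun j => wireNumber_emb k m V j)
  · rw [List.map_singleton, List.flatMap_singleton, StoqGate.map, wireNumber_emb]
    rfl

theorem encode_verifier (V : StoqCircuit) {ℓ : ℕ} (t : ℕ → Bool) (h : V.numWitness = k * ℓ) :
    (verifier V t m h).encode = CircuitSymbol.unary (V.numWitness + V.numWitness) ++
      (CircuitSymbol.unary ((1 + (m + 1)) + (k + V.numZero)) ++
      (CircuitSymbol.unary (V.numPlus + ((1 + m) + k)) ++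
      (CircuitSymbol.unary (V.numWitness + V.numWitness + ((1 + (m + 1)) + (k + V.numZero)) + V.numPlus) ++
        (verifier V t m h).body))) :=
  StoqCircuit.encode_eq _

end SwapTest

namespace PT

variable {α : Type} [Enc α]

theorem pad {V : α → StoqCircuit} {E : α → ℕ} (hV : PT V) (hE : PT E) : PT fun a => (V a).pad (E a) := by
  refine of_encode ?_
  have e : ∀ a, ((V a).pad (E a)).encode = CircuitSymbol.unary ((V a).numWitness + E a) ++
    (CircuitSymbol.unary (V a).numZero ++ (CircuitSymbol.unary (V a).numPlus ++
      (CircuitSymbol.unary (_root_.shiftWire (V a).numWitness (E a) (V a).output) ++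
        _root_.renumber (V a).numWitness (E a) (V a).body))) := fun a => by
    rw [StoqCircuit.encode_eq, StoqCircuit.body_pad]
    simp only [StoqCircuit.pad, StoqCircuit.val_padWire]
    rfl
  simp only [e]
  fun_prop

@[fun_prop] theorem write_coinRow {t : α → Bool} {a b c : α → ℕ} (ht : PT t) (ha : PT a) (hb : PT b)
    (hc : PT c) : PT fun x => (SwapTest.coinRow (t x) (a x) (b x) (c x)).flatMap write := by
  have e : ∀ x, (SwapTest.coinRow (t x) (a x) (b x) (c x)).flatMap write
      = (StoqGate.toffoli (a x) (b x) (c x)).write ++ if t x then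
        (StoqGate.cnot (a x) (c x)).write ++ (StoqGate.cnot (b x) (c x)).write else [] := fun x => by
    unfold SwapTest.coinRow
    cases t x <;> simp
  simp only [e]
  exact append (by fun_prop) (if_bool ht (by fun_prop) (by fun_prop))

@[fun_prop] theorem write_permRow {a b c : α → ℕ} (ha : PT a) (hb : PT b)
    (hc : PT c) : PT fun x => (SwapTest.permRow (a x) (b x) (c x)).flatMap write := by
  simp only [SwapTest.permRow, List.flatMap_cons, List.flatMap_nil]
  fun_prop

@[fun_prop] theorem write_swapRow {a b c d e : α → ℕ} (ha : PT a) (hb : PT b)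
    (hc : PT c) (hd : PT d) (he : PT e) :
    PT fun x => (SwapTest.swapRow (a x) (b x) (c x) (d x) (e x)).flatMap write := by
  simp only [SwapTest.swapRow, List.flatMap_cons, List.flatMap_nil]
  fun_prop

/-- The verifier for two proofs can be written down in polynomial time. -/
theorem verifier {V V₀ : α → StoqCircuit} {k ℓ m : α → ℕ} {T : α → List Bool} (hV : PT V)
    (hV₀ : PT V₀) (hk : PT k) (hℓ : PT ℓ) (hm : PT m) (hT : PT T) :
    PT fun a => if h : (V a).numWitness = k a * ℓ a then
      SwapTest.verifier (V a) (fun j => ((T a).drop j).headD false) (m a) h else V₀ a := by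
  refine of_encode ?_
  -- This text makes sense without a proof that the witness has the right length, so the dependent
  -- case distinction turns into a choice between two words.
  let text (a : α) : List CircuitSymbol :=
    CircuitSymbol.unary ((V a).numWitness + (V a).numWitness) ++
    (CircuitSymbol.unary ((1 + (m a + 1)) + (k a + (V a).numZero)) ++
    (CircuitSymbol.unary ((V a).numPlus + ((1 + m a) + k a)) ++
    (CircuitSymbol.unary ((V a).numWitness + (V a).numWitness +
      ((1 + (m a + 1)) + (k a + (V a).numZero)) + (V a).numPlus) ++
    (((List.range (m a)).flatMap fun j => (SwapTest.coinRow (((T a).drop j).headD false)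
      ((V a).numWitness + (V a).numWitness + ((1 + (m a + 1)) + (k a + (V a).numZero)) +
        ((V a).numPlus + (1 + j)))
      ((V a).numWitness + (V a).numWitness + (1 + j))
      ((V a).numWitness + (V a).numWitness + (1 + (j + 1)))).flatMap write) ++
    (((List.range (k a)).flatMap fun i => (SwapTest.permRow
      ((V a).numWitness + (V a).numWitness + (1 + m a))
      ((V a).numWitness + (V a).numWitness + ((1 + (m a + 1)) + (k a + (V a).numZero)) +
        ((V a).numPlus + ((1 + m a) + i)))
      ((V a).numWitness + (V a).numWitness + ((1 + (m a + 1)) + i))).flatMap write) ++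
    (((List.range (k a)).flatMap fun i => (List.range (ℓ a)).flatMap fun t => (SwapTest.swapRow
      ((V a).numWitness + (V a).numWitness + ((1 + (m a + 1)) + (k a + (V a).numZero)) + (V a).numPlus)
      ((V a).numWitness + (V a).numWitness + ((1 + (m a + 1)) + i))
      ((V a).numWitness + (V a).numWitness) (t + ℓ a * i)
      ((V a).numWitness + (t + ℓ a * i))).flatMap write) ++
    (_root_.renumber (V a).numWitness ((V a).numWitness + (1 + (m a + 1)) + k a) (V a).body ++
    (StoqGate.toffoli
      ((V a).numWitness + (V a).numWitness + ((1 + (m a + 1)) + (k a + (V a).numZero)) + (V a).numPlus)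
      ((V a).numWitness + (V a).numWitness + (1 + m a))
      (_root_.shiftWire (V a).numWitness ((V a).numWitness + (1 + (m a + 1)) + k a)
        (V a).output)).write)))))))
  have h1 : PT fun a => (List.range (m a)).flatMap fun j =>
      (SwapTest.coinRow (((T a).drop j).headD false)
      ((V a).numWitness + (V a).numWitness + ((1 + (m a + 1)) + (k a + (V a).numZero)) +
        ((V a).numPlus + (1 + j)))
      ((V a).numWitness + (V a).numWitness + (1 + j))
      ((V a).numWitness + (V a).numWitness + (1 + (j + 1)))).flatMap write :=
    flatMap_range hm (by fun_prop)
  have h2 : PT fun a => (List.range (k a)).flatMap fun i => (SwapTest.permRow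
      ((V a).numWitness + (V a).numWitness + (1 + m a))
      ((V a).numWitness + (V a).numWitness + ((1 + (m a + 1)) + (k a + (V a).numZero)) +
        ((V a).numPlus + ((1 + m a) + i)))
      ((V a).numWitness + (V a).numWitness + ((1 + (m a + 1)) + i))).flatMap write :=
    flatMap_range hk (by fun_prop)
  have h3 : PT fun a => (List.range (k a)).flatMap fun i => (List.range (ℓ a)).flatMap fun t =>
      (SwapTest.swapRow
      ((V a).numWitness + (V a).numWitness + ((1 + (m a + 1)) + (k a + (V a).numZero)) + (V a).numPlus)
      ((V a).numWitness + (V a).numWitness + ((1 + (m a + 1)) + i))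
      ((V a).numWitness + (V a).numWitness) (t + ℓ a * i)
      ((V a).numWitness + (t + ℓ a * i))).flatMap write :=
    flatMap_range hk (flatMap_range (n := fun x : α × ℕ => ℓ x.1) (g := fun x t =>
      (SwapTest.swapRow ((V x.1).numWitness + (V x.1).numWitness +
        ((1 + (m x.1 + 1)) + (k x.1 + (V x.1).numZero)) + (V x.1).numPlus)
      ((V x.1).numWitness + (V x.1).numWitness + ((1 + (m x.1 + 1)) + x.2))
      ((V x.1).numWitness + (V x.1).numWitness) (t + ℓ x.1 * x.2)
      ((V x.1).numWitness + (t + ℓ x.1 * x.2))).flatMap write) (by fun_prop) (by fun_prop))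
  have h : PT text := by
    unfold text
    fun_prop
  have e : ∀ a, (if h : (V a).numWitness = k a * ℓ a then
      SwapTest.verifier (V a) (fun j => ((T a).drop j).headD false) (m a) h else V₀ a).encode
      = if (V a).numWitness = k a * ℓ a then text a else (V₀ a).encode := by
    intro a
    split_ifs with ha
    · rw [SwapTest.encode_verifier, SwapTest.body_verifier]
      simp only [text, List.flatMap_assoc]
    · rfl
  simp only [e]
  fun_prop

end PT

end

/-! ### The two inclusions -/

section

open Turing Computability Enc

theorem sum_headD_drop (l : List Bool) (m : ℕ) :
    ∑ j ∈ Finset.range m, ((l.drop j).headD false).toNat * 2 ^ j = bitsVal l % 2 ^ m := by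
  induction m with
  | zero => simp [Nat.mod_one]
  | succ m ih =>
    have h := bitsVal_headD_tail (l.drop m)
    rw [bitsVal_drop] at h
    have h1 := Bool.toNat_lt ((l.drop m).headD false)
    rw [Finset.sum_range_succ, ih, Nat.mod_pow_succ, h, Nat.add_mul_mod_self_left, Nat.mod_eq_of_lt h1,
      mul_comm (2 ^ m)]

/-- The properties of the parameters of a class. -/
theorem StoqMA.parameters {ℓ k : ℕ → ℕ} {ε Δ : ℕ → ℝ} {I : PromiseProblem}
    (hI : I ∈ StoqMAGap ℓ k (fun n => 1 - ε n) Δ) (n : ℕ) : 0 ≤ ε n ∧ 0 < Δ n ∧ ε n + Δ n ≤ 1 / 2 := by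
  obtain ⟨-, -, -, h, -⟩ := hI
  obtain ⟨h1, h2, h3⟩ := h n
  refine ⟨?_, ?_, ?_⟩ <;> linarith

theorem ApproxPT.congr {r r' : ℕ → ℝ} (h : ApproxPT r) (e : ∀ n, r n = r' n) : ApproxPT r' :=
  funext e ▸ h

/-- A dyadic number from below a given real number. -/
theorem exists_dyadic_le {x : ℝ} {C m : ℕ} {F : List Bool} (hx : x < 1)
    (h0 : 0 ≤ x) (hF : |x * 2 ^ m - bitsVal F| ≤ C) :
    ∃ p : ℝ, p = ((∑ j ∈ Finset.range m,
        (((subBits F (encodeNat C)).drop j).headD false).toNat * 2 ^ j : ℕ) : ℝ) / 2 ^ m ∧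
      p ≤ x ∧ x - 2 * C / 2 ^ m ≤ p := by
  have h2 : (0 : ℝ) < 2 ^ m := by positivity
  obtain ⟨h3, h4⟩ := abs_le.1 hF
  -- The approximation may be too large by `C`. Subtracting `C` gives a lower bound and loses at
  -- most `2 C`.
  have hv : ((bitsVal F - C : ℕ) : ℝ) ≤ x * 2 ^ m ∧ x * 2 ^ m - 2 * C ≤ ((bitsVal F - C : ℕ) : ℝ) := by
    rcases le_total C (bitsVal F) with h | h
    · rw [Nat.cast_sub h]
      constructor <;> linarith
    · have : (bitsVal F : ℝ) ≤ C := by exact_mod_cast h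
      rw [Nat.sub_eq_zero_of_le h, Nat.cast_zero]
      exact ⟨by positivity, by linarith⟩
  refine ⟨_, rfl, ?_⟩
  -- The threshold fits into `m` digits, so reading only these loses nothing.
  have hlt : bitsVal F - C < 2 ^ m := by
    have : ((bitsVal F - C : ℕ) : ℝ) < 2 ^ m := hv.1.trans_lt (by nlinarith)
    exact_mod_cast this
  rw [sum_headD_drop, bitsVal_subBits, bitsVal_encodeNat, Nat.mod_eq_of_lt hlt]
  refine ⟨(div_le_iff₀ h2).2 hv.1, ?_⟩
  rw [le_div_iff₀ h2, sub_mul, div_mul_cancel₀ _ h2.ne']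
  exact hv.2

/-- Two proofs suffice. -/
theorem StoqMAGap_subset_two {k ℓ : ℕ → ℕ} (hk : PolyTimeNat k) {c : ℚ} (hc0 : 0 < c) (hc1 : c ≤ 1 / 3)
    {ε Δ : ℕ → ℝ} : StoqMAGap ℓ k (fun n => 1 - ε n) Δ ⊆ StoqMAGap (fun n => k n * ℓ n) (fun _ => 2)
      (fun n => 1 - c / 4 * Δ n * ε n) (fun n => c / 4 * Δ n ^ 2 / 2) := by
  intro I hI
  have hpar := StoqMA.parameters hI
  obtain ⟨hℓ, hc, hs, -, ⟨q, hq⟩, V, hV, hyes, hno⟩ := hI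
  replace hk : PT k := hk
  replace hℓ : PT ℓ := hℓ
  replace hV : PT V := hV
  have hγ0 : (0 : ℝ) < c / 4 := by
    have : (0 : ℝ) < c := by exact_mod_cast hc0
    positivity
  have hγ1 : (c / 4 : ℝ) ≤ 1 / 12 := by
    have : (c : ℝ) ≤ ((1 / 3 : ℚ) : ℝ) := by exact_mod_cast hc1
    push_cast at this
    linarith
  have hlam : ∀ n, 0 < c / 4 * Δ n ∧ c / 4 * Δ n ≤ Δ n / 12 ∧ c / 4 * Δ n ≤ 1 / 24 := fun n => by
    obtain ⟨h1, h2, h3⟩ := hpar n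
    refine ⟨mul_pos hγ0 h2, by nlinarith, by nlinarith⟩
  have hlamε : ∀ n, 0 ≤ c / 4 * Δ n * ε n ∧ c / 4 * Δ n * ε n ≤ 1 / 48 := fun n => by
    obtain ⟨h1, h2, h3⟩ := hpar n
    obtain ⟨h4, h5, h6⟩ := hlam n
    exact ⟨mul_nonneg h4.le h1, by nlinarith⟩
  have hgap : ∀ n, 0 < c / 4 * Δ n ^ 2 / 2 ∧ c / 4 * Δ n ^ 2 / 2 ≤ 1 / 96 := fun n => by
    obtain ⟨h1, h2, h3⟩ := hpar n
    obtain ⟨h4, h5, h6⟩ := hlam n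
    exact ⟨by positivity, by nlinarith⟩
  -- This inverse polynomial below the new gap serves twice: for the promise on the gap and for the
  -- precision of `p`.
  have hΔq : ∀ n : ℕ, c / 4 / (2 * ((q.eval n : ℕ) : ℝ) ^ 2) ≤ c / 4 * Δ n ^ 2 / 2 := fun n => by
    obtain ⟨h1, h2⟩ := hq n
    have h1' : (0 : ℝ) < (q.eval n : ℕ) := by exact_mod_cast h1
    have h3 : (1 / ((q.eval n : ℕ) : ℝ)) ^ 2 ≤ Δ n ^ 2 := by
      refine pow_le_pow_left₀ (by positivity) ?_ 2
      simpa using h2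
    have h4 := mul_le_mul_of_nonneg_left h3 hγ0.le
    have h5 : c / 4 / (2 * ((q.eval n : ℕ) : ℝ) ^ 2) = c / 4 * (1 / ((q.eval n : ℕ) : ℝ)) ^ 2 / 2 := by
      field_simp
    linarith
  -- efficient computability of the parameters
  have aε : ApproxPT ε := (ApproxPT.one.sub hc.approxPT fun n => by linarith [(hpar n).1]).congr
    fun n => by ring
  have aΔ : ApproxPT Δ := (hc.approxPT.sub hs.approxPT fun n => by linarith [(hpar n).2.1]).congr
    fun n => by ring
  have hΔ01 : ∀ n, 0 ≤ Δ n ∧ Δ n ≤ 1 := fun n => by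
    obtain ⟨h1, h2, h3⟩ := hpar n
    exact ⟨h2.le, by linarith⟩
  have alam : ApproxPT fun n => c / 4 * Δ n :=
    ((ApproxPT.const (q := c / 4) (by positivity) (by linarith)).mul aΔ
      (fun _ => by push_cast; exact ⟨hγ0.le, by linarith⟩) hΔ01).congr fun n => by push_cast; ring
  have alamε : ApproxPT fun n => c / 4 * Δ n * ε n :=
    alam.mul aε (fun n => ⟨(hlam n).1.le, by linarith [(hlam n).2.2]⟩)
      fun n => ⟨(hpar n).1, by linarith [(hpar n).2.1, (hpar n).2.2]⟩
  have agap : ApproxPT fun n => c / 4 * Δ n ^ 2 / 2 := by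
    -- The gap is computed as `(c / 8 * Δ) * Δ`, so that all factors stay in `[0, 1]`.
    have h1 : ApproxPT fun n => ((c / 8 : ℚ) : ℝ) * Δ n :=
      (ApproxPT.const (q := c / 8) (by positivity) (by linarith)).mul aΔ
        (fun _ => by push_cast; exact ⟨by linarith, by linarith⟩) hΔ01
    refine (h1.mul aΔ (fun n => ?_) hΔ01).congr fun n => by push_cast; ring
    push_cast
    obtain ⟨h1, h2, h3⟩ := hlam n
    exact ⟨by linarith, by linarith⟩
  have ac : ApproxPT fun n => 1 - c / 4 * Δ n * ε n :=
    ApproxPT.one.sub alamε fun n => by linarith [(hlamε n).2]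
  have as : ApproxPT fun n => 1 - c / 4 * Δ n * ε n - c / 4 * Δ n ^ 2 / 2 :=
    ac.sub agap fun n => by linarith [(hlamε n).2, (hgap n).2]
  -- the verifier
  obtain ⟨F, hF, C, hFC⟩ := alam
  -- With `m = N q²` coins, `2 ^ m ≥ m` gives a rounding loss `2 C / 2 ^ m ≤ γ / (2 q²)` as soon as
  -- `N ≥ 4 C / γ`. Similarly `M ≥ 2 / γ` makes `1 / ((M + 1) q²)` a lower bound for the gap.
  obtain ⟨N, hN⟩ := exists_nat_ge (4 * C / (c / 4 : ℝ))
  obtain ⟨M, hM⟩ := exists_nat_ge (2 / (c / 4 : ℝ))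
  let m : ℕ → ℕ := fun n => (Polynomial.C N * q ^ 2).eval n
  have hm : ∀ n, 2 * C / 2 ^ m n ≤ c / 4 * Δ n ^ 2 / 2 := fun n => by
    refine le_trans ?_ (hΔq n)
    have h1' : (0 : ℝ) < (q.eval n : ℕ) := by exact_mod_cast (hq n).1
    have h2 : ((m n : ℕ) : ℝ) ≤ 2 ^ m n := by exact_mod_cast Nat.lt_two_pow_self.le
    have h3 : ((m n : ℕ) : ℝ) = N * ((q.eval n : ℕ) : ℝ) ^ 2 := by simp [m]
    rw [div_le_div_iff₀ (by positivity) (by positivity)]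
    rw [div_le_iff₀ hγ0] at hN
    have h4 := mul_le_mul_of_nonneg_right hN (sq_nonneg ((q.eval n : ℕ) : ℝ))
    have h5 := mul_le_mul_of_nonneg_left h2 hγ0.le
    rw [h3] at h5
    linarith
  choose p hp hpl hlp using fun n => exists_dyadic_le (by linarith [(hlam n).2.2]) (hlam n).1.le
    (hFC n (m n))
  -- Outside the promise the witness register may have a wrong size; there any circuit will do.
  let V' : List Bool → StoqCircuit := fun x =>
    if h : (V x).numWitness = k x.length * ℓ x.length then
      SwapTest.verifier (V x) (fun j =>
        ((subBits (F x.length (m x.length)) (encodeNat C)).drop j).headD false) (m x.length) h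
    else V x
  have hlen : PT fun x : List Bool => x.length := by fun_prop
  have hmx : PT fun x : List Bool => m x.length := PT.eval _ hlen
  have hV' : PT V' := PT.verifier hV hV (hk.comp hlen) (hℓ.comp hlen) hmx
    (PT.subBits (hF.comp (hlen.prodMk hmx)) (PT.const _))
  have eV : ∀ {x} (h : (V x).numWitness = k x.length * ℓ x.length), V' x = SwapTest.verifier (V x) (fun j =>
      ((subBits (F x.length (m x.length)) (encodeNat C)).drop j).headD false) (m x.length) h :=
    fun h => dif_pos h
  refine ⟨hk.mul hℓ, ac.polyTimeReal, as.polyTimeReal, fun n => ?_, ⟨Polynomial.C (M + 1) * q ^ 2, fun n => ?_⟩,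
    V', hV', fun x hx => ?_, fun x hx => ?_⟩
  · have h1 := hlamε n
    have h2 := hgap n
    exact ⟨by linarith, by linarith, by linarith⟩
  · have h0 := (hq n).1
    have h1 : (0 : ℝ) < (q.eval n : ℕ) := by exact_mod_cast h0
    have e : (Polynomial.C (M + 1) * q ^ 2).eval n = (M + 1) * q.eval n ^ 2 := by simp
    rw [e]
    refine ⟨by positivity, ?_⟩
    rw [sub_sub_cancel]
    refine le_trans ?_ (hΔq n)
    push_cast
    rw [div_le_div_iff₀ (by positivity) (by positivity)]
    rw [div_le_iff₀ hγ0] at hM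
    have h4 := mul_le_mul_of_nonneg_right hM (sq_nonneg ((q.eval n : ℕ) : ℝ))
    nlinarith [mul_pos hγ0 (pow_pos h1 2)]
  · obtain ⟨h, ψ, hψ, hψc⟩ := hyes x hx
    rw [eV h]
    have h' := SwapTest.numWitness_verifier (V x) h (fun j =>
      ((subBits (F x.length (m x.length)) (encodeNat C)).drop j).headD false) (m x.length)
    obtain ⟨φ, hφ, hφc⟩ := SwapTest.acceptProb_verifier_of_yes (V x) h _ _ (hp x.length) hψ hψc h'
    refine ⟨h', φ, hφ, le_trans ?_ hφc⟩
    -- Completeness is `1 - p ε`, so `p` has to be rounded down, not up.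
    have := mul_le_mul_of_nonneg_right (hpl x.length) (hpar x.length).1
    linarith
  · obtain ⟨h, hψ⟩ := hno x hx
    rw [eV h]
    have h' := SwapTest.numWitness_verifier (V x) h (fun j =>
      ((subBits (F x.length (m x.length)) (encodeNat C)).drop j).headD false) (m x.length)
    refine ⟨h', fun φ hφ => ?_⟩
    obtain ⟨h1, h2, h3⟩ := hpar x.length
    refine (SwapTest.acceptProb_verifier_of_no (V x) h _ _ (hp x.length) h2.le h1 h3
      (hlam x.length).2.1 (hpl x.length) ?_ hψ h' hφ).trans_eq (by ring)
    -- The precision was chosen so that the rounding loss is at most `λ Δ / 2 = γ Δ² / 2`, as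
    -- `mixture_le` requires.
    have h4 := hm x.length
    have h5 := hlp x.length
    have : c / 4 * Δ x.length * Δ x.length / 2 = c / 4 * Δ x.length ^ 2 / 2 := by ring
    linarith

/-- Two proofs can be simulated by more proofs. -/
theorem StoqMAGap_two_subset {k ℓ : ℕ → ℕ} (hk : PolyTimeNat k) (hk2 : ∀ n, 2 ≤ k n) {c Δ : ℕ → ℝ} :
    StoqMAGap ℓ (fun _ => 2) c Δ ⊆ StoqMAGap ℓ k c Δ := by
  rintro I ⟨hℓ, hc, hs, hcs, hq, V, hV, hyes, hno⟩
  replace hk : PT k := hk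
  replace hℓ : PT ℓ := hℓ
  replace hV : PT V := hV
  have hlen : PT fun x : List Bool => x.length := by fun_prop
  refine ⟨hℓ, hc, hs, hcs, hq, fun x => (V x).pad ((k x.length - 2) * ℓ x.length),
    PT.pad hV (PT.mul (PT.sub (hk.comp hlen) (PT.const 2)) (hℓ.comp hlen)), fun x hx => ?_, fun x hx => ?_⟩
  · obtain ⟨h, ψ, hψ, hψc⟩ := hyes x hx
    exact ⟨(V x).numWitness_pad (hk2 _) h, (V x).acceptProb_pad_of_yes
      (Nat.add_sub_of_le (hk2 x.length)).symm rfl h _ hψ hψc⟩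
  · obtain ⟨h, hψ⟩ := hno x hx
    exact ⟨(V x).numWitness_pad (hk2 _) h, fun φ hφ => (V x).acceptProb_pad_of_no
      (Nat.add_sub_of_le (hk2 x.length)).symm rfl h _ hψ hφ⟩

end

theorem mainTheorem9 (k : ℕ → ℕ) (hk : ∀ n, 2 < k n) (hk_poly : PolyTimeNat k) :
    (∀ (c_prod : ℚ), 0 < c_prod → c_prod ≤ 1 / 3 →
      ∀ (ℓ : ℕ → ℕ) (ε Δ : ℕ → ℝ), (∀ n, 0 ≤ ε n ∧ ε n < 1 / 2) → (∀ n, 0 < Δ n) →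
        ∀ (γ : ℝ) (lam : ℕ → ℝ), γ = (c_prod : ℝ) / 4 → (∀ n, lam n = γ * Δ n) →
          StoqMAGap ℓ k (fun n => 1 - ε n) Δ ⊆
            StoqMAGap (fun n => k n * ℓ n) (fun _ => 2)
              (fun n => 1 - lam n * ε n) (fun n => γ * Δ n ^ 2 / 2)) ∧
    StoqMANegl k = StoqMANegl (fun _ => 2) := by
  refine ⟨fun c hc0 hc1 ℓ ε Δ _ _ γ lam hγ hlam => ?_, Set.Subset.antisymm ?_ ?_⟩
  · subst hγ
    obtain rfl : lam = fun n => c / 4 * Δ n := funext hlam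
    exact StoqMAGap_subset_two hk_poly hc0 hc1
  · rintro I ⟨ℓ, ε, Δ, hε, hI⟩
    -- The new completeness error is `λ ε` with `λ = Δ / 12 ≤ 1`, hence between 0 and `ε` and again
    -- negligible.
    refine ⟨_, fun n => ((1 / 3 : ℚ) : ℝ) / 4 * Δ n * ε n, _, ?_,
      StoqMAGap_subset_two hk_poly (by norm_num) le_rfl hI⟩
    have hpar := StoqMA.parameters hI
    refine Asymptotics.SuperpolynomialDecay.trans_eventuallyLE (.of_forall fun n => n.cast_nonneg)
      (Asymptotics.superpolynomialDecay_zero _ _) hε (.of_forall fun n => ?_) (.of_forall fun n => ?_)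
    · obtain ⟨h1, h2, h3⟩ := hpar n
      simp only [Pi.zero_apply]
      positivity
    · obtain ⟨h1, h2, h3⟩ := hpar n
      push_cast
      nlinarith
  · rintro I ⟨ℓ, ε, Δ, hε, hI⟩
    exact ⟨ℓ, ε, Δ, hε, StoqMAGap_two_subset hk_poly (fun n => (hk n).le) hI⟩
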